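/- Let $I\subset\mathbb R$ be an open interval (or, more generally, an open set). For $t\in I$ let $A_1(t)A_2(t)$ and $A_3(t)A_4(t)$ be two disjoint non-degenerate segments in $\mathbb C$, lying on two straight lines that do not depend on $t$, and let $G(t)$ be the exterior of their union in the Riemann sphere. Let $m(t)>0$ and let $f(\cdot,t)$ be a function with period $1$ which maps the strip $\{-m(t)<\operatorname{Im}z<0\}$ modulo the period $1$ (equivalently, the rectangle $\{0<\operatorname{Re}z<1,\ -m(t)<\operatorname{Im}z<0\}$ with identified vertical sides) conformally onto $G(t)$. It is continued analytically across the sides of the strip. Let $z_0^*(t)$ be a point of the strip with $f(z_0^*(t),t)=\infty$, and let $z_1(t),z_2(t)$ on the side $\operatorname{Im}z=0$ and $z_3(t),z_4(t)$ on the side $\operatorname{Im}z=-m(t)$ be points with $f(z_k(t),t)=A_k(t)$, $1\le k\le4$. Assume that the family is smooth: $m$, $z_0^*$ and $A_1,\dots,A_4$ are $C^1$ functions of $t\in I$, and each point $(t,z)$ with $t\in I$, $-m(t)\le\operatorname{Im}z\le0$, $z\notin z_0^*(t)+\mathbb Z$, has a neighbourhood in $\mathbb R\times\mathbb C$ in which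 $f$ is $C^1$ jointly in its two variables and holomorphic in the second one. Then, for every $t\in I$, $m(t)$ is the conformal module of $G(t)$, that is, $m(t)=\frac1{2\pi}\log\frac1q$ where $\{q<|\zeta|<1\}$ is the annulus conformally equivalent to $G(t)$; moreover $f''(z_k(t),t)\ne0$ for $1\le k\le4$, and $$\dot m(t)=\pi\sum_{j=1}^4\gamma_j(t),\qquad \gamma_k(t)=\frac{\dot A_k(t)}{f''(z_k(t),t)},$$ where the dot is the derivative in $t$ and the prime the derivative in $z$. -/

import Mathlib

open Set Filter Topology

/-- The annulus `{q < |ζ| < 1}`. -/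
def annulus (q : ℝ) : Set ℂ := {ζ | q < ‖ζ‖ ∧ ‖ζ‖ < 1}

/-- The exterior of the compact set `K ⊆ ℂ` in the Riemann sphere (so `∞` belongs to it) is the image
of an annulus `{q < |ζ| < 1}` with `m = log (1 / q) / (2 π)` under a conformal map `g`. The map `g` is
written as a holomorphic bijection of the annulus without one point `a` onto `ℂ ∖ K`, with `g a = ∞`. -/
def HasConformalModule (K : Set ℂ) (m : ℝ) : Prop :=
  ∃ q : ℝ, 0 < q ∧ q < 1 ∧ m = Real.log q⁻¹ / (2 * Real.pi) ∧
    ∃ (g : ℂ → ℂ) (a : ℂ), a ∈ annulus q ∧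
      DifferentiableOn ℂ g (annulus q \ {a}) ∧
      Tendsto g (𝓝[≠] a) (Bornology.cobounded ℂ) ∧
      BijOn g (annulus q \ {a}) Kᶜ

open Classical in
/-- The conformal module of the exterior of `K` in the Riemann sphere (`0` if that exterior is not
conformally equivalent to an annulus `{q < |ζ| < 1}` with `0 < q < 1`). -/
noncomputable def conformalModule (K : Set ℂ) : ℝ :=
  if h : ∃ m, HasConformalModule K m then h.choose else 0

/-- The horizontal strip `-m < Im z < 0`. -/
def strip (m : ℝ) : Set ℂ := {z | -m < z.im ∧ z.im < 0}

/-- The closed horizontal strip `-m ≤ Im z ≤ 0`. -/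
def closedStrip (m : ℝ) : Set ℂ := {z | -m ≤ z.im ∧ z.im ≤ 0}

/-- The points `p + n`, `n ∈ ℤ`. -/
def intTranslates (p : ℂ) : Set ℂ := {z | ∃ n : ℤ, z = p + n}

/-- The union of the two slits `A₁A₂` and `A₃A₄` (the indices `1, 2, 3, 4` are `0, 1, 2, 3` here). -/
def slits (A : Fin 4 → ℂ) : Set ℂ := segment ℝ (A 0) (A 1) ∪ segment ℝ (A 2) (A 3)

/-- `f` is a conformal map of the strip `-m < Im z < 0` modulo the period `1` (that is, of the
rectangle `0 < Re z < 1`, `-m < Im z < 0` with identified vertical sides) onto the exterior, in the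
Riemann sphere, of two disjoint slits `A₁A₂` and `A₃A₄`. It is continued analytically across the
sides of the strip; `p` is the point with `f p = ∞`; the points `z₁, z₂` of the upper side and
`z₃, z₄` of the lower side correspond to the endpoints of the slits. -/
structure IsSlitMap (m : ℝ) (A : Fin 4 → ℂ) (p : ℂ) (z : Fin 4 → ℂ) (f : ℂ → ℂ) : Prop where
  width_pos : 0 < m
  ne_one_two : A 0 ≠ A 1
  ne_three_four : A 2 ≠ A 3
  disjoint : Disjoint (segment ℝ (A 0) (A 1)) (segment ℝ (A 2) (A 3))
  periodic : Function.Periodic f 1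
  analytic : AnalyticOnNhd ℂ f (closedStrip m \ intTranslates p)
  pole_mem : p ∈ strip m
  pole : Tendsto f (𝓝[≠] p) (Bornology.cobounded ℂ)
  injective : ∀ u ∈ strip m \ intTranslates p, ∀ v ∈ strip m \ intTranslates p,
    f u = f v → ∃ n : ℤ, v = u + n
  image : f '' (strip m \ intTranslates p) = (slits A)ᶜ
  im_one : (z 0).im = 0
  im_two : (z 1).im = 0
  im_three : (z 2).im = -m
  im_four : (z 3).im = -m
  map_endpoint : ∀ k, f (z k) = A k

/-- A one-parameter family, over an open set `I` of parameters, of conformal maps `f t` onto the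
exteriors of two slits with endpoints `A k t` lying on two lines that do not depend on `t`. The family
is continuously differentiable: so are the strip width, the endpoints and the pole as functions of
`t`, and so is `f` jointly in the two variables, up to the sides of the strip and off the poles. -/
structure IsSmoothSlitFamily (I : Set ℝ) (m : ℝ → ℝ) (A : Fin 4 → ℝ → ℂ) (p : ℝ → ℂ)
    (z : Fin 4 → ℝ → ℂ) (f : ℝ → ℂ → ℂ) : Prop where
  isOpen : IsOpen I
  isSlitMap : ∀ t ∈ I, IsSlitMap (m t) (fun k => A k t) (p t) (fun k => z k t) (f t)
  fixed_line_one : ∃ L : AffineSubspace ℝ ℂ, Module.finrank ℝ L.direction = 1 ∧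
    ∀ t ∈ I, A 0 t ∈ L ∧ A 1 t ∈ L
  fixed_line_two : ∃ L : AffineSubspace ℝ ℂ, Module.finrank ℝ L.direction = 1 ∧
    ∀ t ∈ I, A 2 t ∈ L ∧ A 3 t ∈ L
  smooth_width : ContDiffOn ℝ 1 m I
  smooth_endpoint : ∀ k, ContDiffOn ℝ 1 (A k) I
  smooth_pole : ContDiffOn ℝ 1 p I
  smooth_map : ∀ t ∈ I, ∀ w ∈ closedStrip (m t) \ intTranslates (p t),
    ContDiffAt ℝ 1 (fun x : ℝ × ℂ => f x.1 x.2) (t, w) ∧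
      ∀ᶠ x : ℝ × ℂ in 𝓝 (t, w), DifferentiableAt ℂ (f x.1) x.2

/-- `γ_k(t) = Ȧ_k(t) / f''(z_k(t), t)`. -/
noncomputable def slitGamma (A : Fin 4 → ℝ → ℂ) (z : Fin 4 → ℝ → ℂ) (f : ℝ → ℂ → ℂ)
    (k : Fin 4) (t : ℝ) : ℂ :=
  deriv (A k) t / iteratedDeriv 2 (f t) (z k t)

/-! Fix t and consider the variation V = ∂_t f / f'. On the upper side every f(·, s) takes values in
one fixed line, so ∂_t f and f' are parallel to it and V is real. The lower side moves with the
parameter; differentiating along it shows that ∂_t f - i ṁ f' is parallel to the second line, hence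
Im V = ṁ there (`im_variation_upper_side`, `im_variation_lower_side`).

In the closed strip f' vanishes exactly at the z_k modulo 1, and to first order. Inside this is
injectivity. On a side, injectivity on a half disc excludes zeros of f - f(c) of order above two,
and the values taken just inside the strip continue the slit beyond f(c), so f(c) is an endpoint
(`critical_alternative`). At z_k the value ∂_t f is Ȧ_k, since a point of a sliding segment that
sits at its endpoint moves with the endpoint to first order (`deriv_param_endpoint`). So V has
residue γ_k at z_k, while at the pole of f its singularity is removable (`isBigO_variation_pole`).

Subtracting Σ γ_k π cot π(w - z_k) from V leaves a periodic holomorphic function on the closed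
strip, whose integrals over the two sides agree by Cauchy's theorem. The imaginary parts of these
integrals give ṁ = π Σ γ_k (`im_eq_pi_mul_sum_residues`).

That m is the conformal module has two halves. The map z ↦ exp(-2πiz) turns the strip modulo 1 into
an annulus (`hasConformalModule`). Conversely, a conformal map of the strip modulo 1 onto an annulus
is an exponential by the maximum principle, which determines the radius (`IsAnnulusParam.width_eq`).
-/

/-! ### Local normal form and critical points of maps injective on a half disc -/

/-- Near a point where it is not locally constant, an analytic function is a power `f c + b * w ^ n`
in a suitable analytic coordinate `w`. -/
theorem AnalyticAt.exists_eq_add_mul_pow {f : ℂ → ℂ} {c : ℂ} (hf : AnalyticAt ℂ f c)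
    (hne : ¬ ∀ᶠ z in 𝓝 c, f z = f c) :
    ∃ (n : ℕ) (b : ℂ) (ψ φ : ℂ → ℂ), n ≠ 0 ∧ b ≠ 0 ∧ ψ 0 = c ∧ AnalyticAt ℂ ψ 0 ∧ deriv ψ 0 = 1 ∧
      (∀ᶠ w in 𝓝 0, φ (ψ w) = w) ∧ ∀ᶠ w in 𝓝 0, f (ψ w) = f c + b * w ^ n := by
  have hF : AnalyticAt ℂ (fun z => f z - f c) c := hf.sub analyticAt_const
  have htop : analyticOrderAt (fun z => f z - f c) c ≠ ⊤ := by
    rw [Ne, analyticOrderAt_eq_top]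
    simpa [sub_eq_zero] using hne
  obtain ⟨g, hg, hg0, hfg⟩ := hF.analyticOrderAt_ne_top.1 htop
  set n := analyticOrderNatAt (fun z => f z - f c) c with hn
  have hn0 : n ≠ 0 := by
    intro h0
    have := hfg.self_of_nhds
    simp [h0] at this
    exact hg0 this.symm
  have hq : AnalyticAt ℂ (fun z => g z / g c) c := hg.div_const
  -- Dividing by g(c) puts the base near 1, where the principal branch of the root is analytic, and
  -- makes φ'(c) = 1.
  set h : ℂ → ℂ := fun z => (g z / g c) ^ ((n : ℂ)⁻¹) with hh
  have hhan : AnalyticAt ℂ h c := by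
    refine hq.cpow analyticAt_const ?_
    simp [hg0]
  have hhc : h c = 1 := by simp [hh, hg0]
  have hhpow : ∀ z, h z ^ n = g z / g c := fun z => Complex.cpow_nat_inv_pow _ hn0
  set φ : ℂ → ℂ := fun z => (z - c) * h z with hφ
  have hφan : AnalyticAt ℂ φ c := (analyticAt_id.sub analyticAt_const).mul hhan
  have hφc : φ c = 0 := by simp [hφ]
  have hφd : HasDerivAt φ 1 c := by
    have := ((hasDerivAt_id c).sub_const c).fun_mul hhan.differentiableAt.hasDerivAt
    simpa [hhc] using this
  have hd : deriv φ c ≠ 0 := by rw [hφd.deriv]; exact one_ne_zero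
  have hs : HasStrictDerivAt φ (deriv φ c) c := hφan.hasStrictDerivAt
  have hψan := hφan.analyticAt_localInverse hd
  set ψ := hφan.hasStrictDerivAt.localInverse _ _ _ hd with hψ
  have hψs : HasStrictDerivAt ψ (deriv φ c)⁻¹ (φ c) := hs.to_localInverse hd
  have hright : ∀ᶠ w in 𝓝 (φ c), φ (ψ w) = w := HasStrictDerivAt.eventually_right_inverse hs hd
  have hleft : ∀ᶠ z in 𝓝 c, ψ (φ z) = z := HasStrictDerivAt.eventually_left_inverse hs hd
  rw [hφc] at hψan hψs hright
  have hψ0 : ψ 0 = c := by rw [← hφc]; exact hleft.self_of_nhds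
  refine ⟨n, g c, ψ, φ, hn0, hg0, hψ0, hψan, ?_, hright, ?_⟩
  · rw [hψs.hasDerivAt.deriv, hφd.deriv, inv_one]
  · have hcont : Tendsto ψ (𝓝 0) (𝓝 c) := by
      have := hψan.continuousAt.tendsto
      rwa [hψ0] at this
    filter_upwards [hright, hcont.eventually hfg] with w hw1 hw2
    have h1 : f (ψ w) - f c = (ψ w - c) ^ n * g (ψ w) := by simpa using hw2
    have h2 : (ψ w - c) ^ n * (g (ψ w) / g c) = w ^ n := by
      rw [← hhpow, ← mul_pow]
      exact congrArg (· ^ n) hw1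
    rw [← h2, mul_div_assoc', mul_div_cancel₀ _ hg0, ← h1]
    ring

theorem eventually_im_lt_of_deriv_eq_one {ψ : ℂ → ℂ} (hψ : AnalyticAt ℂ ψ 0) (hd : deriv ψ 0 = 1)
    {ω : ℂ} (hω : ω.im < 0) : ∀ᶠ ε : ℝ in 𝓝[>] 0, (ψ (ε * ω)).im < (ψ 0).im := by
  have h0 : HasDerivAt ψ 1 ((fun ε : ℝ => (ε : ℂ) * ω) 0) := by
    simpa [hd] using hψ.differentiableAt.hasDerivAt
  have h1 : HasDerivAt (fun ε : ℝ => (ε : ℂ) * ω) ω 0 := by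
    simpa using (Complex.ofRealCLM.hasDerivAt (x := (0 : ℝ))).mul_const ω
  have h2 : HasDerivAt (fun ε : ℝ => ψ (ε * ω)) ω 0 := by
    simpa [Function.comp_def] using h0.scomp (0 : ℝ) h1
  have h3 : HasDerivAt (fun ε : ℝ => (ψ (ε * ω)).im) ω.im 0 :=
    Complex.imCLM.hasFDerivAt.comp_hasDerivAt (0 : ℝ) h2
  have h4 := (hasDerivAt_iff_tendsto_slope.1 h3).eventually_lt_const hω
  have h5 : ∀ᶠ ε : ℝ in 𝓝[>] 0, slope (fun ε : ℝ => (ψ (ε * ω)).im) 0 ε < 0 :=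
    h4.filter_mono (nhdsWithin_mono _ fun x hx => ne_of_gt hx)
  filter_upwards [h5, self_mem_nhdsWithin] with ε hε hpos
  rw [slope_def_field, sub_zero, div_neg_iff] at hε
  have hpos' : (0 : ℝ) < ε := hpos
  rcases hε with ⟨_, h⟩ | ⟨h, _⟩
  · linarith
  · simpa using h

theorem eventually_comp_mul_nhdsGT {p : ℂ → Prop} (hp : ∀ᶠ w in 𝓝 0, p w) (ω : ℂ) :
    ∀ᶠ ε : ℝ in 𝓝[>] 0, p (ε * ω) := by
  have : Tendsto (fun ε : ℝ => (ε : ℂ) * ω) (𝓝[>] 0) (𝓝 0) := by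
    have h : Continuous fun ε : ℝ => (ε : ℂ) * ω := by fun_prop
    simpa using (h.tendsto 0).mono_left nhdsWithin_le_nhds
  exact this.eventually hp

/-- The directions e^{±iπ/n} share the n-th power -1. Being distinct for n ≥ 2, they show that w ↦
w^n is not injective near 0; the half-disc argument uses the same pair turned by -i. -/
theorem exp_pi_div_I_ne {n : ℕ} (hn : 2 ≤ n) :
    Complex.exp (Real.pi / n * Complex.I) ≠ Complex.exp (-(Real.pi / n * Complex.I)) := by
  intro h
  have h1 := congrArg Complex.im h
  rw [← neg_mul] at h1
  have e1 : ((Real.pi / n : ℝ) : ℂ) = Real.pi / n := by push_cast; rfl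
  rw [← e1, ← Complex.ofReal_neg, Complex.exp_ofReal_mul_I_im, Complex.exp_ofReal_mul_I_im,
    Real.sin_neg] at h1
  have hn' : (2 : ℝ) ≤ n := by exact_mod_cast hn
  have : 0 < Real.sin (Real.pi / n) := by
    apply Real.sin_pos_of_pos_of_lt_pi
    · have := Real.pi_pos; positivity
    · rw [div_lt_iff₀ (by linarith)]
      nlinarith [Real.pi_pos]
  linarith

theorem exp_pi_div_I_pow {n : ℕ} (hn : n ≠ 0) (u : ℂ) :
    (u * Complex.exp (Real.pi / n * Complex.I)) ^ n =
      (u * Complex.exp (-(Real.pi / n * Complex.I))) ^ n := by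
  have hn' : (n : ℂ) ≠ 0 := by exact_mod_cast hn
  rw [mul_pow, mul_pow, ← Complex.exp_nat_mul, ← Complex.exp_nat_mul, mul_neg, Complex.exp_neg,
    ← mul_assoc, mul_div_cancel₀ _ hn', Complex.exp_pi_mul_I]
  norm_num

/-- The derivative of an injective holomorphic function does not vanish. -/
theorem AnalyticAt.deriv_ne_zero_of_injOn {f : ℂ → ℂ} {c : ℂ} (hf : AnalyticAt ℂ f c) {U : Set ℂ}
    (hU : U ∈ 𝓝 c) (hinj : InjOn f U) : deriv f c ≠ 0 := by
  intro hd
  have hne : ¬ ∀ᶠ z in 𝓝 c, f z = f c := by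
    intro h
    have h1 : ∀ᶠ z in 𝓝[≠] c, f z = f c ∧ z ∈ U :=
      (h.and hU).filter_mono nhdsWithin_le_nhds
    obtain ⟨z, ⟨hz, hzU⟩, hzc⟩ := (h1.and self_mem_nhdsWithin).exists
    exact hzc (hinj hzU (mem_of_mem_nhds hU) hz)
  obtain ⟨n, b, ψ, φ, hn, hb, hψ0, hψ, hψd, hφ, hfψ⟩ := hf.exists_eq_add_mul_pow hne
  have hn2 : 2 ≤ n := by
    by_contra hlt
    have hn1 : n = 1 := by omega
    have h1 : HasDerivAt (fun w => f (ψ w)) 0 0 := by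
      have hfd : HasDerivAt f 0 (ψ 0) := by
        rw [hψ0, ← hd]; exact hf.differentiableAt.hasDerivAt
      simpa [Function.comp_def] using hfd.comp (0 : ℂ) hψ.differentiableAt.hasDerivAt
    have h2 : HasDerivAt (fun w => f (ψ w)) b 0 := by
      have : HasDerivAt (fun w : ℂ => f c + b * w ^ n) b 0 := by
        simpa [hn1] using ((hasDerivAt_id (0 : ℂ)).const_mul b).const_add (f c)
      exact this.congr_of_eventuallyEq hfψ
    exact hb (h2.unique h1)
  have hψU : ∀ᶠ w in 𝓝 0, ψ w ∈ U := by
    have := hψ.continuousAt.tendsto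
    rw [hψ0] at this
    exact this.eventually hU
  have hall := hψU.and (hφ.and hfψ)
  obtain ⟨ε, ⟨⟨hU1, hφ1, hf1⟩, hU2, hφ2, hf2⟩, hε⟩ :=
    (((eventually_comp_mul_nhdsGT hall (Complex.exp (Real.pi / n * Complex.I))).and
      (eventually_comp_mul_nhdsGT hall (Complex.exp (-(Real.pi / n * Complex.I))))).and
      self_mem_nhdsWithin).exists
  have hε' : (ε : ℂ) ≠ 0 := by exact_mod_cast ne_of_gt hε
  have heq := hinj hU1 hU2 (by rw [hf1, hf2, exp_pi_div_I_pow hn])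
  have h3 := congrArg φ heq
  rw [hφ1, hφ2] at h3
  exact exp_pi_div_I_ne hn2 (mul_left_cancel₀ hε' h3)

/-- A function that is injective below the critical point `c` (near `c`) has a nondegenerate critical
point there, and takes the values `f c - f'' (c) / 2 * ε ^ 2` below `c`. -/
theorem AnalyticAt.of_injOn_lower_half {f : ℂ → ℂ} {c : ℂ} (hf : AnalyticAt ℂ f c) {U : Set ℂ}
    (hU : U ∈ 𝓝 c) (hinj : InjOn f (U ∩ {z | z.im < c.im})) (hd : deriv f c = 0) :
    iteratedDeriv 2 f c ≠ 0 ∧ ∀ V ∈ 𝓝 c, ∀ᶠ ε : ℝ in 𝓝[>] 0, ∃ z ∈ V, z.im < c.im ∧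
      f z = f c - iteratedDeriv 2 f c / 2 * ε ^ 2 := by
  have hne : ¬ ∀ᶠ z in 𝓝 c, f z = f c := by
    intro h
    have ht : ∀ ω : ℂ, Tendsto (fun ε : ℝ => c + ε * ω) (𝓝[>] 0) (𝓝 c) := by
      intro ω
      have h : Continuous fun ε : ℝ => c + (ε : ℂ) * ω := by fun_prop
      simpa using (h.tendsto 0).mono_left nhdsWithin_le_nhds
    -- A locally constant f would agree at c - iε and c - 2iε, two distinct points below c.
    obtain ⟨ε, ⟨⟨h1, h2⟩, h3, h4⟩, hε⟩ := (((ht (-Complex.I)).eventually (h.and hU)).and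
      ((ht (-2 * Complex.I)).eventually (h.and hU)) |>.and self_mem_nhdsWithin).exists
    have hε' : (0 : ℝ) < ε := hε
    have := hinj ⟨h2, by simp [hε']⟩ ⟨h4, by simp [hε']⟩ (h1.trans h3.symm)
    have := congrArg Complex.im this
    simp at this
    linarith
  obtain ⟨n, b, ψ, φ, hn, hb, hψ0, hψ, hψd, hφ, hfψ⟩ := hf.exists_eq_add_mul_pow hne
  have hψt : Tendsto ψ (𝓝 0) (𝓝 c) := by
    have := hψ.continuousAt.tendsto
    rwa [hψ0] at this
  have hder : ∀ᶠ w in 𝓝 0, deriv f (ψ w) * deriv ψ w = b * (n * w ^ (n - 1)) := by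
    filter_upwards [hfψ.eventually_nhds, hψ.eventually_analyticAt,
      hψt.eventually hf.eventually_analyticAt] with w h1 h2 h3
    have h4 : HasDerivAt (fun w => f (ψ w)) (deriv f (ψ w) * deriv ψ w) w :=
      h3.differentiableAt.hasDerivAt.comp w h2.differentiableAt.hasDerivAt
    have h5 : HasDerivAt (fun w => f (ψ w)) (b * (n * w ^ (n - 1))) w := by
      have : HasDerivAt (fun w : ℂ => f c + b * w ^ n) (b * (n * w ^ (n - 1))) w :=
        ((hasDerivAt_pow n w).const_mul b).const_add (f c)
      exact this.congr_of_eventuallyEq h1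
    exact h4.unique h5
  have hn1 : n ≠ 1 := by
    rintro rfl
    have := hder.self_of_nhds
    simp [hψ0, hd] at this
    exact hb this.symm
  have hψU : ∀ V ∈ 𝓝 c, ∀ᶠ w in 𝓝 0, ψ w ∈ V := fun V hV => hψt.eventually hV
  -- For n ≥ 3 both rays -i·e^{±iπ/n} point into the lower half plane, because cos(π/n) > 0, and f
  -- takes equal values on them.
  have hn2 : n = 2 := by
    by_contra hn2
    have hn3 : 3 ≤ n := by omega
    have hcos : 0 < Real.cos (Real.pi / n) := by
      have hn' : (3 : ℝ) ≤ n := by exact_mod_cast hn3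
      have := Real.pi_pos
      apply Real.cos_pos_of_mem_Ioo
      constructor
      · have : 0 < Real.pi / n := by positivity
        linarith
      · rw [div_lt_div_iff₀ (by linarith) (by norm_num)]
        nlinarith
    have e1 : ((Real.pi / n : ℝ) : ℂ) = Real.pi / n := by push_cast; rfl
    have hω1 : (-Complex.I * Complex.exp (Real.pi / n * Complex.I)).im < 0 := by
      rw [← e1, Complex.mul_im, Complex.exp_ofReal_mul_I_re]
      simpa using hcos
    have hω2 : (-Complex.I * Complex.exp (-(Real.pi / n * Complex.I))).im < 0 := by
      rw [← neg_mul, ← e1, ← Complex.ofReal_neg, Complex.mul_im, Complex.exp_ofReal_mul_I_re]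
      simpa using hcos
    have hall := (hψU U hU).and (hφ.and hfψ)
    obtain ⟨ε, ⟨⟨⟨hU1, hφ1, hf1⟩, hU2, hφ2, hf2⟩, hi1, hi2⟩, hε⟩ :=
      (((eventually_comp_mul_nhdsGT hall (-Complex.I * Complex.exp (Real.pi / n * Complex.I))).and
        (eventually_comp_mul_nhdsGT hall
          (-Complex.I * Complex.exp (-(Real.pi / n * Complex.I))))).and
        ((eventually_im_lt_of_deriv_eq_one hψ hψd hω1).and
          (eventually_im_lt_of_deriv_eq_one hψ hψd hω2)) |>.and self_mem_nhdsWithin).exists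
    rw [hψ0] at hi1 hi2
    have hε' : (ε : ℂ) ≠ 0 := by exact_mod_cast ne_of_gt hε
    have heq := hinj ⟨hU1, hi1⟩ ⟨hU2, hi2⟩ (by
      rw [hf1, hf2, ← mul_assoc, ← mul_assoc, exp_pi_div_I_pow hn])
    have h3 := congrArg φ heq
    rw [hφ1, hφ2] at h3
    exact exp_pi_div_I_ne (by omega : 2 ≤ n)
      (mul_left_cancel₀ (neg_ne_zero.2 Complex.I_ne_zero) (mul_left_cancel₀ hε' h3))
  subst hn2
  -- Differentiating f'(ψ)ψ' = 2bw at 0; the term with ψ'' drops out because f'(c) = 0.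
  have hb2 : iteratedDeriv 2 f c = 2 * b := by
    rw [iteratedDeriv_succ, iteratedDeriv_one]
    have h1 : HasDerivAt (fun w => deriv f (ψ w) * deriv ψ w) (deriv (deriv f) c) 0 := by
      have h2 : HasDerivAt (deriv f) (deriv (deriv f) c) (ψ 0) := by
        rw [hψ0]; exact hf.deriv.differentiableAt.hasDerivAt
      have h3 := (h2.comp (0 : ℂ) hψ.differentiableAt.hasDerivAt).fun_mul
        hψ.deriv.differentiableAt.hasDerivAt
      simpa [hψd, hψ0, hd, Function.comp_def] using h3
    have h4 : HasDerivAt (fun w => deriv f (ψ w) * deriv ψ w) (2 * b) 0 := by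
      have : HasDerivAt (fun w : ℂ => b * ((2 : ℕ) * w ^ (2 - 1))) (2 * b) 0 := by
        have := ((hasDerivAt_id (0 : ℂ)).const_mul 2).const_mul b
        simpa [mul_comm] using this
      exact this.congr_of_eventuallyEq hder
    exact h1.unique h4
  refine ⟨by rw [hb2]; exact mul_ne_zero two_ne_zero hb, fun V hV => ?_⟩
  -- The witness is ψ(-iε), where b·w² = -b·ε².
  filter_upwards [eventually_comp_mul_nhdsGT ((hψU V hV).and hfψ) (-Complex.I),
    eventually_im_lt_of_deriv_eq_one hψ hψd (ω := -Complex.I) (by simp)] with ε h1 h2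
  refine ⟨_, h1.1, by rwa [hψ0] at h2, ?_⟩
  rw [h1.2, hb2, mul_pow, neg_sq, Complex.I_sq]
  ring

/-! ### Topology of the strip and of the set of poles -/

theorem isClosed_intTranslates (p : ℂ) : IsClosed (intTranslates p) := by
  have h : intTranslates p = (fun z => z - p) ⁻¹' range ((↑) : ℤ → ℂ) := by
    ext z
    simp only [intTranslates, mem_ofPred_eq, mem_preimage, mem_range]
    exact ⟨fun ⟨n, hn⟩ => ⟨n, by rw [hn]; ring⟩, fun ⟨n, hn⟩ => ⟨n, by rw [hn]; ring⟩⟩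
  rw [h]
  exact Complex.isClosed_range_intCast.preimage (by fun_prop)

theorem mem_intTranslates_self (p : ℂ) : p ∈ intTranslates p := ⟨0, by simp⟩

theorem add_int_mem_intTranslates_iff {p z : ℂ} (n : ℤ) :
    z + n ∈ intTranslates p ↔ z ∈ intTranslates p := by
  constructor
  · rintro ⟨k, hk⟩
    exact ⟨k - n, by push_cast; linear_combination hk⟩
  · rintro ⟨k, hk⟩
    exact ⟨k + n, by push_cast; linear_combination hk⟩

theorem im_eq_of_mem_intTranslates {p z : ℂ} (h : z ∈ intTranslates p) : z.im = p.im := by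
  obtain ⟨n, rfl⟩ := h
  simp

theorem isOpen_strip (m : ℝ) : IsOpen (strip m) :=
  (isOpen_lt continuous_const Complex.continuous_im).inter
    (isOpen_lt Complex.continuous_im continuous_const)

theorem isOpen_strip_diff (m : ℝ) (p : ℂ) : IsOpen (strip m \ intTranslates p) :=
  (isOpen_strip m).sdiff (isClosed_intTranslates p)

theorem closure_strip {m : ℝ} (hm : 0 < m) : closure (strip m) = closedStrip m := by
  have h1 : strip m = Complex.im ⁻¹' Ioo (-m) 0 := rfl
  have h2 : closedStrip m = Complex.im ⁻¹' Icc (-m) 0 := rfl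
  rw [h1, Complex.closure_preimage_im, closure_Ioo (by linarith), h2]

theorem strip_subset_closedStrip (m : ℝ) : strip m ⊆ closedStrip m :=
  fun _ h => ⟨h.1.le, h.2.le⟩

/-- On a horizontal line on which a holomorphic function takes values in a line of direction `u`, so
does its derivative. -/
theorem im_deriv_div_eq_zero {g : ℂ → ℂ} {c : ℂ} {a u : ℂ} (hg : DifferentiableAt ℂ g c)
    (h : ∀ s : ℝ, ((g (c + s) - a) / u).im = 0) : (deriv g c / u).im = 0 := by
  have h0 : HasDerivAt g (deriv g c) (c + ((0 : ℝ) : ℂ)) := by simpa using hg.hasDerivAt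
  have h1 : HasDerivAt (fun s : ℝ => c + (s : ℂ)) 1 0 := by
    simpa using (Complex.ofRealCLM.hasDerivAt (x := (0 : ℝ))).const_add c
  have h2 : HasDerivAt (fun s : ℝ => (g (c + s) - a) / u) (deriv g c / u) 0 := by
    simpa [Function.comp_def] using ((h0.scomp (0 : ℝ) h1).sub_const a).div_const u
  have h3 := Complex.imCLM.hasFDerivAt.comp_hasDerivAt (0 : ℝ) h2
  have h4 : (Complex.imCLM ∘ fun s : ℝ => (g (c + s) - a) / u) = fun _ => 0 := funext h
  rw [h4] at h3
  exact h3.unique (hasDerivAt_const _ _)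

theorem mem_segment_iff_exists_add {a b x : ℂ} :
    x ∈ segment ℝ a b ↔ ∃ θ : ℝ, θ ∈ Icc (0 : ℝ) 1 ∧ x = a + θ * (b - a) := by
  rw [segment_eq_image']
  simp only [mem_image, Complex.real_smul]
  exact ⟨fun ⟨θ, h, e⟩ => ⟨θ, h, e.symm⟩, fun ⟨θ, h, e⟩ => ⟨θ, h, e.symm⟩⟩

/-! ### Boundary behaviour of a slit map -/

namespace IsSlitMap

variable {m : ℝ} {A : Fin 4 → ℂ} {p : ℂ} {z : Fin 4 → ℂ} {f : ℂ → ℂ}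

theorem notMem_intTranslates_of_notMem_strip (h : IsSlitMap m A p z f) {x : ℂ} (hx : x ∉ strip m) :
    x ∉ intTranslates p := by
  intro hp
  have := im_eq_of_mem_intTranslates hp
  exact hx ⟨by rw [this]; exact h.pole_mem.1, by rw [this]; exact h.pole_mem.2⟩

theorem notMem_poles_of_im_eq_zero (h : IsSlitMap m A p z f) {x : ℂ} (hx : x.im = 0) :
    x ∉ intTranslates p :=
  h.notMem_intTranslates_of_notMem_strip fun hs => hs.2.ne hx

theorem mem_closedStrip_of_im_eq_zero (h : IsSlitMap m A p z f) {x : ℂ} (hx : x.im = 0) :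
    x ∈ closedStrip m :=
  ⟨by rw [hx]; linarith [h.width_pos], hx.le⟩

theorem analyticAt_of_im_eq_zero (h : IsSlitMap m A p z f) {x : ℂ} (hx : x.im = 0) :
    AnalyticAt ℂ f x :=
  h.analytic x ⟨h.mem_closedStrip_of_im_eq_zero hx, h.notMem_poles_of_im_eq_zero hx⟩

theorem analyticAt (h : IsSlitMap m A p z f) {x : ℂ} (hx : x ∈ strip m \ intTranslates p) :
    AnalyticAt ℂ f x :=
  h.analytic x ⟨strip_subset_closedStrip m hx.1, hx.2⟩

/-- Two distinct points congruent modulo 1 cannot lie in one open ball of radius 1/2. -/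
theorem exists_nhds_injOn (h : IsSlitMap m A p z f) (x : ℂ) :
    ∃ U ∈ 𝓝 x, InjOn f (U ∩ (strip m \ intTranslates p)) := by
  refine ⟨Metric.ball x (1 / 2), Metric.ball_mem_nhds _ (by norm_num), ?_⟩
  rintro u ⟨hu, hu'⟩ v ⟨hv, hv'⟩ huv
  obtain ⟨n, hn⟩ := h.injective u hu' v hv' huv
  have h1 : dist u v < 1 := by
    have := dist_triangle_right u v x
    rw [Metric.mem_ball] at hu hv
    linarith
  rw [hn, dist_self_add_right, Complex.norm_intCast] at h1
  have h2 : n = 0 := by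
    have : |n| < 1 := by exact_mod_cast h1
    exact Int.abs_lt_one_iff.1 this
  rw [hn, h2]; simp

theorem deriv_ne_zero (h : IsSlitMap m A p z f) {x : ℂ} (hx : x ∈ strip m \ intTranslates p) :
    deriv f x ≠ 0 := by
  obtain ⟨U, hU, hinj⟩ := h.exists_nhds_injOn x
  exact (h.analyticAt hx).deriv_ne_zero_of_injOn
    (inter_mem hU ((isOpen_strip_diff m p).mem_nhds hx)) hinj

/-- Otherwise f x = f w with w inside the strip. As f is open at w, values taken in the strip near x
are also taken near w; but points near x and points near w have different heights, so they are
incongruent. -/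
theorem map_mem_slits (h : IsSlitMap m A p z f) {x : ℂ} (hx : x ∈ closedStrip m)
    (hx' : x ∉ strip m) : f x ∈ slits A := by
  by_contra hns
  have hp := h.notMem_intTranslates_of_notMem_strip hx'
  have hmem : f x ∈ f '' (strip m \ intTranslates p) := by rw [h.image]; exact hns
  obtain ⟨w, hw, hfw⟩ := hmem
  have hne : w.im ≠ x.im := fun he => hx' ⟨he ▸ hw.1.1, he ▸ hw.1.2⟩
  -- Half the height difference, so that heights within d of the two points cannot agree.
  set d : ℝ := |w.im - x.im| / 2 with hd
  have hdpos : 0 < d := by have := abs_pos.2 (sub_ne_zero.2 hne); positivity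
  set V : Set ℂ := (strip m \ intTranslates p) ∩ {v | |v.im - w.im| < d} with hV
  have hVn : V ∈ 𝓝 w := by
    refine inter_mem ((isOpen_strip_diff m p).mem_nhds hw) ?_
    have : IsOpen {v : ℂ | |v.im - w.im| < d} := isOpen_lt (by fun_prop) continuous_const
    exact this.mem_nhds (by simpa using hdpos)
  have hmap : f '' V ∈ 𝓝 (f x) := by
    rw [← hfw, ← (h.analyticAt hw).hasStrictDerivAt.map_nhds_eq (h.deriv_ne_zero hw)]
    exact image_mem_map hVn
  have hcont := (h.analytic x ⟨hx, hp⟩).continuousAt.eventually_mem hmap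
  have hnear : ∀ᶠ y in 𝓝 x, |y.im - x.im| < d := by
    have : IsOpen {v : ℂ | |v.im - x.im| < d} := isOpen_lt (by fun_prop) continuous_const
    exact this.mem_nhds (by simpa using hdpos)
  have hfreq : ∃ᶠ y in 𝓝 x, y ∈ strip m := by
    rw [← mem_closure_iff_frequently, closure_strip h.width_pos]
    exact hx
  obtain ⟨y, hys, ⟨v, ⟨hv, hvd⟩, hfv⟩, hyd, hyp⟩ := (hfreq.and_eventually (hcont.and
    (hnear.and ((isClosed_intTranslates p).isOpen_compl.mem_nhds hp)))).exists
  obtain ⟨n, hn⟩ := h.injective v hv y ⟨hys, hyp⟩ hfv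
  have him : y.im = v.im := by simp [hn]
  have hvd' : |v.im - w.im| < d := hvd
  rw [him] at hyd
  have h1 := abs_sub_le w.im v.im x.im
  rw [abs_sub_comm w.im v.im] at h1
  linarith

/-- The image of the side is connected and lies in two disjoint closed segments, one of which it
meets at f(z_1). -/
theorem map_mem_segment (h : IsSlitMap m A p z f) {x : ℂ} (hx : x.im = 0) :
    f x ∈ segment ℝ (A 0) (A 1) := by
  have hconn : IsPreconnected (f '' (Complex.im ⁻¹' {0})) := by
    refine IsPreconnected.image ?_ f fun y hy =>
      (h.analyticAt_of_im_eq_zero hy).continuousAt.continuousWithinAt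
    exact ((convex_singleton (0 : ℝ)).linear_preimage Complex.imLm).isPreconnected
  have hsub : f '' (Complex.im ⁻¹' {0}) ⊆ segment ℝ (A 0) (A 1) ∪ segment ℝ (A 2) (A 3) := by
    rintro _ ⟨y, hy, rfl⟩
    exact h.map_mem_slits (h.mem_closedStrip_of_im_eq_zero hy) fun hs => hs.2.ne hy
  have hcl : ∀ a b : ℂ, IsClosed (segment ℝ a b) := fun a b => by
    rw [segment_eq_image']
    exact (isCompact_Icc.image (by fun_prop)).isClosed
  have := isPreconnected_closed_iff.1 hconn _ _ (hcl (A 0) (A 1)) (hcl (A 2) (A 3)) hsub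
  by_contra hn
  have hx2 : f x ∈ segment ℝ (A 2) (A 3) :=
    (hsub (mem_image_of_mem f hx)).resolve_left hn
  have h0 : f (z 0) ∈ segment ℝ (A 0) (A 1) := by
    rw [h.map_endpoint]; exact left_mem_segment ℝ _ _
  obtain ⟨y, -, hy1, hy2⟩ := this ⟨f (z 0), mem_image_of_mem f h.im_one, h0⟩
    ⟨f x, mem_image_of_mem f hx, hx2⟩
  exact h.disjoint.ne_of_mem hy1 hy2 rfl

/-- The rotation of the strip by a half turn exchanges the two slits. -/
theorem flip (h : IsSlitMap m A p z f) :
    IsSlitMap m (fun k => A (k + 2)) (-p - m * Complex.I) (fun k => -z (k + 2) - m * Complex.I)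
      (fun w => f (-w - m * Complex.I)) := by
  have hstrip : ∀ w, -w - m * Complex.I ∈ strip m ↔ w ∈ strip m := by
    intro w
    simp only [strip, mem_ofPred_eq, Complex.sub_im, Complex.neg_im, Complex.mul_im,
      Complex.ofReal_re, Complex.ofReal_im, Complex.I_im, Complex.I_re]
    constructor <;> rintro ⟨h1, h2⟩ <;> constructor <;> linarith
  have hpole : ∀ w, -w - m * Complex.I ∈ intTranslates p ↔
      w ∈ intTranslates (-p - m * Complex.I) := by
    intro w
    constructor
    · rintro ⟨n, hn⟩
      exact ⟨-n, by push_cast; linear_combination -hn⟩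
    · rintro ⟨n, hn⟩
      exact ⟨-n, by push_cast; linear_combination -hn⟩
  have hinv : ∀ w : ℂ, -(-w - m * Complex.I) - m * Complex.I = w := fun w => by ring
  refine ⟨h.width_pos, h.ne_three_four, h.ne_one_two, h.disjoint.symm, ?_, ?_, ?_, ?_, ?_, ?_,
    ?_, ?_, ?_, ?_, ?_⟩
  · intro w
    have := h.periodic (-(w + 1) - m * Complex.I)
    simp only
    rw [← this]
    congr 1
    ring
  · rintro w ⟨hw, hw'⟩
    have h1 : AnalyticAt ℂ f (-w - m * Complex.I) := by
      refine h.analytic _ ⟨?_, fun hn => hw' ((hpole w).1 hn)⟩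
      simp only [closedStrip, mem_ofPred_eq, Complex.sub_im, Complex.neg_im, Complex.mul_im,
        Complex.ofReal_re, Complex.ofReal_im, Complex.I_im, Complex.I_re] at hw ⊢
      constructor <;> linarith [hw.1, hw.2]
    exact h1.fun_comp (f := fun w => -w - m * Complex.I) (by fun_prop)
  · exact (hstrip _).1 (by rw [hinv]; exact h.pole_mem)
  · refine h.pole.comp ?_
    refine tendsto_nhdsWithin_iff.2 ⟨?_, ?_⟩
    · have : Continuous fun w : ℂ => -w - m * Complex.I := by fun_prop
      have := (this.tendsto (-p - m * Complex.I))
      rw [hinv] at this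
      exact this.mono_left nhdsWithin_le_nhds
    · filter_upwards [self_mem_nhdsWithin] with w hw hw'
      exact hw (by rw [mem_singleton_iff] at hw' ⊢; rw [← hw']; ring)
  · rintro u ⟨hu, hu'⟩ v ⟨hv, hv'⟩ huv
    obtain ⟨n, hn⟩ := h.injective _ ⟨(hstrip u).2 hu, fun hc => hu' ((hpole u).1 hc)⟩ _
      ⟨(hstrip v).2 hv, fun hc => hv' ((hpole v).1 hc)⟩ huv
    exact ⟨-n, by push_cast; linear_combination -hn⟩
  · have : slits (fun k => A (k + 2)) = slits A := union_comm _ _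
    rw [this, ← h.image]
    ext y
    constructor
    · rintro ⟨w, ⟨hw, hw'⟩, rfl⟩
      exact ⟨_, ⟨(hstrip w).2 hw, fun hc => hw' ((hpole w).1 hc)⟩, rfl⟩
    · rintro ⟨w, ⟨hw, hw'⟩, rfl⟩
      refine ⟨-w - m * Complex.I, ⟨(hstrip w).2 hw, fun hc => hw' ?_⟩, ?_⟩
      · have := (hpole _).2 hc
        rwa [hinv] at this
      · simp only [hinv]
  · simp [h.im_three]
  · simp [h.im_four]
  · simp [h.im_one]
  · simp [h.im_two]
  · intro k
    simp only [hinv, h.map_endpoint]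

end IsSlitMap

/-! ### Critical points on the sides of the strip -/

namespace IsSlitMap

variable {m : ℝ} {A : Fin 4 → ℂ} {p : ℂ} {z : Fin 4 → ℂ} {f : ℂ → ℂ}

theorem im_map_div_eq_zero (h : IsSlitMap m A p z f) {x : ℂ} (hx : x.im = 0) :
    ((f x - A 0) / (A 1 - A 0)).im = 0 := by
  obtain ⟨θ, -, hθ⟩ := mem_segment_iff_exists_add.1 (h.map_mem_segment hx)
  rw [hθ, add_sub_cancel_left, mul_div_cancel_right₀ _ (sub_ne_zero.2 h.ne_one_two.symm),
    Complex.ofReal_im]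

theorem im_deriv_div_eq_zero_of_im_eq_zero (h : IsSlitMap m A p z f) {x : ℂ} (hx : x.im = 0) :
    (deriv f x / (A 1 - A 0)).im = 0 :=
  im_deriv_div_eq_zero (a := A 0) (h.analyticAt_of_im_eq_zero hx).differentiableAt fun s =>
    h.im_map_div_eq_zero (by simpa using hx)

theorem im_iteratedDeriv_div_eq_zero (h : IsSlitMap m A p z f) {x : ℂ} (hx : x.im = 0) :
    (iteratedDeriv 2 f x / (A 1 - A 0)).im = 0 := by
  rw [iteratedDeriv_succ, iteratedDeriv_one]
  refine im_deriv_div_eq_zero (a := 0) (h.analyticAt_of_im_eq_zero hx).deriv.differentiableAt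
    fun s => ?_
  rw [sub_zero]
  exact h.im_deriv_div_eq_zero_of_im_eq_zero (by simpa using hx)

/-- At a point of the upper side that is mapped to an endpoint of the slit, `f` is critical. -/
theorem deriv_eq_zero_of_map_eq (h : IsSlitMap m A p z f) {x : ℂ} (hx : x.im = 0)
    (he : f x = A 0 ∨ f x = A 1) : deriv f x = 0 := by
  have hu : A 1 - A 0 ≠ 0 := sub_ne_zero.2 h.ne_one_two.symm
  have h0 : HasDerivAt f (deriv f x) (x + ((0 : ℝ) : ℂ)) := by
    simpa using (h.analyticAt_of_im_eq_zero hx).differentiableAt.hasDerivAt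
  have h1 : HasDerivAt (fun s : ℝ => x + (s : ℂ)) 1 0 := by
    simpa using (Complex.ofRealCLM.hasDerivAt (x := (0 : ℝ))).const_add x
  have h2 : HasDerivAt (fun s : ℝ => (f (x + s) - A 0) / (A 1 - A 0))
      (deriv f x / (A 1 - A 0)) 0 := by
    simpa [Function.comp_def] using ((h0.scomp (0 : ℝ) h1).sub_const (A 0)).div_const (A 1 - A 0)
  have h3 : HasDerivAt (fun s : ℝ => ((f (x + s) - A 0) / (A 1 - A 0)).re)
      (deriv f x / (A 1 - A 0)).re 0 := Complex.reCLM.hasFDerivAt.comp_hasDerivAt (0 : ℝ) h2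
  have h4 : ∀ s : ℝ, ((f (x + s) - A 0) / (A 1 - A 0)).re ∈ Icc (0 : ℝ) 1 := fun s => by
    obtain ⟨θ, hθ, hθ'⟩ := mem_segment_iff_exists_add.1
      (h.map_mem_segment (x := x + s) (by simpa using hx))
    rw [hθ', add_sub_cancel_left, mul_div_cancel_right₀ _ hu, Complex.ofReal_re]
    exact hθ
  -- The normalized coordinate along the slit stays in [0, 1] and attains an extremum at x.
  have h5 : (deriv f x / (A 1 - A 0)).re = 0 := by
    rcases he with he | he
    · refine IsLocalMin.hasDerivAt_eq_zero (.of_forall fun s => ?_) h3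
      have : ((f (x + ((0 : ℝ) : ℂ)) - A 0) / (A 1 - A 0)).re = 0 := by simp [he]
      rw [this]
      exact (h4 s).1
    · refine IsLocalMax.hasDerivAt_eq_zero (.of_forall fun s => ?_) h3
      have : ((f (x + ((0 : ℝ) : ℂ)) - A 0) / (A 1 - A 0)).re = 1 := by simp [he, div_self hu]
      rw [this]
      exact (h4 s).2
  have h6 := Complex.ext (w := 0) h5 (h.im_deriv_div_eq_zero_of_im_eq_zero hx)
  exact (div_eq_zero_iff.1 h6).resolve_right hu

/-- Near x the strip is the half disc below x, free of poles and far from the lower side, so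
`AnalyticAt.of_injOn_lower_half` applies. -/
theorem exists_preimage_of_critical (h : IsSlitMap m A p z f) {x : ℂ} (hx : x.im = 0)
    (hd : deriv f x = 0) : iteratedDeriv 2 f x ≠ 0 ∧ ∀ V ∈ 𝓝 x, ∀ᶠ ε : ℝ in 𝓝[>] 0,
      ∃ w ∈ V, w ∈ strip m \ intTranslates p ∧
        f w = f x - iteratedDeriv 2 f x / 2 * ε ^ 2 := by
  obtain ⟨U, hU, hinj⟩ := h.exists_nhds_injOn x
  set W : Set ℂ := {w : ℂ | -m < w.im} ∩ (intTranslates p)ᶜ with hW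
  have hWn : W ∈ 𝓝 x := by
    refine inter_mem (?_ : {w : ℂ | -m < w.im} ∈ 𝓝 x)
      ((isClosed_intTranslates p).isOpen_compl.mem_nhds (h.notMem_poles_of_im_eq_zero hx))
    refine (isOpen_lt continuous_const Complex.continuous_im).mem_nhds ?_
    simpa [hx] using h.width_pos
  have hsub : ∀ w ∈ W, w.im < x.im → w ∈ strip m \ intTranslates p := fun w hw hwi =>
    ⟨⟨hw.1, by rw [← hx]; exact hwi⟩, hw.2⟩
  have hinj' : InjOn f ((U ∩ W) ∩ {w : ℂ | w.im < x.im}) := by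
    refine hinj.mono ?_
    rintro w ⟨hw, hwi⟩
    exact ⟨hw.1, hsub w hw.2 hwi⟩
  obtain ⟨h1, h2⟩ :=
    (h.analyticAt_of_im_eq_zero hx).of_injOn_lower_half (inter_mem hU hWn) hinj' hd
  refine ⟨h1, fun V hV => ?_⟩
  filter_upwards [h2 (V ∩ W) (inter_mem hV hWn)] with ε ⟨w, hw, hwi, hfw⟩
  exact ⟨w, hw.1, hsub w hw.2 hwi, hfw⟩

/-- The critical points on the upper side are mapped to endpoints of the slit, and the side on which
the image of the strip lies is the outer one. -/
theorem critical_alternative (h : IsSlitMap m A p z f) {x : ℂ} (hx : x.im = 0)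
    (hd : deriv f x = 0) : ∃ r : ℝ, iteratedDeriv 2 f x = r * (A 1 - A 0) ∧
      (f x = A 0 ∧ 0 < r ∨ f x = A 1 ∧ r < 0) := by
  have hu : A 1 - A 0 ≠ 0 := sub_ne_zero.2 h.ne_one_two.symm
  obtain ⟨h1, h2⟩ := h.exists_preimage_of_critical hx hd
  obtain ⟨θ, hθ, hθ'⟩ := mem_segment_iff_exists_add.1 (h.map_mem_segment hx)
  set r : ℝ := (iteratedDeriv 2 f x / (A 1 - A 0)).re with hr
  have hr' : iteratedDeriv 2 f x = r * (A 1 - A 0) := by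
    rw [← div_eq_iff hu]
    exact Complex.ext rfl (by simpa using h.im_iteratedDeriv_div_eq_zero hx)
  have hr0 : r ≠ 0 := by
    intro h0
    rw [h0] at hr'
    exact h1 (by simpa using hr')
  -- θ is the position of f x on the slit. If θ - rε²/2 stayed in [0, 1], a point inside the strip
  -- would be mapped into the slit.
  have key : ¬ ∀ᶠ ε : ℝ in 𝓝[>] 0, θ - r / 2 * ε ^ 2 ∈ Icc (0 : ℝ) 1 := by
    intro hk
    obtain ⟨ε, hε, w, -, hw, hfw⟩ := (hk.and (h2 univ univ_mem)).exists
    have hnot : f w ∈ (slits A)ᶜ := by rw [← h.image]; exact mem_image_of_mem f hw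
    refine hnot (Or.inl (mem_segment_iff_exists_add.2 ⟨_, hε, ?_⟩))
    rw [hfw, hr', hθ']
    push_cast
    ring
  have ht : Tendsto (fun ε : ℝ => θ - r / 2 * ε ^ 2) (𝓝[>] 0) (𝓝 θ) := by
    have : Continuous fun ε : ℝ => θ - r / 2 * ε ^ 2 := by fun_prop
    simpa using (this.tendsto 0).mono_left nhdsWithin_le_nhds
  refine ⟨r, hr', ?_⟩
  rcases lt_or_gt_of_ne hr0 with hneg | hpos
  · right
    refine ⟨?_, hneg⟩
    have : θ = 1 := by
      by_contra hne
      have hlt : θ < 1 := lt_of_le_of_ne hθ.2 hne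
      refine key ?_
      filter_upwards [ht.eventually_lt_const hlt] with ε hε
      refine ⟨?_, hε.le⟩
      nlinarith [sq_nonneg ε, hθ.1]
    rw [hθ', this]; simp
  · left
    refine ⟨?_, hpos⟩
    have : θ = 0 := by
      by_contra hne
      have hlt : 0 < θ := lt_of_le_of_ne hθ.1 (Ne.symm hne)
      refine key ?_
      filter_upwards [ht.eventually_const_lt hlt] with ε hε
      refine ⟨hε.le, ?_⟩
      nlinarith [sq_nonneg ε, hθ.2]
    rw [hθ', this]; simp

/-- The common endpoint fixes the sign of f'' relative to the slit, so just below x and just below y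
the map runs along the same prolongation of the slit. One value is then taken inside the strip both
near x and near y, and injectivity makes x and y congruent. -/
theorem exists_int_of_critical (h : IsSlitMap m A p z f) {x y : ℂ} (hx : x.im = 0) (hy : y.im = 0)
    (hdx : deriv f x = 0) (hdy : deriv f y = 0) (hxy : f x = f y) : ∃ n : ℤ, y = x + n := by
  obtain ⟨r, hr, hr'⟩ := h.critical_alternative hx hdx
  obtain ⟨s, hs, hs'⟩ := h.critical_alternative hy hdy
  have hrs : 0 < r / s := by
    rcases hr' with ⟨h1, h2⟩ | ⟨h1, h2⟩ <;> rcases hs' with ⟨h3, h4⟩ | ⟨h3, h4⟩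
    · positivity
    · exact absurd (h1.symm.trans (hxy.trans h3)) h.ne_one_two
    · exact absurd (h3.symm.trans (hxy.symm.trans h1)) h.ne_one_two
    · exact div_pos_of_neg_of_neg h2 h4
  by_contra hn
  have hy' : y ∉ intTranslates x := hn
  obtain ⟨δ, hδ, hball⟩ := Metric.isOpen_iff.1 (isClosed_intTranslates x).isOpen_compl y hy'
  -- The factor √(r/s) matches the two quadratic terms: s·(√(r/s)·ε)² = r·ε².
  have hsq : Tendsto (fun ε : ℝ => Real.sqrt (r / s) * ε) (𝓝[>] 0) (𝓝[>] 0) := by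
    refine tendsto_nhdsWithin_iff.2 ⟨?_, ?_⟩
    · have : Continuous fun ε : ℝ => Real.sqrt (r / s) * ε := by fun_prop
      simpa using (this.tendsto 0).mono_left nhdsWithin_le_nhds
    · filter_upwards [self_mem_nhdsWithin] with ε hε
      exact mul_pos (Real.sqrt_pos.2 hrs) hε
  have hx2 := (h.exists_preimage_of_critical hx hdx).2 _ (Metric.ball_mem_nhds x (half_pos hδ))
  have hy2 := (h.exists_preimage_of_critical hy hdy).2 _ (Metric.ball_mem_nhds y (half_pos hδ))
  obtain ⟨ε, ⟨w, hwV, hw, hfw⟩, v, hvV, hv, hfv⟩ := (hx2.and (hsq.eventually hy2)).exists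
  have hs0 : s ≠ 0 := by
    rintro rfl
    simp at hrs
  have heq : f w = f v := by
    rw [hfw, hfv, hr, hs, hxy]
    have h1 : ((Real.sqrt (r / s) * ε : ℝ) : ℂ) ^ 2 = (r / s : ℂ) * ε ^ 2 := by
      rw [← Complex.ofReal_pow, mul_pow, Real.sq_sqrt hrs.le]; push_cast; rfl
    have hs0' : (s : ℂ) ≠ 0 := by exact_mod_cast hs0
    rw [h1]
    field_simp
  obtain ⟨n, hn⟩ := h.injective w hw v hv heq
  have hd : dist (x + n) y < δ := by
    have h1 : dist (x + n) v < δ / 2 := by rw [hn, dist_add_right, dist_comm]; exact hwV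
    have h2 : dist v y < δ / 2 := hvV
    linarith [dist_triangle (x + n) v y]
  exact hball hd ⟨n, rfl⟩

/-- This is what transfers statements about critical points from the upper to the lower side: a half
turn has derivative -1, so only the first derivative changes sign. -/
theorem deriv_flip (h : IsSlitMap m A p z f) {x : ℂ} (hx : x ∈ closedStrip m \ intTranslates p) :
    deriv (fun w => f (-w - m * Complex.I)) (-x - m * Complex.I) = -deriv f x ∧
      iteratedDeriv 2 (fun w => f (-w - m * Complex.I)) (-x - m * Complex.I) =
        iteratedDeriv 2 f x := by
  have hinv : ∀ w : ℂ, -(-w - m * Complex.I) - m * Complex.I = w := fun w => by ring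
  have hlin : ∀ w : ℂ, HasDerivAt (fun w : ℂ => -w - m * Complex.I) (-1) w := fun w =>
    (hasDerivAt_id w).neg.sub_const _
  have h1 : ∀ w, AnalyticAt ℂ f (-w - m * Complex.I) →
      deriv (fun w => f (-w - m * Complex.I)) w = -deriv f (-w - m * Complex.I) := by
    intro w hw
    have := hw.differentiableAt.hasDerivAt.comp w (hlin w)
    simpa [Function.comp_def] using this.deriv
  have hx' : AnalyticAt ℂ f (-(-x - m * Complex.I) - m * Complex.I) := by
    rw [hinv]; exact h.analytic x hx
  refine ⟨by rw [h1 _ hx', hinv], ?_⟩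
  rw [iteratedDeriv_succ, iteratedDeriv_one, iteratedDeriv_succ, iteratedDeriv_one]
  have hc : Tendsto (fun w : ℂ => -w - m * Complex.I) (𝓝 (-x - m * Complex.I)) (𝓝 x) := by
    have : Continuous fun w : ℂ => -w - m * Complex.I := by fun_prop
    have := this.tendsto (-x - m * Complex.I)
    rwa [hinv] at this
  have h2 : deriv (fun w => f (-w - m * Complex.I)) =ᶠ[𝓝 (-x - m * Complex.I)]
      fun w => -deriv f (-w - m * Complex.I) := by
    filter_upwards [hc.eventually (h.analytic x hx).eventually_analyticAt] with w hw
    exact h1 w hw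
  rw [h2.deriv_eq]
  have h3 := (hx'.deriv.differentiableAt.hasDerivAt.comp (-x - m * Complex.I) (hlin _)).fun_neg
  have h4 := h3.deriv
  rw [hinv] at h4
  simpa only [Function.comp_apply, mul_neg, mul_one, neg_neg] using h4

theorem endpoint_mem (h : IsSlitMap m A p z f) (k : Fin 4) :
    z k ∈ closedStrip m \ intTranslates p := by
  have hm := h.width_pos
  have key : z k ∈ closedStrip m ∧ z k ∉ strip m := by
    simp only [closedStrip, strip, mem_ofPred_eq]
    fin_cases k
    · simp [h.im_one, hm.le]
    · simp [h.im_two, hm.le]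
    · simp [h.im_three, hm.le]
    · simp [h.im_four, hm.le]
  exact ⟨key.1, h.notMem_intTranslates_of_notMem_strip key.2⟩

theorem deriv_endpoint (h : IsSlitMap m A p z f) (k : Fin 4) : deriv f (z k) = 0 := by
  have hb : ∀ k, (-z k - m * Complex.I).im = 0 →
      (A k = A 2 ∨ A k = A 3) → deriv f (z k) = 0 := by
    intro k hk hA
    have h1 := (h.deriv_flip (h.endpoint_mem k)).1
    have h2 := h.flip.deriv_eq_zero_of_map_eq hk (by
      have : -(-z k - m * Complex.I) - m * Complex.I = z k := by ring
      rw [this, h.map_endpoint]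
      exact hA)
    rw [h2] at h1
    exact neg_eq_zero.1 h1.symm
  fin_cases k
  · exact h.deriv_eq_zero_of_map_eq h.im_one (Or.inl (h.map_endpoint 0))
  · exact h.deriv_eq_zero_of_map_eq h.im_two (Or.inr (h.map_endpoint 1))
  · exact hb 2 (by simp [h.im_three]) (Or.inl rfl)
  · exact hb 3 (by simp [h.im_four]) (Or.inr rfl)

theorem iteratedDeriv_endpoint_ne_zero (h : IsSlitMap m A p z f) (k : Fin 4) :
    iteratedDeriv 2 f (z k) ≠ 0 := by
  have hb : ∀ k, (-z k - m * Complex.I).im = 0 → iteratedDeriv 2 f (z k) ≠ 0 := by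
    intro k hk
    obtain ⟨h1, h2⟩ := h.deriv_flip (h.endpoint_mem k)
    rw [← h2]
    exact (h.flip.exists_preimage_of_critical hk (by rw [h1, h.deriv_endpoint, neg_zero])).1
  fin_cases k
  · exact (h.exists_preimage_of_critical h.im_one (h.deriv_endpoint 0)).1
  · exact (h.exists_preimage_of_critical h.im_two (h.deriv_endpoint 1)).1
  · exact hb 2 (by simp [h.im_three])
  · exact hb 3 (by simp [h.im_four])

theorem exists_eq_endpoint_add_int (h : IsSlitMap m A p z f) {x : ℂ}
    (hx : x ∈ closedStrip m \ intTranslates p) (hd : deriv f x = 0) :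
    ∃ k, ∃ n : ℤ, x = z k + n := by
  -- Stated for arbitrary data so that it applies both to f and to its half turn.
  have htop : ∀ {A : Fin 4 → ℂ} {p : ℂ} {z : Fin 4 → ℂ} {f : ℂ → ℂ} (_ : IsSlitMap m A p z f)
      {x : ℂ}, x.im = 0 → deriv f x = 0 → ∃ k, ∃ n : ℤ, x = z k + n := by
    intro A p z f h x hx hd
    obtain ⟨r, -, ⟨hr, -⟩ | ⟨hr, -⟩⟩ := h.critical_alternative hx hd
    · exact ⟨0, h.exists_int_of_critical h.im_one hx (h.deriv_endpoint 0) hd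
        ((h.map_endpoint 0).trans hr.symm)⟩
    · exact ⟨1, h.exists_int_of_critical h.im_two hx (h.deriv_endpoint 1) hd
        ((h.map_endpoint 1).trans hr.symm)⟩
  have hns : x ∉ strip m := fun hs => h.deriv_ne_zero ⟨hs, hx.2⟩ hd
  by_cases h0 : x.im = 0
  · exact htop h h0 hd
  · have h1 : x.im = -m := by
      by_contra hne
      exact hns ⟨lt_of_le_of_ne hx.1.1 (Ne.symm hne), lt_of_le_of_ne hx.1.2 h0⟩
    obtain ⟨k, n, hk⟩ := htop h.flip (x := -x - m * Complex.I) (by simp [h1])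
      (by rw [(h.deriv_flip hx).1, hd, neg_zero])
    -- The half turn shifts the indices by 2, modulo 4.
    exact ⟨k + 2, -n, by push_cast; linear_combination -hk⟩

/-- The four endpoints are pairwise incongruent modulo the period. -/
theorem eq_of_endpoint_add_int (h : IsSlitMap m A p z f) {j k : Fin 4} {n : ℤ}
    (hjk : z j = z k + n) : j = k := by
  have hA : A j = A k := by
    rw [← h.map_endpoint j, ← h.map_endpoint k, hjk]
    simpa using (h.periodic.int_mul n) (z k)
  have him : (z j).im = (z k).im := by simp [hjk]
  have hm := h.width_pos
  have h01 := h.ne_one_two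
  have h23 := h.ne_three_four
  have i0 := h.im_one
  have i1 := h.im_two
  have i2 := h.im_three
  have i3 := h.im_four
  fin_cases j <;> fin_cases k <;> first
    | rfl
    | exact absurd hA h01
    | exact absurd hA.symm h01
    | exact absurd hA h23
    | exact absurd hA.symm h23
    | (exfalso; simp only [Fin.zero_eta, Fin.mk_one, Fin.reduceFinMk, i0, i1, i2, i3] at him
       linarith)

end IsSlitMap

/-! ### The kernel π cot πw and its integral over a period -/

theorem sin_pi_mul_eq_zero_iff {w : ℂ} : Complex.sin (Real.pi * w) = 0 ↔ ∃ n : ℤ, w = n := by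
  have hpi : (Real.pi : ℂ) ≠ 0 := by exact_mod_cast Real.pi_ne_zero
  rw [Complex.sin_eq_zero_iff]
  refine exists_congr fun n => ?_
  rw [mul_comm, mul_left_inj' hpi]

theorem eventually_sin_ne_zero (a c : ℂ) :
    ∀ᶠ w in 𝓝[≠] c, Complex.sin (Real.pi * (w - a)) ≠ 0 := by
  have hd : HasDerivAt (fun w : ℂ => Complex.sin (Real.pi * (w - a)))
      (Complex.cos (Real.pi * (c - a)) * Real.pi) c := by
    have := (Complex.hasDerivAt_sin (Real.pi * (c - a))).comp c
      (((hasDerivAt_id c).sub_const a).const_mul (Real.pi : ℂ))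
    simpa [Function.comp_def] using this
  by_cases h0 : Complex.sin (Real.pi * (c - a)) = 0
  · refine hd.eventually_ne (mul_ne_zero (fun hcos => ?_) (by exact_mod_cast Real.pi_ne_zero))
    have := Complex.sin_sq_add_cos_sq (Real.pi * (c - a))
    simp [h0, hcos] at this
  · exact (hd.continuousAt.eventually_ne h0).filter_mono nhdsWithin_le_nhds

theorem differentiableAt_cot_pi {a w : ℂ} (h : Complex.sin (Real.pi * (w - a)) ≠ 0) :
    DifferentiableAt ℂ (fun w => Real.pi * Complex.cot (Real.pi * (w - a))) w := by
  simp only [Complex.cot_eq_cos_div_sin]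
  have h1 : DifferentiableAt ℂ (fun w : ℂ => Complex.cos (Real.pi * (w - a))) w := by fun_prop
  have h2 : DifferentiableAt ℂ (fun w : ℂ => Complex.sin (Real.pi * (w - a))) w := by fun_prop
  exact (h1.div h2 h).const_mul _

theorem cot_pi_add_int (w : ℂ) (n : ℤ) :
    Complex.cot (Real.pi * (w + n)) = Complex.cot (Real.pi * w) := by
  have hper : Function.Periodic (fun w : ℂ => Complex.cot (Real.pi * w)) 1 := fun w => by
    simp only [Complex.cot_eq_cos_div_sin]
    rw [mul_add, mul_one, Complex.cos_add_pi, Complex.sin_add_pi, neg_div_neg_eq]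
  simpa using hper.int_mul n w

/-- In the variable ζ = exp(2πix) the integrand is holomorphic on the closed unit disc, so its mean
over the circle is the value at the centre. -/
theorem integral_cot_pi_of_im_pos {c : ℂ} (hc : 0 < c.im) :
    ∫ x in (0 : ℝ)..1, Real.pi * Complex.cot (Real.pi * (x + c)) = -(Real.pi * Complex.I) := by
  set q : ℂ := Complex.exp (2 * Real.pi * Complex.I * c) with hq
  have hq1 : ‖q‖ < 1 := by
    rw [hq, Complex.norm_exp, Real.exp_lt_one_iff]
    have : (2 * Real.pi * Complex.I * c).re = -(2 * Real.pi * c.im) := by simp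
    rw [this]
    have := Real.pi_pos
    nlinarith
  -- The cotangent written in exponentials; the only pole 1/q lies outside the closed disc.
  set g : ℂ → ℂ := fun ζ => Real.pi * Complex.I * ((q * ζ + 1) / (q * ζ - 1)) with hg
  have hne : ∀ ζ : ℂ, ‖ζ‖ ≤ 1 → q * ζ - 1 ≠ 0 := by
    intro ζ hζ h0
    have : ‖q * ζ‖ = 1 := by rw [sub_eq_zero.1 h0, norm_one]
    rw [norm_mul] at this
    nlinarith [norm_nonneg q, norm_nonneg ζ]
  have hgd : ∀ ζ : ℂ, ‖ζ‖ ≤ 1 → DifferentiableAt ℂ g ζ := by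
    intro ζ hζ
    have h1 : DifferentiableAt ℂ (fun ζ : ℂ => q * ζ + 1) ζ := by fun_prop
    have h2 : DifferentiableAt ℂ (fun ζ : ℂ => q * ζ - 1) ζ := by fun_prop
    exact (h1.div h2 (hne ζ hζ)).const_mul _
  have havg : Real.circleAverage g 0 1 = g 0 := by
    refine DiffContOnCl.circleAverage (DifferentiableOn.diffContOnCl fun ζ hζ => ?_)
    refine (hgd ζ ?_).differentiableWithinAt
    have := Metric.closure_ball_subset_closedBall hζ
    simpa using this
  have hint : ∀ x : ℝ, Real.pi * Complex.cot (Real.pi * (x + c)) =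
      g (circleMap 0 1 (2 * Real.pi * x)) := by
    intro x
    have he : Complex.exp (2 * Complex.I * (Real.pi * (x + c))) =
        q * circleMap 0 1 (2 * Real.pi * x) := by
      simp only [circleMap, hq, zero_add, Complex.ofReal_one, one_mul]
      rw [← Complex.exp_add]
      congr 1
      push_cast
      ring
    have h1 := hne (circleMap 0 1 (2 * Real.pi * x)) (by simp)
    have h2 : 1 - q * circleMap 0 1 (2 * Real.pi * x) ≠ 0 := by
      rw [← neg_sub]; exact neg_ne_zero.2 h1
    rw [Complex.cot_eq_exp_ratio, he]
    simp only [hg]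
    field_simp
    linear_combination (q * circleMap 0 1 (2 * Real.pi * x) + 1) *
      (1 - q * circleMap 0 1 (2 * Real.pi * x)) * (-Complex.I_sq)
  simp only [hint]
  rw [intervalIntegral.integral_comp_mul_left (fun θ => g (circleMap 0 1 θ))
    (by have := Real.pi_pos; positivity)]
  rw [mul_zero, mul_one]
  have h3 : (2 * Real.pi)⁻¹ • ∫ x in (0 : ℝ)..2 * Real.pi, g (circleMap 0 1 x) =
    Real.circleAverage g 0 1 := rfl
  rw [h3, havg, hg]
  simp

theorem sin_pi_mul_ne_zero_of_im_ne_zero {w : ℂ} (h : w.im ≠ 0) : Complex.sin (Real.pi * w) ≠ 0 := by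
  intro h0
  obtain ⟨n, rfl⟩ := sin_pi_mul_eq_zero_iff.1 h0
  simp at h

theorem continuous_cot_pi {c : ℂ} (hc : c.im ≠ 0) :
    Continuous fun x : ℝ => Real.pi * Complex.cot (Real.pi * (x + c)) := by
  simp only [Complex.cot_eq_cos_div_sin]
  refine continuous_const.mul (Continuous.div (by fun_prop) (by fun_prop) fun x => ?_)
  exact sin_pi_mul_ne_zero_of_im_ne_zero (by simpa using hc)

theorem im_cot_pi_eq_zero {w : ℂ} (hw : w.im = 0) :
    (Real.pi * Complex.cot (Real.pi * w)).im = 0 := by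
  have : w = (w.re : ℂ) := Complex.ext rfl (by simpa using hw)
  rw [this, ← Complex.ofReal_mul, ← Complex.ofReal_cot, ← Complex.ofReal_mul, Complex.ofReal_im]

/-- On the real line the cotangent is real, and at its poles division by zero gives 0, so the
imaginary part has no singularity even when the line passes through poles. -/
theorem continuous_im_cot_pi (c : ℂ) :
    Continuous fun x : ℝ => (Real.pi * Complex.cot (Real.pi * (x + c))).im := by
  by_cases hc : c.im = 0
  · have : (fun x : ℝ => (Real.pi * Complex.cot (Real.pi * (x + c))).im) = fun _ => 0 :=
      funext fun x => im_cot_pi_eq_zero (by simpa using hc)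
    rw [this]
    exact continuous_const
  · exact Complex.continuous_im.comp (continuous_cot_pi hc)

/-- Conjugation reduces the lower half plane to the upper one. For real c the integrand vanishes, so
a pole contributes nothing to the integral over its own side. -/
theorem integral_im_cot_pi (c : ℂ) :
    ∫ x in (0 : ℝ)..1, (Real.pi * Complex.cot (Real.pi * (x + c))).im = -(Real.pi * Real.sign c.im) := by
  have him : ∀ {c : ℂ}, c.im ≠ 0 → ∫ x in (0 : ℝ)..1, (Real.pi * Complex.cot (Real.pi * (x + c))).im
      = (∫ x in (0 : ℝ)..1, Real.pi * Complex.cot (Real.pi * (x + c))).im := fun hc =>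
    Complex.imCLM.intervalIntegral_comp_comm ((continuous_cot_pi hc).intervalIntegrable 0 1)
  rcases lt_trichotomy c.im 0 with h | h | h
  · have h1 : ∀ x : ℝ, (Real.pi * Complex.cot (Real.pi * (x + c))).im =
        -(Real.pi * Complex.cot (Real.pi * ((starRingEnd ℂ) (x + c)))).im := by
      intro x
      rw [← Complex.conj_im]
      congr 1
      simp only [map_mul, Complex.conj_ofReal, Complex.cot_eq_cos_div_sin, map_div₀,
        ← Complex.cos_conj, ← Complex.sin_conj, Complex.conj_conj]
    simp only [h1, intervalIntegral.integral_neg, map_add, Complex.conj_ofReal]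
    have h2 : 0 < ((starRingEnd ℂ) c).im := by simpa using h
    rw [him h2.ne', integral_cot_pi_of_im_pos h2, Real.sign_of_neg h]
    simp
  · have : ∀ x : ℝ, (Real.pi * Complex.cot (Real.pi * (x + c))).im = 0 := fun x =>
      im_cot_pi_eq_zero (by simpa using h)
    simp [this, h]
  · rw [him h.ne', integral_cot_pi_of_im_pos h, Real.sign_of_pos h]
    simp

/-! ### Removable singularities and the residue identity in a strip -/

/-- A periodic function with only removable singularities in a closed strip. -/
theorem exists_periodic_extension {H : ℂ → ℂ} {s : Set ℂ} (hper : Function.Periodic H 1)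
    (hd : ∀ c ∈ s, ∀ᶠ w in 𝓝[≠] c, DifferentiableAt ℂ H w)
    (hb : ∀ c ∈ s, H =O[𝓝[≠] c] fun _ => (1 : ℝ)) :
    ∃ R : ℂ → ℂ, Function.Periodic R 1 ∧ (∀ c ∈ s, DifferentiableAt ℂ R c) ∧
      ∀ c ∈ s, R =ᶠ[𝓝[≠] c] H := by
  set R : ℂ → ℂ := fun w => limUnder (𝓝[≠] w) H with hR
  have hRH : ∀ c ∈ s, R =ᶠ[𝓝[≠] c] H := by
    intro c hc
    filter_upwards [hd c hc] with w hw
    exact (hw.continuousAt.tendsto.mono_left nhdsWithin_le_nhds).limUnder_eq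
  refine ⟨R, ?_, fun c hc => ?_, hRH⟩
  · intro w
    have h1 : map (fun v : ℂ => v + 1) (𝓝[≠] w) = 𝓝[≠] (w + 1) := by
      have := (Homeomorph.addRight (1 : ℂ)).isEmbedding.map_nhdsWithin_eq {w}ᶜ w
      simpa [image_compl_eq (Homeomorph.addRight (1 : ℂ)).bijective, -map_add_right_nhdsNE] using this
    simp only [hR, limUnder]
    rw [← h1, Filter.map_map]
    congr 2
    exact funext hper
  · obtain ⟨C, hC⟩ := (hb c hc).bound
    set S : Set ℂ := insert c {w | DifferentiableAt ℂ H w ∧ ‖H w‖ ≤ C * ‖(1 : ℝ)‖} with hS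
    have hSn : S ∈ 𝓝 c := insert_mem_nhds_iff.2 ((hd c hc).and hC)
    have h1 : ∀ w ∈ S \ {c}, DifferentiableAt ℂ H w ∧ ‖H w‖ ≤ C * ‖(1 : ℝ)‖ :=
      fun w hw => hw.1.resolve_left hw.2
    have h2 := Complex.differentiableOn_update_limUnder_of_bddAbove (f := H) hSn
      (fun w hw => (h1 w hw).1.differentiableWithinAt)
      ⟨C * ‖(1 : ℝ)‖, by rintro _ ⟨w, hw, rfl⟩; exact (h1 w hw).2⟩
    refine (h2.differentiableAt hSn).congr_of_eventuallyEq ?_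
    have h3 := eventually_nhdsWithin_iff.1 (hRH c hc)
    filter_upwards [h3] with w hw
    by_cases hwc : w = c
    · subst hwc; simp [hR]
    · rw [Function.update_of_ne hwc]; exact hw hwc

/-- Cauchy's theorem on a rectangle of width one period, whose vertical sides cancel. -/
theorem integral_eq_integral_of_periodic {R : ℂ → ℂ} {m : ℝ} (hm : 0 < m)
    (hper : Function.Periodic R 1) (hd : ∀ w ∈ closedStrip m, DifferentiableAt ℂ R w) :
    ∫ x in (0 : ℝ)..1, R x = ∫ x in (0 : ℝ)..1, R (x - m * Complex.I) := by
  have h := Complex.integral_boundary_rect_eq_zero_of_differentiableOn R (-(m * Complex.I)) 1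
    (by
      intro w hw
      refine (hd w ?_).differentiableWithinAt
      have h1 := hw.2
      simp only [mem_preimage, Complex.neg_im, Complex.mul_im, Complex.ofReal_re, Complex.I_im,
        mul_one, Complex.ofReal_im, Complex.I_re, mul_zero, add_zero, Complex.one_im] at h1
      rw [uIcc_of_le (by linarith)] at h1
      exact h1)
  have hv : ∀ y : ℝ, R (((1 : ℂ).re : ℂ) + y * Complex.I) =
      R (((-(m * Complex.I) : ℂ).re : ℂ) + y * Complex.I) := by
    intro y
    have := hper (y * Complex.I)
    simpa [add_comm] using this
  simp only [hv] at h
  rw [add_sub_cancel_right, sub_eq_zero] at h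
  simp only [Complex.neg_im, Complex.mul_im, Complex.ofReal_re, Complex.I_im,
        mul_one, Complex.ofReal_im, Complex.I_re, mul_zero, add_zero, Complex.one_im,
        Complex.neg_re, Complex.mul_re, sub_self, neg_zero, Complex.one_re, zero_mul,
        Complex.ofReal_zero, Complex.ofReal_neg, neg_mul, ← sub_eq_add_neg] at h
  exact h.symm

/-- The sum of the residues of a periodic function with simple poles on the sides of a strip and
constant imaginary part on each side. -/
theorem im_eq_pi_mul_sum_residues {ι : Type*} [Fintype ι] {m v : ℝ} (hm : 0 < m) {H : ℂ → ℂ}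
    (hper : Function.Periodic H 1) {z : ι → ℂ} {γ : ι → ℝ}
    (hz : ∀ k, (z k).im = 0 ∨ (z k).im = -m)
    (hd : ∀ c ∈ closedStrip m, ∀ᶠ w in 𝓝[≠] c, DifferentiableAt ℂ H w)
    (hb : ∀ c ∈ closedStrip m,
      (fun w => H w - ∑ k, γ k * (Real.pi * Complex.cot (Real.pi * (w - z k))))
        =O[𝓝[≠] c] fun _ => (1 : ℝ))
    (htop : ∀ c, c.im = 0 → ∀ᶠ w in 𝓝[≠] c, w.im = 0 → (H w).im = 0)
    (hbot : ∀ c, c.im = -m → ∀ᶠ w in 𝓝[≠] c, w.im = -m → (H w).im = v) :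
    v = Real.pi * ∑ k, γ k := by
  set K : ι → ℂ → ℂ := fun k w => Real.pi * Complex.cot (Real.pi * (w - z k)) with hK
  set G : ℂ → ℂ := fun w => H w - ∑ k, γ k * K k w with hG
  have hGper : Function.Periodic G 1 := by
    intro w
    have : ∀ k, K k (w + 1) = K k w := fun k => by
      have := cot_pi_add_int (w - z k) 1
      simp only [hK]
      rw [← this]
      congr 3
      push_cast
      ring
    simp only [hG, hper w, this]
  have hGd : ∀ c ∈ closedStrip m, ∀ᶠ w in 𝓝[≠] c, DifferentiableAt ℂ G w := by
    intro c hc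
    filter_upwards [hd c hc, eventually_all.2 fun k => eventually_sin_ne_zero (z k) c] with w hw hs
    exact hw.sub (DifferentiableAt.fun_sum fun k _ => (differentiableAt_cot_pi (hs k)).const_mul _)
  obtain ⟨R, hRper, hRd, hRG⟩ := exists_periodic_extension hGper hGd hb
  -- the imaginary part of the extension on a side
  have hside : ∀ (b u : ℝ), (∀ x : ℝ, (x + b * Complex.I : ℂ) ∈ closedStrip m) →
      (∀ c : ℂ, c.im = b → ∀ᶠ w in 𝓝[≠] c, w.im = b → (H w).im = u) → ∀ x : ℝ, (R (x + b * Complex.I)).im =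
        u - ∑ k, γ k * (Real.pi * Complex.cot (Real.pi * (x + (b * Complex.I - z k)))).im := by
    intro b u hmem hu x
    set L : ℝ → ℂ := fun x => x + b * Complex.I with hL
    have hLc : Continuous L := by fun_prop
    have hLt : Tendsto L (𝓝[≠] x) (𝓝[≠] (L x)) := by
      refine tendsto_nhdsWithin_iff.2 ⟨(hLc.tendsto x).mono_left nhdsWithin_le_nhds, ?_⟩
      filter_upwards [self_mem_nhdsWithin] with y hy hy'
      exact hy (by simpa [hL] using hy')
    have h1 : Tendsto (fun y => (R (L y)).im) (𝓝[≠] x) (𝓝 (R (L x)).im) :=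
      ((Complex.continuous_im.continuousAt.comp (hRd _ (hmem x)).continuousAt).tendsto.comp
        (hLc.tendsto x)).mono_left nhdsWithin_le_nhds
    have h2 : Continuous fun y : ℝ =>
        u - ∑ k, γ k * (Real.pi * Complex.cot (Real.pi * (y + (b * Complex.I - z k)))).im :=
      continuous_const.sub (continuous_finsetSum _ fun k _ =>
        continuous_const.mul (continuous_im_cot_pi _))
    -- The identity is known only at points of the side close to x and different from x. Both sides
    -- of it are continuous, so it extends to x, which may be a singularity of H.
    refine tendsto_nhds_unique h1 (((h2.tendsto x).mono_left nhdsWithin_le_nhds).congr' ?_)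
    filter_upwards [hLt.eventually (hRG _ (hmem x)),
      hLt.eventually (hu (L x) (by simp [hL]))] with y hy hyu
    rw [hy]
    simp only [hG, Complex.sub_im _ (∑ k, _), Complex.im_sum, hyu (by simp [hL])]
    simp only [Complex.im_ofReal_mul, hK, hL, add_sub_assoc]
  have hint : ∀ (b u : ℝ), (∀ x : ℝ, (x + b * Complex.I : ℂ) ∈ closedStrip m) →
      (∀ c : ℂ, c.im = b → ∀ᶠ w in 𝓝[≠] c, w.im = b → (H w).im = u) → (∫ x in (0 : ℝ)..1, R (x + b * Complex.I)).im =
        u + Real.pi * ∑ k, γ k * Real.sign (b - (z k).im) := by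
    intro b u hmem hu
    have hc : Continuous fun x : ℝ => R (x + b * Complex.I) :=
      continuous_iff_continuousAt.2 fun x => ContinuousAt.comp (f := fun x : ℝ => (x + b * Complex.I : ℂ))
        (hRd _ (hmem x)).continuousAt (by fun_prop)
    have h1 : ∫ x in (0 : ℝ)..1, (R (x + b * Complex.I)).im =
        (∫ x in (0 : ℝ)..1, R (x + b * Complex.I)).im :=
      Complex.imCLM.intervalIntegral_comp_comm (hc.intervalIntegrable 0 1)
    rw [← h1]
    simp only [hside b u hmem hu]
    have hi : ∀ k, IntervalIntegrable (fun x : ℝ => γ k *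
        (Real.pi * Complex.cot (Real.pi * (x + (b * Complex.I - z k)))).im) MeasureTheory.volume 0 1 :=
      fun k => (continuous_const.mul (continuous_im_cot_pi _)).intervalIntegrable 0 1
    have hi' : IntervalIntegrable (fun x : ℝ => ∑ k, γ k *
        (Real.pi * Complex.cot (Real.pi * (x + (b * Complex.I - z k)))).im) MeasureTheory.volume 0 1 :=
      (continuous_finsetSum _ fun k _ =>
        continuous_const.mul (continuous_im_cot_pi _)).intervalIntegrable 0 1
    rw [intervalIntegral.integral_sub intervalIntegrable_const hi',
      intervalIntegral.integral_finsetSum fun k _ => hi k]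
    simp only [intervalIntegral.integral_const_mul, integral_im_cot_pi]
    simp [Finset.mul_sum, mul_left_comm]
  have e1 := hint 0 0 (fun x => by simp [closedStrip, hm.le]) htop
  have e2 := hint (-m) v (fun x => by simp [closedStrip, hm.le]) hbot
  have e3 := integral_eq_integral_of_periodic hm hRper hRd
  have e4 : ∫ x in (0 : ℝ)..1, R (x + (0 : ℝ) * Complex.I) =
      ∫ x in (0 : ℝ)..1, R (x + (-m : ℝ) * Complex.I) := by
    simpa [sub_eq_add_neg] using e3
  rw [e4, e2, zero_add] at e1
  -- A pole contributes only to the integral over the opposite side: sign +1 on the upper side if it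
  -- lies below, sign -1 on the lower side if it lies above. In the difference each pole counts
  -- once.
  have e5 : ∀ k, γ k * Real.sign (0 - (z k).im) - γ k * Real.sign (-m - (z k).im) = γ k := by
    intro k
    rcases hz k with h | h
    · rw [h, sub_zero, sub_zero, Real.sign_zero, Real.sign_of_neg (neg_lt_zero.2 hm)]; ring
    · rw [h, sub_neg_eq_add, zero_add, sub_neg_eq_add, neg_add_cancel, Real.sign_zero,
        Real.sign_of_pos hm]; ring
  have e6 := Finset.sum_congr rfl fun k (_ : k ∈ Finset.univ) => e5 k
  rw [Finset.sum_sub_distrib] at e6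
  rw [← e6, mul_sub]
  linarith

/-! ### Differentiation in the parameter -/

/-- If `F` is jointly `C¹` and holomorphic in the second variable, then so is its derivative in the
parameter. -/
theorem eventually_differentiableAt_deriv_param {F : ℝ → ℂ → ℂ} {t : ℝ} {w : ℂ}
    (h1 : ContDiffAt ℝ 1 (fun x : ℝ × ℂ => F x.1 x.2) (t, w))
    (h2 : ∀ᶠ x : ℝ × ℂ in 𝓝 (t, w), DifferentiableAt ℂ (F x.1) x.2) :
    ∀ᶠ v in 𝓝 w, DifferentiableAt ℂ (fun v => deriv (fun s => F s v) t) v := by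
  have h3 := (h1.eventually (by simp)).and h2
  obtain ⟨δ, hδ, hball⟩ := Metric.eventually_nhds_iff_ball.1 h3
  rw [← ball_prod_same] at hball
  set V := Metric.ball w δ with hV
  have hVn : V ∈ 𝓝 w := Metric.ball_mem_nhds w hδ
  set D : ℂ → ℂ := fun v => deriv (fun s => F s v) t with hD
  have htδ : t ∈ Metric.ball t δ := Metric.mem_ball_self hδ
  have hstrict : ∀ v ∈ V, ∃ F' : ℝ × ℂ →L[ℝ] ℂ,
      HasStrictFDerivAt (fun x : ℝ × ℂ => F x.1 x.2) F' (t, v) ∧ HasDerivAt (fun s => F s v) (F' (1, 0)) t := by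
    intro v hv
    have h4 := (hball (t, v) ⟨htδ, hv⟩).1.hasStrictFDerivAt one_ne_zero
    refine ⟨_, h4, ?_⟩
    have h5 : HasDerivAt (fun s : ℝ => (s, v)) ((1 : ℝ), (0 : ℂ)) t :=
      (hasDerivAt_id t).prodMk (hasDerivAt_const t v)
    exact HasFDerivAt.comp_hasDerivAt t (h4.hasFDerivAt) h5
  -- Strict differentiability compares (s, v) with (t, v) for v varying near v₀; this supplies the
  -- uniformity in v.
  have hquot : ∀ v₀ ∈ V, ∀ ε > 0, ∀ᶠ y : ℝ × ℂ in 𝓝 (t, v₀),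
      ‖F y.1 y.2 - F t y.2 - (y.1 - t : ℝ) * D v₀‖ ≤ ε * |y.1 - t| := by
    intro v₀ hv₀ ε hε
    obtain ⟨F', hF', hF''⟩ := hstrict v₀ hv₀
    have h4 := hF'.isLittleO.def hε
    have h5 : Tendsto (fun y : ℝ × ℂ => (y, (t, y.2))) (𝓝 (t, v₀)) (𝓝 ((t, v₀), (t, v₀))) := by
      have : Continuous fun y : ℝ × ℂ => (y, (t, y.2)) := by fun_prop
      exact this.tendsto (t, v₀)
    filter_upwards [h5.eventually h4] with y hy
    have h6 : y - (t, y.2) = (y.1 - t) • ((1 : ℝ), (0 : ℂ)) := by ext <;> simp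
    have h7 : D v₀ = F' (1, 0) := hF''.deriv
    simp only [h6] at hy
    rw [map_smul, norm_smul, ← h7, Complex.real_smul] at hy
    simpa using hy
  -- The difference quotients in the parameter are holomorphic in v, and a locally uniform limit of
  -- holomorphic functions is holomorphic.
  have hunif : TendstoLocallyUniformlyOn
      (fun (s : ℝ) (v : ℂ) => ((s - t : ℝ) : ℂ)⁻¹ * (F s v - F t v)) D (𝓝[≠] t) V := by
    rw [Metric.tendstoLocallyUniformlyOn_iff]
    intro ε hε v₀ hv₀
    obtain ⟨η, hη, hη'⟩ := Metric.eventually_nhds_iff_ball.1 (hquot v₀ hv₀ (ε / 3) (by positivity))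
    rw [← ball_prod_same] at hη'
    have hest : ∀ᶠ s in 𝓝[≠] t, ∀ v ∈ Metric.ball v₀ η,
        ‖((s - t : ℝ) : ℂ)⁻¹ * (F s v - F t v) - D v₀‖ ≤ ε / 3 := by
      filter_upwards [self_mem_nhdsWithin, mem_nhdsWithin_of_mem_nhds (Metric.ball_mem_nhds t hη)]
        with s hs hsη v hv
      have h4 := hη' (s, v) ⟨hsη, hv⟩
      simp only at h4
      have h5 : ((s - t : ℝ) : ℂ) ≠ 0 := by
        exact_mod_cast sub_ne_zero.2 hs
      have h6 : ((s - t : ℝ) : ℂ)⁻¹ * (F s v - F t v) - D v₀ =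
          ((s - t : ℝ) : ℂ)⁻¹ * (F s v - F t v - (s - t : ℝ) * D v₀) := by
        field_simp
      rw [h6, norm_mul, norm_inv, Complex.norm_real, Real.norm_eq_abs, inv_mul_le_iff₀
        (abs_pos.2 (sub_ne_zero.2 hs)), mul_comm |s - t|]
      exact h4
    refine ⟨V ∩ Metric.ball v₀ η, inter_mem_nhdsWithin _ (Metric.ball_mem_nhds v₀ hη), ?_⟩
    have hDv : ∀ v ∈ V ∩ Metric.ball v₀ η, ‖D v - D v₀‖ ≤ ε / 3 := by
      rintro v ⟨hv, hvη⟩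
      obtain ⟨F', -, hF''⟩ := hstrict v hv
      have h4 : Tendsto (fun s : ℝ => ((s - t : ℝ) : ℂ)⁻¹ * (F s v - F t v)) (𝓝[≠] t) (𝓝 (D v)) := by
        have := hasDerivAt_iff_tendsto_slope.1 hF''
        rw [← hF''.deriv] at this
        refine this.congr fun s => ?_
        simp [slope, vsub_eq_sub]
      exact le_of_tendsto (h4.sub_const (D v₀)).norm (hest.mono fun s hs => hs v hvη)
    filter_upwards [hest] with s hs v hv
    rw [dist_eq_norm]
    have h4 := hDv v hv
    have h5 := hs v hv.2
    calc ‖D v - ((s - t : ℝ) : ℂ)⁻¹ * (F s v - F t v)‖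
        = ‖(D v - D v₀) - (((s - t : ℝ) : ℂ)⁻¹ * (F s v - F t v) - D v₀)‖ := by congr 1; ring
      _ ≤ ε / 3 + ε / 3 := (norm_sub_le _ _).trans (add_le_add h4 h5)
      _ < ε := by linarith
  have hdiff : DifferentiableOn ℂ D V := by
    refine hunif.differentiableOn ?_ Metric.isOpen_ball
    filter_upwards [mem_nhdsWithin_of_mem_nhds (Metric.ball_mem_nhds t hδ)] with s hs v hv
    have h4 := (hball (s, v) ⟨hs, hv⟩).2
    have h5 := (hball (t, v) ⟨htδ, hv⟩).2
    exact ((h4.sub h5).const_mul _).differentiableWithinAt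
  filter_upwards [Metric.isOpen_ball.mem_nhds (Metric.mem_ball_self hδ)] with v hv
  exact hdiff.differentiableAt (Metric.isOpen_ball.mem_nhds hv)

/-- The chain rule along a curve for a function that is holomorphic in the second variable. -/
theorem hasDerivAt_param_comp {F : ℝ → ℂ → ℂ} {t : ℝ} {g : ℝ → ℂ} {g' : ℂ}
    (h1 : DifferentiableAt ℝ (fun x : ℝ × ℂ => F x.1 x.2) (t, g t))
    (h2 : DifferentiableAt ℂ (F t) (g t)) (hg : HasDerivAt g g' t) :
    HasDerivAt (fun s => F s (g s)) (deriv (fun s => F s (g t)) t + deriv (F t) (g t) * g') t := by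
  obtain ⟨F', hF'⟩ := h1
  have e1 : HasDerivAt (fun s => F s (g t)) (F' (1, 0)) t :=
    HasFDerivAt.comp_hasDerivAt (f := fun s : ℝ => (s, g t)) t hF'
      ((hasDerivAt_id t).prodMk (hasDerivAt_const t (g t)))
  have e2 : HasFDerivAt (F t) (F'.comp (ContinuousLinearMap.inr ℝ ℝ ℂ)) (g t) :=
    HasFDerivAt.comp (g := fun x : ℝ × ℂ => F x.1 x.2) (f := fun v : ℂ => (t, v)) (g t) hF'
      (hasFDerivAt_prodMk_right t (g t))
  have e3 : F' (0, g') = deriv (F t) (g t) * g' := by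
    have h := congrArg (fun L : ℂ →L[ℝ] ℂ => L g')
      (e2.unique (h2.hasDerivAt.hasFDerivAt.restrictScalars ℝ))
    simpa [mul_comm] using h
  have e4 : HasDerivAt (fun s => F s (g s)) (F' (1, g')) t :=
    HasFDerivAt.comp_hasDerivAt (f := fun s : ℝ => (s, g s)) t hF' ((hasDerivAt_id t).prodMk hg)
  have e5 : ((1 : ℝ), g') = (1, 0) + (0, g') := by simp
  rw [e5, map_add, e3, ← e1.deriv] at e4
  exact e4

theorem im_hasDerivAt_div_eq_zero {F : ℝ → ℂ} {F' a u : ℂ} {t : ℝ} (hF : HasDerivAt F F' t)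
    (h : ∀ᶠ s in 𝓝 t, ((F s - a) / u).im = 0) : (F' / u).im = 0 := by
  have h1 : HasDerivAt (fun s => ((F s - a) / u).im) (F' / u).im t :=
    Complex.imCLM.hasFDerivAt.comp_hasDerivAt t ((hF.sub_const a).div_const u)
  exact h1.unique ((hasDerivAt_const t (0 : ℝ)).congr_of_eventuallyEq h)

theorem im_sub_div_sub_eq_zero {L : AffineSubspace ℝ ℂ} (hL : Module.finrank ℝ L.direction = 1)
    {a b x : ℂ} (ha : a ∈ L) (hb : b ∈ L) (hx : x ∈ L) (hab : a ≠ b) :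
    ((x - a) / (b - a)).im = 0 := by
  have hu : b - a ≠ 0 := sub_ne_zero.2 hab.symm
  have hu' : (⟨b - a, AffineSubspace.vsub_mem_direction hb ha⟩ : L.direction) ≠ 0 := by
    simpa [Subtype.ext_iff] using hu
  obtain ⟨c, hc⟩ := (finrank_eq_one_iff_of_nonzero' _ hu').1 hL
    ⟨x - a, AffineSubspace.vsub_mem_direction hx ha⟩
  have hc' : c • (b - a) = x - a := congrArg Subtype.val hc
  rw [← hc', Complex.real_smul, mul_div_cancel_right₀ _ hu, Complex.ofReal_im]

theorem im_eq_zero_of_mem_segment {a b x c u : ℂ} (hx : x ∈ segment ℝ a b)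
    (ha : ((a - c) / u).im = 0) (hb : ((b - c) / u).im = 0) : ((x - c) / u).im = 0 := by
  obtain ⟨θ, -, hθ⟩ := mem_segment_iff_exists_add.1 hx
  have : (x - c) / u = (a - c) / u + θ * ((b - c) / u - (a - c) / u) := by rw [hθ]; ring
  rw [this, Complex.add_im, Complex.im_ofReal_mul, Complex.sub_im, ha, hb]
  ring

/-- A moving point of a segment sliding along a line has the velocity of the endpoint with which it
coincides. -/
theorem deriv_eq_of_mem_segment {F a b : ℝ → ℂ} {t : ℝ} (hF : DifferentiableAt ℝ F t)
    (ha : DifferentiableAt ℝ a t) (hb : ContinuousAt b t) (hab : a t ≠ b t) (hFa : F t = a t)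
    (hseg : ∀ᶠ s in 𝓝 t, F s ∈ segment ℝ (a s) (b s))
    (hla : ∀ᶠ s in 𝓝 t, ((a s - a t) / (b t - a t)).im = 0)
    (hlb : ∀ᶠ s in 𝓝 t, ((b s - a t) / (b t - a t)).im = 0) : deriv F t = deriv a t := by
  have hu : b t - a t ≠ 0 := sub_ne_zero.2 hab.symm
  have hd : HasDerivAt (fun s => F s - a s) (deriv F t - deriv a t) t :=
    hF.hasDerivAt.fun_sub ha.hasDerivAt
  have hre : HasDerivAt (fun s => ((F s - a s) / (b t - a t)).re)
      ((deriv F t - deriv a t) / (b t - a t)).re t :=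
    Complex.reCLM.hasFDerivAt.comp_hasDerivAt t (hd.div_const _)
  have him : ((deriv F t - deriv a t) / (b t - a t)).im = 0 := by
    refine im_hasDerivAt_div_eq_zero (a := 0) hd ?_
    filter_upwards [hseg, hla, hlb] with s h1 h2 h3
    have h4 := im_eq_zero_of_mem_segment h1 h2 h3
    have h5 : (F s - a s - 0) / (b t - a t) =
        (F s - a t) / (b t - a t) - (a s - a t) / (b t - a t) := by ring
    rw [h5, Complex.sub_im, h4, h2, sub_zero]
  have hpos : ∀ᶠ s in 𝓝 t, 0 < ((b s - a s) / (b t - a t)).re := by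
    have hc : ContinuousAt (fun s => ((b s - a s) / (b t - a t)).re) t :=
      Complex.continuous_re.continuousAt.comp ((hb.sub ha.continuousAt).div_const _)
    refine hc.eventually_const_lt ?_
    simp [div_self hu]
  -- F lies on the side of a towards b and meets a at time t, so the signed distance from a to F has
  -- a minimum there.
  have hzero : ((deriv F t - deriv a t) / (b t - a t)).re = 0 := by
    refine IsLocalMin.hasDerivAt_eq_zero ?_ hre
    filter_upwards [hseg, hpos] with s h1 h2
    obtain ⟨θ, hθ, hθ'⟩ := mem_segment_iff_exists_add.1 h1
    simp only [hFa, sub_self, zero_div, Complex.zero_re]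
    rw [hθ', add_sub_cancel_left, mul_div_assoc, Complex.re_ofReal_mul]
    exact mul_nonneg hθ.1 h2.le
  have h6 := Complex.ext (w := 0) hzero him
  exact sub_eq_zero.1 ((div_eq_zero_iff.1 h6).resolve_right hu)

/-- The singular part of a quotient of holomorphic functions at a simple zero of the denominator. -/
theorem isBigO_div_sub_residue {F G : ℂ → ℂ} {c : ℂ} (hF : AnalyticAt ℂ F c) (hG : AnalyticAt ℂ G c)
    (hG0 : G c = 0) (hG1 : deriv G c ≠ 0) :
    (fun w => F w / G w - F c / deriv G c * (w - c)⁻¹) =O[𝓝[≠] c] fun _ => (1 : ℝ) := by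
  obtain ⟨g, hg, hGg⟩ : ∃ g : ℂ → ℂ, AnalyticAt ℂ g c ∧ ∀ w, G w = (w - c) * g w := by
    refine ⟨dslope G c, ?_, fun w => ?_⟩
    · obtain ⟨p, hp⟩ := hG
      exact ⟨p.fslope, hp.has_fpower_series_dslope_fslope⟩
    · have := sub_smul_dslope G c w
      rw [hG0, sub_zero, smul_eq_mul] at this
      exact this.symm
  have hgc : g c = deriv G c := by
    have h1 : HasDerivAt (fun w => (w - c) * g w) (g c) c := by
      simpa using ((hasDerivAt_id c).sub_const c).fun_mul hg.differentiableAt.hasDerivAt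
    have h2 : G = fun w => (w - c) * g w := funext hGg
    rw [h2, h1.deriv]
  have hg0 : g c ≠ 0 := by rwa [hgc]
  -- With G = (w - c)·g the expression to be bounded is Q(w)/(w - c), a difference quotient of Q
  -- because Q(c) = 0.
  set Q : ℂ → ℂ := fun w => F w / g w - F c / deriv G c with hQ
  have hQan : DifferentiableAt ℂ Q c := (hF.div hg hg0).differentiableAt.sub_const _
  have hQ0 : Q c = 0 := by simp [hQ, hgc]
  have hlim := (hasDerivAt_iff_tendsto_slope.1 hQan.hasDerivAt).isBigO_one ℝ
  refine hlim.congr' ?_ EventuallyEq.rfl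
  filter_upwards [self_mem_nhdsWithin,
    (hg.continuousAt.eventually_ne hg0).filter_mono nhdsWithin_le_nhds] with w hw hgw
  have hw' : w - c ≠ 0 := sub_ne_zero.2 hw
  rw [slope_def_field, hQ0, sub_zero, hGg]
  simp only [hQ]
  field_simp

/-! ### The variation on the sides of the strip -/

theorem IsSlitMap.map_mem_segment_of_im_eq_neg {m : ℝ} {A : Fin 4 → ℂ} {p : ℂ} {z : Fin 4 → ℂ}
    {f : ℂ → ℂ} (h : IsSlitMap m A p z f) {x : ℂ} (hx : x.im = -m) :
    f x ∈ segment ℝ (A 2) (A 3) := by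
  have h1 := h.flip.map_mem_segment (x := -x - m * Complex.I) (by simp [hx])
  have h2 : -(-x - m * Complex.I) - m * Complex.I = x := by ring
  rw [h2] at h1
  exact h1

theorem IsSlitMap.im_deriv_div_eq_zero_of_im_eq_neg {m : ℝ} {A : Fin 4 → ℂ} {p : ℂ} {z : Fin 4 → ℂ}
    {f : ℂ → ℂ} (h : IsSlitMap m A p z f) {x : ℂ} (hx : x.im = -m) :
    (deriv f x / (A 3 - A 2)).im = 0 := by
  have hxm : x ∈ closedStrip m \ intTranslates p := by
    have : x ∉ strip m := fun hs => hs.1.ne hx.symm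
    exact ⟨⟨hx.ge, by rw [hx]; linarith [h.width_pos]⟩, h.notMem_intTranslates_of_notMem_strip this⟩
  have h1 := h.flip.im_deriv_div_eq_zero_of_im_eq_zero (x := -x - m * Complex.I) (by simp [hx])
  rw [(h.deriv_flip hxm).1, neg_div, Complex.neg_im, neg_eq_zero] at h1
  exact h1

theorem IsSlitMap.mem_of_im_eq_neg {m : ℝ} {A : Fin 4 → ℂ} {p : ℂ} {z : Fin 4 → ℂ}
    {f : ℂ → ℂ} (h : IsSlitMap m A p z f) {x : ℂ} (hx : x.im = -m) :
    x ∈ closedStrip m \ intTranslates p :=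
  ⟨⟨hx.ge, by rw [hx]; linarith [h.width_pos]⟩,
    h.notMem_intTranslates_of_notMem_strip fun hs => hs.1.ne hx.symm⟩

theorem im_div_eq_zero_of_im_div {a b u : ℂ} (ha : (a / u).im = 0) (hb : (b / u).im = 0)
    (hu : u ≠ 0) : (a / b).im = 0 := by
  have h1 : a / b = (a / u) / (b / u) := by rw [div_div_div_cancel_right₀ hu]
  rw [h1, Complex.div_im, ha, hb]
  simp

namespace IsSmoothSlitFamily

variable {I : Set ℝ} {m : ℝ → ℝ} {A : Fin 4 → ℝ → ℂ} {p : ℝ → ℂ} {z : Fin 4 → ℝ → ℂ}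
  {f : ℝ → ℂ → ℂ} {t : ℝ}

theorem eventually_mem (hf : IsSmoothSlitFamily I m A p z f) (ht : t ∈ I) : ∀ᶠ s in 𝓝 t, s ∈ I :=
  hf.isOpen.mem_nhds ht

theorem differentiableAt_width (hf : IsSmoothSlitFamily I m A p z f) (ht : t ∈ I) :
    DifferentiableAt ℝ m t :=
  (hf.smooth_width.contDiffAt (hf.isOpen.mem_nhds ht)).differentiableAt one_ne_zero

theorem differentiableAt_pole (hf : IsSmoothSlitFamily I m A p z f) (ht : t ∈ I) :
    DifferentiableAt ℝ p t :=
  (hf.smooth_pole.contDiffAt (hf.isOpen.mem_nhds ht)).differentiableAt one_ne_zero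

theorem differentiableAt_endpoint (hf : IsSmoothSlitFamily I m A p z f) (ht : t ∈ I) (k : Fin 4) :
    DifferentiableAt ℝ (A k) t :=
  ((hf.smooth_endpoint k).contDiffAt (hf.isOpen.mem_nhds ht)).differentiableAt one_ne_zero

theorem im_endpoint_one (hf : IsSmoothSlitFamily I m A p z f) (ht : t ∈ I) {s : ℝ} (hs : s ∈ I) :
    ((A 0 s - A 0 t) / (A 1 t - A 0 t)).im = 0 ∧ ((A 1 s - A 0 t) / (A 1 t - A 0 t)).im = 0 ∧
    ((A 0 s - A 1 t) / (A 0 t - A 1 t)).im = 0 ∧ ((A 1 s - A 1 t) / (A 0 t - A 1 t)).im = 0 := by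
  obtain ⟨L, hL, hmem⟩ := hf.fixed_line_one
  have hne := (hf.isSlitMap t ht).ne_one_two
  obtain ⟨h0, h1⟩ := hmem t ht
  obtain ⟨h2, h3⟩ := hmem s hs
  exact ⟨im_sub_div_sub_eq_zero hL h0 h1 h2 hne, im_sub_div_sub_eq_zero hL h0 h1 h3 hne,
    im_sub_div_sub_eq_zero hL h1 h0 h2 hne.symm, im_sub_div_sub_eq_zero hL h1 h0 h3 hne.symm⟩

theorem im_endpoint_two (hf : IsSmoothSlitFamily I m A p z f) (ht : t ∈ I) {s : ℝ} (hs : s ∈ I) :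
    ((A 2 s - A 2 t) / (A 3 t - A 2 t)).im = 0 ∧ ((A 3 s - A 2 t) / (A 3 t - A 2 t)).im = 0 ∧
    ((A 2 s - A 3 t) / (A 2 t - A 3 t)).im = 0 ∧ ((A 3 s - A 3 t) / (A 2 t - A 3 t)).im = 0 := by
  obtain ⟨L, hL, hmem⟩ := hf.fixed_line_two
  have hne := (hf.isSlitMap t ht).ne_three_four
  obtain ⟨h0, h1⟩ := hmem t ht
  obtain ⟨h2, h3⟩ := hmem s hs
  exact ⟨im_sub_div_sub_eq_zero hL h0 h1 h2 hne, im_sub_div_sub_eq_zero hL h0 h1 h3 hne,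
    im_sub_div_sub_eq_zero hL h1 h0 h2 hne.symm, im_sub_div_sub_eq_zero hL h1 h0 h3 hne.symm⟩

theorem hasDerivAt_param (hf : IsSmoothSlitFamily I m A p z f) (ht : t ∈ I) {w : ℂ}
    (hw : w ∈ closedStrip (m t) \ intTranslates (p t)) :
    HasDerivAt (fun s => f s w) (deriv (fun s => f s w) t) t := by
  have h := hasDerivAt_param_comp (F := f) (g := fun _ => w)
    ((hf.smooth_map t ht w hw).1.differentiableAt one_ne_zero)
    ((hf.isSlitMap t ht).analytic w hw).differentiableAt (hasDerivAt_const t w)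
  simpa using h

/-- The point is carried along with the moving lower side, so that the image of a boundary point
stays on the second slit; the velocity -i ṁ of the point produces the extra term. -/
theorem hasDerivAt_lower_side (hf : IsSmoothSlitFamily I m A p z f) (ht : t ∈ I) {w : ℂ}
    (hw : w ∈ closedStrip (m t) \ intTranslates (p t)) :
    HasDerivAt (fun s => f s (w - (m s - m t) * Complex.I))
      (deriv (fun s => f s w) t - deriv (f t) w * (deriv m t * Complex.I)) t := by
  have hg : HasDerivAt (fun s => w - ((m s : ℂ) - m t) * Complex.I) (-(deriv m t * Complex.I)) t :=
    (((hf.differentiableAt_width ht).hasDerivAt.ofReal_comp.sub_const _).mul_const _).const_sub w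
  have h0 : w - ((m t : ℂ) - m t) * Complex.I = w := by ring
  have h := hasDerivAt_param_comp (F := f) (g := fun s => w - ((m s : ℂ) - m t) * Complex.I)
    (by rw [h0]; exact (hf.smooth_map t ht w hw).1.differentiableAt one_ne_zero)
    (by rw [h0]; exact ((hf.isSlitMap t ht).analytic w hw).differentiableAt) hg
  simp only [h0, mul_neg, ← sub_eq_add_neg] at h
  exact h

theorem map_lower_side_mem_segment (hf : IsSmoothSlitFamily I m A p z f) {w : ℂ}
    (hw : w.im = -m t) {s : ℝ} (hs : s ∈ I) :
    f s (w - (m s - m t) * Complex.I) ∈ segment ℝ (A 2 s) (A 3 s) := by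
  refine (hf.isSlitMap s hs).map_mem_segment_of_im_eq_neg ?_
  simp [hw]
  ring

/-- The variation of the map at the preimage of an endpoint is the velocity of the endpoint. -/
theorem deriv_param_endpoint (hf : IsSmoothSlitFamily I m A p z f) (ht : t ∈ I) (k : Fin 4) :
    deriv (fun s => f s (z k t)) t = deriv (A k) t := by
  have h := hf.isSlitMap t ht
  have hev := hf.eventually_mem ht
  have hd := hf.hasDerivAt_param ht (h.endpoint_mem k)
  have hd' := hf.hasDerivAt_lower_side ht (h.endpoint_mem k)
  -- Since f' vanishes at z_k, following the moving side does not change the parameter derivative.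
  rw [h.deriv_endpoint k, zero_mul, sub_zero] at hd'
  have hA := hf.differentiableAt_endpoint ht
  have hk := h.map_endpoint k
  fin_cases k
  · exact deriv_eq_of_mem_segment hd.differentiableAt (hA 0) (hA 1).continuousAt h.ne_one_two hk
      (hev.mono fun s hs => (hf.isSlitMap s hs).map_mem_segment h.im_one)
      (hev.mono fun s hs => (hf.im_endpoint_one ht hs).1)
      (hev.mono fun s hs => (hf.im_endpoint_one ht hs).2.1)
  · exact deriv_eq_of_mem_segment hd.differentiableAt (hA 1) (hA 0).continuousAt h.ne_one_two.symm hk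
      (hev.mono fun s hs => by
        rw [segment_symm]; exact (hf.isSlitMap s hs).map_mem_segment h.im_two)
      (hev.mono fun s hs => (hf.im_endpoint_one ht hs).2.2.2)
      (hev.mono fun s hs => (hf.im_endpoint_one ht hs).2.2.1)
  · refine hd'.deriv.symm.trans ?_
    refine deriv_eq_of_mem_segment hd'.differentiableAt (hA 2) (hA 3).continuousAt h.ne_three_four
      (by simpa using hk)
      (hev.mono fun s hs => hf.map_lower_side_mem_segment h.im_three hs)
      (hev.mono fun s hs => (hf.im_endpoint_two ht hs).1)
      (hev.mono fun s hs => (hf.im_endpoint_two ht hs).2.1)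
  · refine hd'.deriv.symm.trans ?_
    refine deriv_eq_of_mem_segment hd'.differentiableAt (hA 3) (hA 2).continuousAt
      h.ne_three_four.symm (by simpa using hk)
      (hev.mono fun s hs => by
        rw [segment_symm]; exact hf.map_lower_side_mem_segment h.im_four hs)
      (hev.mono fun s hs => (hf.im_endpoint_two ht hs).2.2.2)
      (hev.mono fun s hs => (hf.im_endpoint_two ht hs).2.2.1)

/-- Numerator and denominator are both real multiples of the direction of the first line. Where f' =
0 the quotient is 0 by convention, so no exception is needed. -/
theorem im_variation_upper_side (hf : IsSmoothSlitFamily I m A p z f) (ht : t ∈ I) {w : ℂ}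
    (hw : w.im = 0) : (deriv (fun s => f s w) t / deriv (f t) w).im = 0 := by
  have h := hf.isSlitMap t ht
  have hmem : w ∈ closedStrip (m t) \ intTranslates (p t) :=
    ⟨h.mem_closedStrip_of_im_eq_zero hw, h.notMem_poles_of_im_eq_zero hw⟩
  refine im_div_eq_zero_of_im_div (u := A 1 t - A 0 t) ?_ (h.im_deriv_div_eq_zero_of_im_eq_zero hw)
    (sub_ne_zero.2 h.ne_one_two.symm)
  refine im_hasDerivAt_div_eq_zero (a := A 0 t) (hf.hasDerivAt_param ht hmem) ?_
  filter_upwards [hf.eventually_mem ht] with s hs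
  obtain ⟨h1, h2, -⟩ := hf.im_endpoint_one ht hs
  exact im_eq_zero_of_mem_segment ((hf.isSlitMap s hs).map_mem_segment hw) h1 h2

/-- Along the moving side the derivative ∂_t f - i ṁ f' is parallel to the second line, as is f';
dividing by f' isolates ṁ. -/
theorem im_variation_lower_side (hf : IsSmoothSlitFamily I m A p z f) (ht : t ∈ I) {w : ℂ}
    (hw : w.im = -m t) (hd : deriv (f t) w ≠ 0) :
    (deriv (fun s => f s w) t / deriv (f t) w).im = deriv m t := by
  have h := hf.isSlitMap t ht
  have hmem := h.mem_of_im_eq_neg hw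
  have h1 : ((deriv (fun s => f s w) t - deriv (f t) w * (deriv m t * Complex.I)) /
      deriv (f t) w).im = 0 := by
    refine im_div_eq_zero_of_im_div (u := A 3 t - A 2 t) ?_ (h.im_deriv_div_eq_zero_of_im_eq_neg hw)
      (sub_ne_zero.2 h.ne_three_four.symm)
    refine im_hasDerivAt_div_eq_zero (a := A 2 t) (hf.hasDerivAt_lower_side ht hmem) ?_
    filter_upwards [hf.eventually_mem ht] with s hs
    obtain ⟨h1, h2, -⟩ := hf.im_endpoint_two ht hs
    exact im_eq_zero_of_mem_segment (hf.map_lower_side_mem_segment hw hs) h1 h2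
  rw [sub_div, mul_div_cancel_left₀ _ hd, Complex.sub_im, sub_eq_zero] at h1
  simpa using h1

/-- The velocity of an endpoint and f'' at its preimage are both parallel to the fixed line of the
slit. -/
theorem im_slitGamma (hf : IsSmoothSlitFamily I m A p z f) (ht : t ∈ I) (k : Fin 4) :
    (slitGamma A z f k t).im = 0 := by
  have h := hf.isSlitMap t ht
  have hev := hf.eventually_mem ht
  have hA := fun k => (hf.differentiableAt_endpoint ht k).hasDerivAt
  have hu1 := sub_ne_zero.2 h.ne_one_two.symm
  have hu2 := sub_ne_zero.2 h.ne_three_four.symm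
  have hup : ∀ k, (z k t).im = 0 → (iteratedDeriv 2 (f t) (z k t) / (A 1 t - A 0 t)).im = 0 :=
    fun k hk => h.im_iteratedDeriv_div_eq_zero hk
  have hlo : ∀ k, (z k t).im = -m t → (iteratedDeriv 2 (f t) (z k t) / (A 3 t - A 2 t)).im = 0 := by
    intro k hk
    have h1 := h.flip.im_iteratedDeriv_div_eq_zero (x := -z k t - m t * Complex.I) (by simp [hk])
    rwa [(h.deriv_flip (h.endpoint_mem k)).2] at h1
  unfold slitGamma
  fin_cases k
  · exact im_div_eq_zero_of_im_div (im_hasDerivAt_div_eq_zero (a := A 0 t) (hA 0)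
      (hev.mono fun s hs => (hf.im_endpoint_one ht hs).1)) (hup 0 h.im_one) hu1
  · exact im_div_eq_zero_of_im_div (im_hasDerivAt_div_eq_zero (a := A 0 t) (hA 1)
      (hev.mono fun s hs => (hf.im_endpoint_one ht hs).2.1)) (hup 1 h.im_two) hu1
  · exact im_div_eq_zero_of_im_div (im_hasDerivAt_div_eq_zero (a := A 2 t) (hA 2)
      (hev.mono fun s hs => (hf.im_endpoint_two ht hs).1)) (hlo 2 h.im_three) hu2
  · exact im_div_eq_zero_of_im_div (im_hasDerivAt_div_eq_zero (a := A 2 t) (hA 3)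
      (hev.mono fun s hs => (hf.im_endpoint_two ht hs).2.1)) (hlo 3 h.im_four) hu2

theorem periodic_deriv_param (hf : IsSmoothSlitFamily I m A p z f) (ht : t ∈ I) :
    Function.Periodic (fun w => deriv (fun s => f s w) t) 1 := by
  intro w
  refine EventuallyEq.deriv_eq ?_
  filter_upwards [hf.eventually_mem ht] with s hs
  exact (hf.isSlitMap s hs).periodic w

theorem eventually_differentiableAt_param (hf : IsSmoothSlitFamily I m A p z f) (ht : t ∈ I) {w : ℂ}
    (hw : w ∈ closedStrip (m t) \ intTranslates (p t)) :
    ∀ᶠ v in 𝓝 w, DifferentiableAt ℂ (fun v => deriv (fun s => f s v) t) v :=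
  eventually_differentiableAt_deriv_param (hf.smooth_map t ht w hw).1 (hf.smooth_map t ht w hw).2

end IsSmoothSlitFamily

/-! ### The variation at the pole of f -/

/-- The reciprocal of a function that tends to infinity has a removable singularity. -/
theorem analyticAt_of_eventuallyEq_inv_sub {F f : ℂ → ℂ} {c w₀ : ℂ} (hF0 : F c = 0)
    (hF : ∀ᶠ w in 𝓝[≠] c, F w = (f w - w₀)⁻¹) (hd : ∀ᶠ w in 𝓝[≠] c, DifferentiableAt ℂ f w)
    (ht : Tendsto f (𝓝[≠] c) (Bornology.cobounded ℂ)) : AnalyticAt ℂ F c := by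
  have ht' : Tendsto (fun w => f w - w₀) (𝓝[≠] c) (Bornology.cobounded ℂ) :=
    (tendsto_sub_const_cobounded w₀).comp ht
  refine Complex.analyticAt_of_differentiable_on_punctured_nhds_of_continuousAt ?_ ?_
  · filter_upwards [eventually_nhdsNE_eventually_nhds_iff.2 hF, hd, ht'.eventually_ne_cobounded 0]
      with w h1 h2 h3
    exact ((h2.sub_const w₀).inv h3).congr_of_eventuallyEq h1
  · rw [← continuousWithinAt_compl_self, ContinuousWithinAt, hF0]
    exact (tendsto_inv₀_cobounded.comp ht').congr' (hF.mono fun w hw => hw.symm)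

theorem eventually_notMem_intTranslates (p c : ℂ) : ∀ᶠ w in 𝓝[≠] c, w ∉ intTranslates p := by
  filter_upwards [eventually_sin_ne_zero p c] with w hw
  rintro ⟨n, rfl⟩
  exact hw (by rw [add_sub_cancel_left]; exact sin_pi_mul_eq_zero_iff.2 ⟨n, rfl⟩)

namespace IsSlitMap

variable {m : ℝ} {A : Fin 4 → ℂ} {p : ℂ} {z : Fin 4 → ℂ} {f : ℂ → ℂ}

theorem eventually_mem_strip_diff (h : IsSlitMap m A p z f) :
    ∀ᶠ w in 𝓝[≠] p, w ∈ strip m \ intTranslates p :=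
  Filter.Eventually.and (mem_nhdsWithin_of_mem_nhds ((isOpen_strip m).mem_nhds h.pole_mem))
    (eventually_notMem_intTranslates p p)

/-- The reciprocal of f, with value 0 at p, is analytic and injective near p, so its zero is simple.
-/
theorem exists_inv_analyticAt (h : IsSlitMap m A p z f) : ∃ F : ℂ → ℂ, AnalyticAt ℂ F p ∧
    F p = 0 ∧ deriv F p ≠ 0 ∧ ∀ w, w ≠ p → F w = (f w)⁻¹ := by
  classical
  set F : ℂ → ℂ := Function.update (fun w => (f w)⁻¹) p 0 with hF
  have hFp : F p = 0 := by simp [hF]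
  have hFw : ∀ w, w ≠ p → F w = (f w)⁻¹ := fun w hw => by rw [hF, Function.update_of_ne hw]
  have han : AnalyticAt ℂ F p := by
    refine analyticAt_of_eventuallyEq_inv_sub (f := f) (w₀ := 0) hFp ?_ ?_ h.pole
    · filter_upwards [self_mem_nhdsWithin] with w hw
      rw [sub_zero, hFw w hw]
    · filter_upwards [h.eventually_mem_strip_diff] with w hw
      exact (h.analyticAt hw).differentiableAt
  refine ⟨F, han, hFp, ?_, hFw⟩
  obtain ⟨U, hU, hinj⟩ := h.exists_nhds_injOn p
  have hV : ∀ᶠ w in 𝓝[≠] p, w ∈ U ∧ w ∈ strip m \ intTranslates p ∧ f w ≠ 0 :=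
    Filter.Eventually.and (mem_nhdsWithin_of_mem_nhds hU)
      (h.eventually_mem_strip_diff.and (h.pole.eventually_ne_cobounded 0))
  refine han.deriv_ne_zero_of_injOn (insert_mem_nhds_iff.2 hV) ?_
  have hne : ∀ w, (w ∈ U ∧ w ∈ strip m \ intTranslates p ∧ f w ≠ 0) → w ≠ p := fun w hw hwp =>
    hw.2.1.2 (hwp ▸ mem_intTranslates_self p)
  rintro u (rfl | hu) v (rfl | hv) huv
  · rfl
  · rw [hFp, hFw v (hne v hv)] at huv
    exact absurd huv.symm (inv_ne_zero hv.2.2)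
  · rw [hFp, hFw u (hne u hu)] at huv
    exact absurd huv (inv_ne_zero hu.2.2)
  · rw [hFw u (hne u hu), hFw v (hne v hv)] at huv
    exact hinj ⟨hu.1, hu.2.1⟩ ⟨hv.1, hv.2.1⟩ (inv_injective huv)

/-- The pole is simple. -/
theorem exists_regularization (h : IsSlitMap m A p z f) : ∃ g : ℂ → ℂ, g p ≠ 0 ∧
    (∀ w, w ≠ p → g w = (w - p) * f w) ∧
    ∀ w ∈ strip m, (w = p ∨ w ∉ intTranslates p) → DifferentiableAt ℂ g w := by
  classical
  obtain ⟨F, hF, hF0, hF1, hFw⟩ := h.exists_inv_analyticAt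
  set g : ℂ → ℂ := Function.update (fun w => (w - p) * f w) p (deriv F p)⁻¹ with hg
  have hgw : ∀ w, w ≠ p → g w = (w - p) * f w := fun w hw => by rw [hg, Function.update_of_ne hw]
  have hd : ∀ w ∈ strip m, w ∉ intTranslates p → DifferentiableAt ℂ g w := by
    intro w hw hwp
    have hwne : w ≠ p := fun hc => hwp (hc ▸ mem_intTranslates_self p)
    have h1 : DifferentiableAt ℂ (fun w => (w - p) * f w) w :=
      (differentiableAt_id.sub_const p).fun_mul (h.analyticAt ⟨hw, hwp⟩).differentiableAt
    refine h1.congr_of_eventuallyEq ?_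
    filter_upwards [isOpen_compl_singleton.mem_nhds hwne] with v hv
    exact hgw v hv
  refine ⟨g, by simp [hg, hF1], hgw, ?_⟩
  rintro w hw (rfl | hwp)
  · refine (Complex.analyticAt_of_differentiable_on_punctured_nhds_of_continuousAt ?_ ?_).differentiableAt
    · filter_upwards [h.eventually_mem_strip_diff] with v hv
      exact hd v hv.1 hv.2
    · have h1 := (hasDerivAt_iff_tendsto_slope.1 hF.differentiableAt.hasDerivAt).inv₀ hF1
      rw [hg, continuousAt_update_same]
      refine h1.congr' ?_
      filter_upwards [self_mem_nhdsWithin] with v hv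
      rw [slope_def_field, hF0, sub_zero, hFw v hv, inv_div, div_inv_eq_mul]
  · exact hd w hw hwp

end IsSlitMap

/-- A C¹ map is locally Lipschitz; compactness makes the constant and the range of s uniform. -/
theorem exists_lipschitz_on_compact {G : ℝ → ℂ → ℂ} {t : ℝ} {K : Set ℂ} (hK : IsCompact K)
    (hG : ∀ w ∈ K, ContDiffAt ℝ 1 (fun x : ℝ × ℂ => G x.1 x.2) (t, w)) :
    ∃ M : ℝ, ∀ᶠ s in 𝓝 t, ∀ w ∈ K, ‖G s w - G t w‖ ≤ M * |s - t| := by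
  refine hK.induction_on (p := fun S => ∃ M : ℝ, ∀ᶠ s in 𝓝 t, ∀ w ∈ S, ‖G s w - G t w‖ ≤ M * |s - t|)
    ⟨0, by simp⟩ ?_ ?_ ?_
  · rintro S T hST ⟨M, hM⟩
    exact ⟨M, hM.mono fun s hs w hw => hs w (hST hw)⟩
  · rintro S T ⟨M, hM⟩ ⟨N, hN⟩
    refine ⟨max M N, ?_⟩
    filter_upwards [hM, hN] with s h1 h2 w hw
    rcases hw with hw | hw
    · exact (h1 w hw).trans (by gcongr; exact le_max_left _ _)
    · exact (h2 w hw).trans (by gcongr; exact le_max_right _ _)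
  · intro w hw
    obtain ⟨C, U, hU, hlip⟩ := (hG w hw).exists_lipschitzOnWith
    rw [nhds_prod_eq, mem_prod_iff] at hU
    obtain ⟨S, hS, T, hT, hST⟩ := hU
    refine ⟨T, mem_nhdsWithin_of_mem_nhds hT, C, ?_⟩
    filter_upwards [hS] with s hs v hv
    have h1 := hlip.dist_le_mul (s, v) (hST ⟨hs, hv⟩) (t, v) (hST ⟨mem_of_mem_nhds hS, hv⟩)
    have h2 : dist (s, v) (t, v) = |s - t| := by simp [Prod.dist_eq, Real.dist_eq]
    rw [h2, dist_eq_norm] at h1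
    exact h1

namespace IsSmoothSlitFamily

variable {I : Set ℝ} {m : ℝ → ℝ} {A : Fin 4 → ℝ → ℂ} {p : ℝ → ℂ} {z : Fin 4 → ℝ → ℂ}
  {f : ℝ → ℂ → ℂ} {t : ℝ}

/-- The parameter derivative of `(w - p(t)) f(w, t)` is bounded near the pole. -/
theorem exists_bound_near_pole (hf : IsSmoothSlitFamily I m A p z f) (ht : t ∈ I) :
    ∃ M : ℝ, ∀ᶠ w in 𝓝[≠] (p t),
      ‖(w - p t) * deriv (fun s => f s w) t - deriv p t * f t w‖ ≤ M := by
  have h := hf.isSlitMap t ht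
  obtain ⟨ρ, hρ, hρs⟩ := Metric.isOpen_iff.1 (isOpen_strip (m t)) _ h.pole_mem
  -- ρ/2 keeps the closed ball inside the strip, and 1/4 makes it too small to contain two
  -- translates of a pole.
  set r : ℝ := min (ρ / 2) (1 / 4) with hr
  have hr0 : 0 < r := by positivity
  have hr4 : r ≤ 1 / 4 := min_le_right _ _
  have hsub : Metric.closedBall (p t) r ⊆ strip (m t) :=
    (Metric.closedBall_subset_ball ((min_le_left _ _).trans_lt (half_lt_self hρ))).trans hρs
  -- the ball stays in the strips, and contains exactly one pole
  have hnp : ∀ s, p s ∈ Metric.ball (p t) r → ∀ w ∈ Metric.closedBall (p t) r,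
      w = p s ∨ w ∉ intTranslates (p s) := by
    intro s hs w hw
    by_contra! hcon
    obtain ⟨hne, n, hn⟩ := hcon
    have h1 : dist w (p s) < 1 := by
      have := dist_triangle_right w (p s) (p t)
      rw [Metric.mem_closedBall] at hw
      rw [Metric.mem_ball] at hs
      linarith
    rw [hn, dist_self_add_left, Complex.norm_intCast] at h1
    have h2 : n = 0 := Int.abs_lt_one_iff.1 (by exact_mod_cast h1)
    exact hne (by rw [hn, h2]; simp)
  have hps : ∀ᶠ s in 𝓝 t, p s ∈ Metric.ball (p t) r :=
    (hf.differentiableAt_pole ht).continuousAt.eventually_mem (Metric.ball_mem_nhds _ hr0)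
  have hstrip : ∀ᶠ s in 𝓝 t, Metric.closedBall (p t) r ⊆ strip (m s) := by
    obtain ⟨w₀, hw₀, hmin⟩ := (isCompact_closedBall (p t) r).exists_isMinOn
      (Metric.nonempty_closedBall.2 hr0.le) Complex.continuous_im.continuousOn
    have h1 : -w₀.im < m t := by linarith [(hsub hw₀).1]
    filter_upwards [(hf.differentiableAt_width ht).continuousAt.eventually_const_lt h1]
      with s hs w hw
    have h2 : w₀.im ≤ w.im := hmin hw
    exact ⟨by linarith, (hsub hw).2⟩
  set G : ℝ → ℂ → ℂ := fun s w => (w - p s) * f s w with hG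
  obtain ⟨M, hM⟩ := exists_lipschitz_on_compact (G := G) (t := t) (isCompact_sphere (p t) r) (by
    intro w hw
    have hwp : w ≠ p t := by
      rintro rfl
      simp at hw
      exact hr0.ne hw
    have hwb : w ∈ Metric.closedBall (p t) r := Metric.sphere_subset_closedBall hw
    have h1 := (hf.smooth_map t ht w ⟨strip_subset_closedStrip _ (hsub hwb),
      ((hnp t (Metric.mem_ball_self hr0) w hwb).resolve_left hwp)⟩).1
    have h2 : ContDiffAt ℝ 1 (fun x : ℝ × ℂ => p x.1) (t, w) :=
      (hf.smooth_pole.contDiffAt (hf.isOpen.mem_nhds ht)).comp (t, w) contDiffAt_fst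
    exact (contDiffAt_snd.sub h2).mul h1)
  -- Once the poles are filled in, (w - p(s)) f(w, s) is holomorphic in the ball. The maximum
  -- principle then carries the Lipschitz bound from the circle, where f is C¹, to points
  -- arbitrarily close to the pole.
  have hmax : ∀ᶠ s in 𝓝 t, ∀ w ∈ Metric.closedBall (p t) r, w ≠ p s → w ≠ p t →
      ‖G s w - G t w‖ ≤ M * |s - t| := by
    filter_upwards [hM, hps, hstrip, hf.eventually_mem ht] with s h1 h2 h3 h4 w hw hws hwt
    obtain ⟨g, -, hgw, hgd⟩ := (hf.isSlitMap s h4).exists_regularization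
    obtain ⟨k, -, hkw, hkd⟩ := h.exists_regularization
    have hdiff : ∀ v ∈ Metric.closedBall (p t) r, DifferentiableAt ℂ (fun v => g v - k v) v :=
      fun v hv => (hgd v (h3 hv) (hnp s h2 v hv)).sub
        (hkd v (hsub hv) (hnp t (Metric.mem_ball_self hr0) v hv))
    have h5 := Complex.norm_le_of_forall_mem_frontier_norm_le (f := fun v => g v - k v)
      (U := Metric.ball (p t) r) Metric.isBounded_ball (C := M * |s - t|)
      (DifferentiableOn.diffContOnCl fun v hv =>
        (hdiff v (Metric.closure_ball_subset_closedBall hv)).differentiableWithinAt)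
      (by
        intro v hv
        rw [frontier_ball _ hr0.ne'] at hv
        have e1 : v ≠ p s := by
          rintro rfl
          exact (Metric.mem_ball.1 h2).ne hv
        have e2 : v ≠ p t := by
          rintro rfl
          simp at hv
          exact hr0.ne hv
        rw [hgw v e1, hkw v e2]
        exact h1 v hv)
      (by rw [closure_ball _ hr0.ne']; exact hw)
    simp only [hgw w hws, hkw w hwt] at h5
    exact h5
  refine ⟨M, ?_⟩
  filter_upwards [self_mem_nhdsWithin, mem_nhdsWithin_of_mem_nhds (Metric.closedBall_mem_nhds (p t) hr0)]
    with w hw hwb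
  have hwp : w ≠ p t := hw
  have hwmem : w ∈ closedStrip (m t) \ intTranslates (p t) :=
    ⟨strip_subset_closedStrip _ (hsub hwb), (hnp t (Metric.mem_ball_self hr0) w hwb).resolve_left hwp⟩
  have hder : HasDerivAt (fun s => G s w)
      ((w - p t) * deriv (fun s => f s w) t - deriv p t * f t w) t := by
    have := ((hf.differentiableAt_pole ht).hasDerivAt.const_sub w).fun_mul
      (hf.hasDerivAt_param ht hwmem)
    have e : (w - p t) * deriv (fun s => f s w) t - deriv p t * f t w =
        -deriv p t * f t w + (w - p t) * deriv (fun s => f s w) t := by ring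
    rw [e]
    exact this
  have hne : ∀ᶠ s in 𝓝 t, w ≠ p s := by
    have := (hf.differentiableAt_pole ht).continuousAt.eventually_ne hwp.symm
    exact this.mono fun s hs => hs.symm
  have hslope := (hasDerivAt_iff_tendsto_slope.1 hder).norm
  refine le_of_tendsto hslope ?_
  filter_upwards [hmax.filter_mono nhdsWithin_le_nhds, hne.filter_mono nhdsWithin_le_nhds,
    self_mem_nhdsWithin] with s h1 h2 h3
  have h4 := h1 w hwb h2 hwp
  have h5 : 0 < |s - t| := abs_pos.2 (sub_ne_zero.2 h3)
  rw [slope, vsub_eq_sub, norm_smul, norm_inv, Real.norm_eq_abs, inv_mul_le_iff₀ h5, mul_comm]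
  exact h4

/-- The numerator has at most a double pole at p(t) and the denominator exactly a double one: (w -
p)² f' tends to -g(p) ≠ 0, where g is the regularization (w - p) f. -/
theorem isBigO_variation_pole (hf : IsSmoothSlitFamily I m A p z f) (ht : t ∈ I) :
    (fun w => deriv (fun s => f s w) t / deriv (f t) w) =O[𝓝[≠] (p t)] fun _ => (1 : ℝ) := by
  have h := hf.isSlitMap t ht
  obtain ⟨M, hM⟩ := hf.exists_bound_near_pole ht
  obtain ⟨g, hg0, hgw, hgd⟩ := h.exists_regularization
  have hgan : AnalyticAt ℂ g (p t) := by
    refine Complex.analyticAt_of_differentiable_on_punctured_nhds_of_continuousAt ?_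
      (hgd _ h.pole_mem (Or.inl rfl)).continuousAt
    filter_upwards [h.eventually_mem_strip_diff] with v hv
    exact hgd v hv.1 (Or.inr hv.2)
  have hle : 𝓝[≠] (p t) ≤ 𝓝 (p t) := nhdsWithin_le_nhds
  have hid : Tendsto (fun w => w - p t) (𝓝[≠] (p t)) (𝓝 0) := by
    have : Continuous fun w => w - p t := by fun_prop
    simpa using (this.tendsto (p t)).mono_left hle
  have h1 : (fun w => (w - p t) ^ 2 * deriv (fun s => f s w) t) =O[𝓝[≠] (p t)]
      fun _ => (1 : ℝ) := by
    have e1 : (fun w => (w - p t) * deriv (fun s => f s w) t - deriv p t * f t w)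
        =O[𝓝[≠] (p t)] fun _ => (1 : ℝ) :=
      Asymptotics.IsBigO.of_bound M (by simpa using hM)
    have e2 := (hid.isBigO_one ℝ).mul e1
    have e3 := ((hgan.continuousAt.tendsto.mono_left hle).const_mul (deriv p t)).isBigO_one ℝ
    simp only [mul_one] at e2
    refine (e2.add e3).congr' ?_ EventuallyEq.rfl
    filter_upwards [self_mem_nhdsWithin] with w hw
    rw [hgw w hw]
    ring
  have h2 : Tendsto (fun w => (w - p t) ^ 2 * deriv (f t) w) (𝓝[≠] (p t)) (𝓝 (-g (p t))) := by
    have e1 : Tendsto (fun w => deriv g w * (w - p t) - g w) (𝓝[≠] (p t)) (𝓝 (-g (p t))) := by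
      have e2 := ((hgan.deriv.continuousAt.tendsto.mono_left hle).mul hid).sub
        (hgan.continuousAt.tendsto.mono_left hle)
      simpa using e2
    refine e1.congr' ?_
    filter_upwards [h.eventually_mem_strip_diff, self_mem_nhdsWithin] with w hw hwp
    have hwp' : w ≠ p t := hwp
    have hsub : w - p t ≠ 0 := sub_ne_zero.2 hwp'
    have e3 : HasDerivAt g (1 * f t w + (w - p t) * deriv (f t) w) w := by
      refine HasDerivAt.congr_of_eventuallyEq (f := fun w => (w - p t) * f t w) ?_ ?_
      · exact ((hasDerivAt_id w).sub_const (p t)).fun_mul (h.analyticAt hw).differentiableAt.hasDerivAt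
      · filter_upwards [isOpen_compl_singleton.mem_nhds hwp'] with v hv
        exact hgw v hv
    rw [e3.deriv, hgw w hwp']
    ring
  have h3 := h1.mul ((h2.inv₀ (neg_ne_zero.2 hg0)).isBigO_one ℝ)
  simp only [mul_one] at h3
  refine h3.congr' ?_ EventuallyEq.rfl
  filter_upwards [self_mem_nhdsWithin] with w hw
  have hsub : (w - p t) ^ 2 ≠ 0 := pow_ne_zero 2 (sub_ne_zero.2 hw)
  rw [← div_eq_mul_inv, mul_div_mul_left _ _ hsub]

end IsSmoothSlitFamily

/-! ### All singularities of the variation, and the formula for ṁ -/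

theorem isBigO_cot_pi {a c : ℂ} (h : c ∉ intTranslates a) :
    (fun w => Real.pi * Complex.cot (Real.pi * (w - a))) =O[𝓝[≠] c] fun _ => (1 : ℝ) := by
  have hs : Complex.sin (Real.pi * (c - a)) ≠ 0 := by
    intro h0
    obtain ⟨n, hn⟩ := sin_pi_mul_eq_zero_iff.1 h0
    exact h ⟨n, by rw [← hn]; ring⟩
  exact ((differentiableAt_cot_pi hs).continuousAt.tendsto.mono_left nhdsWithin_le_nhds).isBigO_one ℝ

theorem isBigO_cot_pi_sub_inv {a c : ℂ} (h : c ∈ intTranslates a) :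
    (fun w => Real.pi * Complex.cot (Real.pi * (w - a)) - (w - c)⁻¹) =O[𝓝[≠] c]
      fun _ => (1 : ℝ) := by
  obtain ⟨n, hn⟩ := h
  have hs : Complex.sin (Real.pi * (c - a)) = 0 :=
    sin_pi_mul_eq_zero_iff.2 ⟨n, by rw [hn, add_sub_cancel_left]⟩
  have hc : Complex.cos (Real.pi * (c - a)) ≠ 0 := by
    intro hcos
    have := Complex.sin_sq_add_cos_sq (Real.pi * (c - a))
    simp [hs, hcos] at this
  have hpi : (Real.pi : ℂ) ≠ 0 := by exact_mod_cast Real.pi_ne_zero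
  have hd : HasDerivAt (fun w : ℂ => Complex.sin (Real.pi * (w - a)))
      (Complex.cos (Real.pi * (c - a)) * Real.pi) c := by
    have := (Complex.hasDerivAt_sin (Real.pi * (c - a))).comp c
      (((hasDerivAt_id c).sub_const a).const_mul (Real.pi : ℂ))
    simpa [Function.comp_def] using this
  have h1 : AnalyticAt ℂ (fun w : ℂ => Real.pi * Complex.cos (Real.pi * (w - a))) c := by fun_prop
  have h2 : AnalyticAt ℂ (fun w : ℂ => Complex.sin (Real.pi * (w - a))) c := by fun_prop
  have h3 := isBigO_div_sub_residue h1 h2 hs (by rw [hd.deriv]; exact mul_ne_zero hc hpi)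
  rw [hd.deriv, mul_comm (Real.pi : ℂ) (Complex.cos _), div_self (mul_ne_zero hc hpi)] at h3
  simpa only [Complex.cot_eq_cos_div_sin, one_mul, mul_div_assoc] using h3

theorem deriv_add_int_of_periodic {f : ℂ → ℂ} (hf : Function.Periodic f 1) (w : ℂ) (n : ℤ) :
    deriv f (w + n) = deriv f w := by
  rw [← deriv_comp_add_const]
  congr 1
  funext v
  simpa using (hf.int_mul n) v

namespace IsSlitMap

variable {m : ℝ} {A : Fin 4 → ℂ} {p : ℂ} {z : Fin 4 → ℂ} {f : ℂ → ℂ}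

theorem deriv_add_int (h : IsSlitMap m A p z f) (w : ℂ) (n : ℤ) : deriv f (w + n) = deriv f w :=
  deriv_add_int_of_periodic h.periodic w n

theorem iteratedDeriv_add_int (h : IsSlitMap m A p z f) (w : ℂ) (n : ℤ) :
    iteratedDeriv 2 f (w + n) = iteratedDeriv 2 f w := by
  rw [iteratedDeriv_succ, iteratedDeriv_one]
  exact deriv_add_int_of_periodic (fun v => by simpa using h.deriv_add_int v 1) w n

theorem deriv_eq_zero_iff (h : IsSlitMap m A p z f) {x : ℂ}
    (hx : x ∈ closedStrip m \ intTranslates p) : deriv f x = 0 ↔ ∃ k, x ∈ intTranslates (z k) := by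
  refine ⟨h.exists_eq_endpoint_add_int hx, ?_⟩
  rintro ⟨k, n, rfl⟩
  rw [h.deriv_add_int, h.deriv_endpoint]

theorem eventually_deriv_ne_zero (h : IsSlitMap m A p z f) {c : ℂ}
    (hc : c ∈ closedStrip m \ intTranslates p) : ∀ᶠ w in 𝓝[≠] c, deriv f w ≠ 0 := by
  have hd := (h.analytic c hc).deriv.differentiableAt
  by_cases h0 : deriv f c = 0
  · obtain ⟨k, n, rfl⟩ := h.exists_eq_endpoint_add_int hc h0
    refine hd.hasDerivAt.eventually_ne ?_
    have := h.iteratedDeriv_endpoint_ne_zero k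
    rwa [← h.iteratedDeriv_add_int _ n, iteratedDeriv_succ, iteratedDeriv_one] at this
  · exact (hd.continuousAt.eventually_ne h0).filter_mono nhdsWithin_le_nhds

theorem mem_strip_of_mem_intTranslates (h : IsSlitMap m A p z f) {x : ℂ} (hx : x ∈ intTranslates p) :
    x ∈ strip m := by
  by_contra hn
  exact h.notMem_intTranslates_of_notMem_strip hn hx

theorem notMem_intTranslates_endpoint (h : IsSlitMap m A p z f) {x : ℂ} (hx : x ∈ intTranslates p)
    (k : Fin 4) : x ∉ intTranslates (z k) := by
  rintro ⟨n, rfl⟩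
  exact (h.endpoint_mem k).2 ((add_int_mem_intTranslates_iff n).1 hx)

end IsSlitMap

namespace IsSmoothSlitFamily

variable {I : Set ℝ} {m : ℝ → ℝ} {A : Fin 4 → ℝ → ℂ} {p : ℝ → ℂ} {z : Fin 4 → ℝ → ℂ}
  {f : ℝ → ℂ → ℂ} {t : ℝ}

theorem periodic_variation (hf : IsSmoothSlitFamily I m A p z f) (ht : t ∈ I) :
    Function.Periodic (fun w => deriv (fun s => f s w) t / deriv (f t) w) 1 := by
  intro w
  have h1 := hf.periodic_deriv_param ht w
  have h2 := (hf.isSlitMap t ht).deriv_add_int w 1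
  rw [Int.cast_one] at h2
  simp only at h1 ⊢
  rw [h1, h2]

theorem eventually_differentiableAt_variation (hf : IsSmoothSlitFamily I m A p z f) (ht : t ∈ I)
    {c : ℂ} (hc : c ∈ closedStrip (m t)) :
    ∀ᶠ w in 𝓝[≠] c, DifferentiableAt ℂ (fun w => deriv (fun s => f s w) t / deriv (f t) w) w := by
  have h := hf.isSlitMap t ht
  by_cases hp : c ∈ intTranslates (p t)
  · filter_upwards [eventually_notMem_intTranslates (p t) c, mem_nhdsWithin_of_mem_nhds
      ((isOpen_strip (m t)).mem_nhds (h.mem_strip_of_mem_intTranslates hp))] with w hw hws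
    have hw' : w ∈ closedStrip (m t) \ intTranslates (p t) := ⟨strip_subset_closedStrip _ hws, hw⟩
    exact (hf.eventually_differentiableAt_param ht hw').self_of_nhds.div
      (h.analytic w hw').deriv.differentiableAt (h.deriv_ne_zero ⟨hws, hw⟩)
  · filter_upwards [(hf.eventually_differentiableAt_param ht ⟨hc, hp⟩).filter_mono nhdsWithin_le_nhds,
      (h.analytic c ⟨hc, hp⟩).deriv.eventually_analyticAt.filter_mono nhdsWithin_le_nhds,
      h.eventually_deriv_ne_zero ⟨hc, hp⟩] with w h1 h2 h3
    exact h1.div h2.differentiableAt h3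

theorem deriv_param_analyticAt (hf : IsSmoothSlitFamily I m A p z f) (ht : t ∈ I) {w : ℂ}
    (hw : w ∈ closedStrip (m t) \ intTranslates (p t)) :
    AnalyticAt ℂ (fun v => deriv (fun s => f s v) t) w := by
  have h := hf.eventually_differentiableAt_param ht hw
  rwa [← Complex.analyticAt_iff_eventually_differentiableAt] at h

theorem ofReal_re_slitGamma (hf : IsSmoothSlitFamily I m A p z f) (ht : t ∈ I) (k : Fin 4) :
    (((slitGamma A z f k t).re : ℝ) : ℂ) = slitGamma A z f k t :=
  Complex.ext rfl (hf.im_slitGamma ht k).symm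

/-- The singularities of the variation in the closed strip are simple poles at the preimages of the
endpoints of the slits. -/
theorem isBigO_variation_sub_cot (hf : IsSmoothSlitFamily I m A p z f) (ht : t ∈ I) {c : ℂ}
    (hc : c ∈ closedStrip (m t)) :
    (fun w => deriv (fun s => f s w) t / deriv (f t) w - ∑ k, ((slitGamma A z f k t).re : ℂ) *
      (Real.pi * Complex.cot (Real.pi * (w - z k t)))) =O[𝓝[≠] c] fun _ => (1 : ℝ) := by
  have h := hf.isSlitMap t ht
  have hregular : (∀ k, c ∉ intTranslates (z k t)) →
      (fun w => deriv (fun s => f s w) t / deriv (f t) w) =O[𝓝[≠] c] (fun _ => (1 : ℝ)) →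
      (fun w => deriv (fun s => f s w) t / deriv (f t) w - ∑ k, ((slitGamma A z f k t).re : ℂ) *
        (Real.pi * Complex.cot (Real.pi * (w - z k t)))) =O[𝓝[≠] c] fun _ => (1 : ℝ) :=
    fun h1 h2 => h2.sub (Asymptotics.IsBigO.fun_sum fun k _ => (isBigO_cot_pi (h1 k)).const_mul_left _)
  by_cases hp : c ∈ intTranslates (p t)
  · refine hregular (h.notMem_intTranslates_endpoint hp) ?_
    obtain ⟨n, rfl⟩ := hp
    have htend : Tendsto (fun w : ℂ => w - n) (𝓝[≠] (p t + n)) (𝓝[≠] (p t)) := by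
      refine tendsto_nhdsWithin_iff.2 ⟨?_, ?_⟩
      · have : Continuous fun w : ℂ => w - n := by fun_prop
        simpa using (this.tendsto (p t + n)).mono_left nhdsWithin_le_nhds
      · filter_upwards [self_mem_nhdsWithin] with w hw hw'
        exact hw (by rw [mem_singleton_iff] at hw' ⊢; rw [← hw']; ring)
    refine ((hf.isBigO_variation_pole ht).comp_tendsto htend).congr_left fun w => ?_
    have := (hf.periodic_variation ht).int_mul n (w - n)
    simp only [mul_one, sub_add_cancel] at this
    exact this.symm
  have hFan := hf.deriv_param_analyticAt ht ⟨hc, hp⟩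
  have hGan := (h.analytic c ⟨hc, hp⟩).deriv
  by_cases h0 : deriv (f t) c = 0
  · obtain ⟨j, n, hj⟩ := (h.deriv_eq_zero_iff ⟨hc, hp⟩).1 h0
    have hG1 : deriv (deriv (f t)) c = iteratedDeriv 2 (f t) (z j t) := by
      rw [hj, ← h.iteratedDeriv_add_int _ n, iteratedDeriv_succ, iteratedDeriv_one]
    have hF0 : deriv (fun s => f s c) t = deriv (A j) t := by
      rw [← hf.deriv_param_endpoint ht j, hj]
      simpa using (hf.periodic_deriv_param ht).int_mul n (z j t)
    have h1 := isBigO_div_sub_residue hFan hGan h0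
      (by rw [hG1]; exact h.iteratedDeriv_endpoint_ne_zero j)
    have h2 : deriv (fun s => f s c) t / deriv (deriv (f t)) c = ((slitGamma A z f j t).re : ℂ) := by
      rw [hf.ofReal_re_slitGamma ht, hG1, hF0]; rfl
    simp only [h2] at h1
    -- Modulo 1 the endpoints are distinct, so only the j-th cotangent is singular at c.
    have h3 : ∀ k, (fun w => Real.pi * Complex.cot (Real.pi * (w - z k t)) -
        if k = j then (w - c)⁻¹ else 0) =O[𝓝[≠] c] fun _ => (1 : ℝ) := by
      intro k
      by_cases hkj : k = j
      · subst hkj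
        simpa using isBigO_cot_pi_sub_inv (a := z k t) (c := c) ⟨n, hj⟩
      · have : c ∉ intTranslates (z k t) := by
          rintro ⟨l, hl⟩
          refine hkj (h.eq_of_endpoint_add_int (n := n - l) ?_)
          push_cast
          linear_combination hj - hl
        simpa [hkj] using isBigO_cot_pi this
    have h4 := h1.sub (Asymptotics.IsBigO.fun_sum (s := Finset.univ) fun k _ =>
      (h3 k).const_mul_left ((slitGamma A z f k t).re : ℂ))
    refine h4.congr_left fun w => ?_
    simp only [mul_sub, Finset.sum_sub_distrib, mul_ite, mul_zero, Finset.sum_ite_eq',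
      Finset.mem_univ, if_true]
    ring
  · refine hregular (fun k hk => h0 ((h.deriv_eq_zero_iff ⟨hc, hp⟩).2 ⟨k, hk⟩)) ?_
    exact ((hFan.div hGan h0).continuousAt.tendsto.mono_left nhdsWithin_le_nhds).isBigO_one ℝ

theorem deriv_width (hf : IsSmoothSlitFamily I m A p z f) (ht : t ∈ I) :
    ((deriv m t : ℝ) : ℂ) = Real.pi * ∑ k, slitGamma A z f k t := by
  have h := hf.isSlitMap t ht
  have hz : ∀ k, (z k t).im = 0 ∨ (z k t).im = -m t := by
    intro k
    fin_cases k
    · exact Or.inl h.im_one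
    · exact Or.inl h.im_two
    · exact Or.inr h.im_three
    · exact Or.inr h.im_four
  have key := im_eq_pi_mul_sum_residues h.width_pos (hf.periodic_variation ht) hz
    (fun c hc => hf.eventually_differentiableAt_variation ht hc)
    (fun c hc => hf.isBigO_variation_sub_cot ht hc)
    (fun c _ => .of_forall fun w hw => hf.im_variation_upper_side ht hw)
    (fun c hc => (h.eventually_deriv_ne_zero (h.mem_of_im_eq_neg hc)).mono fun w hd hw =>
      hf.im_variation_lower_side ht hw hd)
  rw [key]
  push_cast
  simp only [hf.ofReal_re_slitGamma ht]

end IsSmoothSlitFamily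

/-! ### Uniqueness of the module: conformal maps of a strip modulo 1 onto an annulus -/

/-- `φ` is a conformal map of the strip `-m < Im z < 0` modulo the period `1` onto the annulus
`q < |ζ| < 1`. -/
structure IsAnnulusParam (m q : ℝ) (φ : ℂ → ℂ) : Prop where
  width_pos : 0 < m
  pos : 0 < q
  lt_one : q < 1
  differentiableOn : DifferentiableOn ℂ φ (strip m)
  mapsTo : MapsTo φ (strip m) (annulus q)
  periodic : Function.Periodic φ 1
  injective : ∀ u ∈ strip m, ∀ v ∈ strip m, φ u = φ v → ∃ n : ℤ, v = u + n
  surjOn : SurjOn φ (strip m) (annulus q)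

theorem convex_strip (m : ℝ) : Convex ℝ (strip m) :=
  (convex_Ioo (-m) 0).linear_preimage Complex.imLm

/-- A maximum principle without boundary values: Phragmén–Lindelöf is applied on a slightly thinner
strip, where periodicity of the modulus makes the function bounded. -/
theorem norm_le_one_of_boundary {m : ℝ} {χ : ℂ → ℂ} (hd : DifferentiableOn ℂ χ (strip m))
    (hper : ∀ z, ‖χ (z + 1)‖ = ‖χ z‖)
    (hb : ∀ η > 0, ∃ δ > 0, ∀ z ∈ strip m, (-δ < z.im ∨ z.im < -m + δ) → ‖χ z‖ ≤ 1 + η) :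
    ∀ z ∈ strip m, ‖χ z‖ ≤ 1 := by
  intro z hz
  refine le_of_forall_pos_le_add fun η hη => ?_
  obtain ⟨δ, hδ, hbδ⟩ := hb η hη
  obtain ⟨ε, hε, hεδ, hε1, hε2⟩ : ∃ ε > 0, ε < δ ∧ -m + ε < z.im ∧ z.im < -ε := by
    have h1 := hz.1
    have h2 := hz.2
    refine ⟨min (δ / 2) (min ((z.im + m) / 2) (-z.im / 2)), ?_, ?_, ?_, ?_⟩
    · refine lt_min (by linarith) (lt_min (by linarith) (by linarith))
    · exact (min_le_left _ _).trans_lt (by linarith)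
    · have := (min_le_right (δ / 2) (min ((z.im + m) / 2) (-z.im / 2))).trans (min_le_left _ _)
      linarith
    · have := (min_le_right (δ / 2) (min ((z.im + m) / 2) (-z.im / 2))).trans (min_le_right _ _)
      linarith
  have hsub : ∀ w : ℂ, w.im ∈ Icc (-m + ε) (-ε) → w ∈ strip m := fun w hw =>
    ⟨by linarith [hw.1], by linarith [hw.2]⟩
  have hcl : closure (Complex.im ⁻¹' Ioo (-m + ε) (-ε)) ⊆ strip m := by
    rw [Complex.closure_preimage_im]
    intro w hw
    exact hsub w (closure_minimal Ioo_subset_Icc_self isClosed_Icc hw)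
  obtain ⟨C, hC⟩ : ∃ C, ∀ w : ℂ, w.im ∈ Icc (-m + ε) (-ε) → ‖χ w‖ ≤ C := by
    have hK : IsCompact (Icc (0 : ℝ) 1 ×ℂ Icc (-m + ε) (-ε)) := isCompact_Icc.reProdIm isCompact_Icc
    obtain ⟨C, hC⟩ := hK.exists_bound_of_continuousOn
      (hd.continuousOn.mono fun w hw => hsub w hw.2)
    refine ⟨C, fun w hw => ?_⟩
    have hper' : Function.Periodic (fun z => ‖χ z‖) 1 := hper
    have h1 := hper'.sub_int_mul_eq ⌊w.re⌋ (x := w)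
    simp only [mul_one] at h1
    rw [← h1]
    refine hC _ ⟨?_, by simpa using hw⟩
    simp only [mem_preimage, Complex.sub_re, Complex.intCast_re]
    exact ⟨Int.fract_nonneg w.re, (Int.fract_lt_one w.re).le⟩
  refine PhragmenLindelof.horizontal_strip (a := -m + ε) (b := -ε) ?_ ?_ ?_ ?_ hε1.le hε2.le
  · exact (hd.mono hcl).diffContOnCl
  · refine ⟨0, div_pos Real.pi_pos (by linarith), 0, ?_⟩
    refine Asymptotics.IsBigO.of_bound C (eventually_inf_principal.2 (.of_forall fun w hw => ?_))
    simpa using hC w (Ioo_subset_Icc_self hw)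
  · intro w hw
    exact hbδ w (hsub w ⟨hw.ge, by linarith⟩) (Or.inr (by linarith))
  · intro w hw
    exact hbδ w (hsub w ⟨by linarith, hw.le⟩) (Or.inl (by linarith))

namespace IsAnnulusParam

variable {m q : ℝ} {φ : ℂ → ℂ}

theorem flip (h : IsAnnulusParam m q φ) : IsAnnulusParam m q fun w => φ (-w - m * Complex.I) := by
  have hstrip : ∀ w, -w - m * Complex.I ∈ strip m ↔ w ∈ strip m := by
    intro w
    simp only [strip, mem_ofPred_eq, Complex.sub_im, Complex.neg_im, Complex.mul_im,
      Complex.ofReal_re, Complex.ofReal_im, Complex.I_im, Complex.I_re]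
    constructor <;> rintro ⟨h1, h2⟩ <;> constructor <;> linarith
  have hinv : ∀ w : ℂ, -(-w - m * Complex.I) - m * Complex.I = w := fun w => by ring
  refine ⟨h.width_pos, h.pos, h.lt_one, ?_, fun w hw => h.mapsTo ((hstrip w).2 hw), ?_, ?_, ?_⟩
  · exact h.differentiableOn.fun_comp (f := fun w => -w - m * Complex.I) (by fun_prop)
      fun w hw => (hstrip w).2 hw
  · intro w
    have := h.periodic (-(w + 1) - m * Complex.I)
    simp only
    rw [← this]
    congr 1
    ring
  · intro u hu v hv huv
    obtain ⟨n, hn⟩ := h.injective _ ((hstrip u).2 hu) _ ((hstrip v).2 hv) huv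
    exact ⟨-n, by push_cast; linear_combination -hn⟩
  · intro ζ hζ
    obtain ⟨w, hw, rfl⟩ := h.surjOn hζ
    exact ⟨-w - m * Complex.I, (hstrip w).2 hw, by simp only [hinv]⟩

theorem image_mem_nhds (h : IsAnnulusParam m q φ) {w : ℂ} (hw : w ∈ strip m) {U : Set ℂ}
    (hU : U ∈ 𝓝 w) : φ '' U ∈ 𝓝 (φ w) := by
  have han : AnalyticAt ℂ φ w := h.differentiableOn.analyticAt ((isOpen_strip m).mem_nhds hw)
  have hinj : InjOn φ (Metric.ball w (1 / 2) ∩ strip m) := by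
    rintro u ⟨hu, hu'⟩ v ⟨hv, hv'⟩ huv
    obtain ⟨n, hn⟩ := h.injective u hu' v hv' huv
    have h1 : dist u v < 1 := by
      have := dist_triangle_right u v w
      rw [Metric.mem_ball] at hu hv
      linarith
    rw [hn, dist_self_add_right, Complex.norm_intCast] at h1
    have h2 : n = 0 := Int.abs_lt_one_iff.1 (by exact_mod_cast h1)
    rw [hn, h2]; simp
  have hd := han.deriv_ne_zero_of_injOn
    (inter_mem (Metric.ball_mem_nhds w (by norm_num)) ((isOpen_strip m).mem_nhds hw)) hinj
  rw [← han.hasStrictDerivAt.map_nhds_eq hd]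
  exact image_mem_map hU

/-- The preimage of a compact subset of the annulus stays away from the sides of the strip. -/
theorem exists_margin (h : IsAnnulusParam m q φ) {K : Set ℂ} (hK : IsCompact K)
    (hKq : K ⊆ annulus q) : ∃ δ > 0, ∀ z ∈ strip m, φ z ∈ K → -m + δ ≤ z.im ∧ z.im ≤ -δ := by
  refine hK.induction_on
    (p := fun S => ∃ δ > 0, ∀ z ∈ strip m, φ z ∈ S → -m + δ ≤ z.im ∧ z.im ≤ -δ) ⟨1, one_pos, by simp⟩
    ?_ ?_ ?_
  · rintro S T hST ⟨δ, hδ, hT⟩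
    exact ⟨δ, hδ, fun z hz hzS => hT z hz (hST hzS)⟩
  · rintro S T ⟨δ, hδ, hS⟩ ⟨δ', hδ', hT⟩
    refine ⟨min δ δ', lt_min hδ hδ', fun z hz hzST => ?_⟩
    have h1 := min_le_left δ δ'
    have h2 := min_le_right δ δ'
    rcases hzST with hzS | hzT
    · obtain ⟨h3, h4⟩ := hS z hz hzS
      exact ⟨by linarith, by linarith⟩
    · obtain ⟨h3, h4⟩ := hT z hz hzT
      exact ⟨by linarith, by linarith⟩
  · intro ζ hζ
    obtain ⟨w, hw, rfl⟩ := h.surjOn (hKq hζ)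
    obtain ⟨hw1, hw2⟩ := hw
    set U : Set ℂ := Complex.im ⁻¹' Ioo ((-m + w.im) / 2) (w.im / 2) with hU
    have hUn : U ∈ 𝓝 w := (isOpen_Ioo.preimage Complex.continuous_im).mem_nhds
      ⟨by linarith, by linarith⟩
    have hUs : U ⊆ strip m := fun u hu => ⟨by linarith [hu.1], by linarith [hu.2]⟩
    refine ⟨φ '' U, mem_nhdsWithin_of_mem_nhds (h.image_mem_nhds ⟨hw1, hw2⟩ hUn),
      min ((m + w.im) / 2) (-w.im / 2), lt_min (by linarith) (by linarith), ?_⟩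
    rintro z hz ⟨u, hu, huz⟩
    obtain ⟨n, hn⟩ := h.injective u (hUs hu) z hz huz
    have him : z.im = u.im := by simp [hn]
    have h1 := min_le_left ((m + w.im) / 2) (-w.im / 2)
    have h2 := min_le_right ((m + w.im) / 2) (-w.im / 2)
    rw [him]
    exact ⟨by linarith [hu.1], by linarith [hu.2]⟩

theorem isCompact_closedAnnulus (a b : ℝ) : IsCompact {ζ : ℂ | a ≤ ‖ζ‖ ∧ ‖ζ‖ ≤ b} := by
  refine (isCompact_closedBall (0 : ℂ) b).of_isClosed_subset ?_ fun ζ hζ => by simpa using hζ.2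
  exact (isClosed_le continuous_const continuous_norm).inter
    (isClosed_le continuous_norm continuous_const)

/-- The map is bounded away from the boundary of the annulus on compact substrips. -/
theorem exists_norm_bounds (h : IsAnnulusParam m q φ) {a b : ℝ} (ha : -m < a) (hb : b < 0) :
    ∃ κ₁ κ₂ : ℝ, q < κ₁ ∧ κ₂ < 1 ∧ ∀ z : ℂ, a ≤ z.im → z.im ≤ b → κ₁ ≤ ‖φ z‖ ∧ ‖φ z‖ ≤ κ₂ := by
  by_cases hab : a ≤ b
  swap
  · exact ⟨(q + 1) / 2, (q + 1) / 2, by linarith [h.lt_one], by linarith [h.lt_one],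
      fun z h1 h2 => absurd (h1.trans h2) hab⟩
  have hK : IsCompact (Icc (0 : ℝ) 1 ×ℂ Icc a b) := isCompact_Icc.reProdIm isCompact_Icc
  have hsub : (Icc (0 : ℝ) 1 ×ℂ Icc a b) ⊆ strip m := fun w hw =>
    ⟨by linarith [hw.2.1], by linarith [hw.2.2]⟩
  have hne : (Icc (0 : ℝ) 1 ×ℂ Icc a b).Nonempty :=
    ⟨⟨0, a⟩, by simp [Complex.mem_reProdIm, hab]⟩
  have hc : ContinuousOn (fun z => ‖φ z‖) (Icc (0 : ℝ) 1 ×ℂ Icc a b) :=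
    (h.differentiableOn.continuousOn.mono hsub).norm
  obtain ⟨u, hu, humin⟩ := hK.exists_isMinOn hne hc
  obtain ⟨v, hv, hvmax⟩ := hK.exists_isMaxOn hne hc
  refine ⟨‖φ u‖, ‖φ v‖, (h.mapsTo (hsub hu)).1, (h.mapsTo (hsub hv)).2, fun z h1 h2 => ?_⟩
  have h3 := h.periodic.sub_int_mul_eq ⌊z.re⌋ (x := z)
  simp only [mul_one] at h3
  have h4 : z - ⌊z.re⌋ ∈ Icc (0 : ℝ) 1 ×ℂ Icc a b := by
    refine ⟨?_, by simpa using ⟨h1, h2⟩⟩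
    simp only [mem_preimage, Complex.sub_re, Complex.intCast_re]
    exact ⟨Int.fract_nonneg z.re, (Int.fract_lt_one z.re).le⟩
  rw [← h3]
  exact ⟨humin h4, hvmax h4⟩

/-- The upper side of the strip corresponds to one of the two boundary circles. -/
theorem upper_side_alternative (h : IsAnnulusParam m q φ) :
    (∀ ε > 0, ∃ δ > 0, ∀ z ∈ strip m, -δ < z.im → 1 - ε < ‖φ z‖) ∨
      ∀ ε > 0, ∃ δ > 0, ∀ z ∈ strip m, -δ < z.im → ‖φ z‖ < q + ε := by
  have hq := h.lt_one
  have hmargin : ∀ ε > 0, ∃ δ > 0, ∀ z ∈ strip m, -δ < z.im → ‖φ z‖ < q + ε ∨ 1 - ε < ‖φ z‖ := by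
    intro ε hε
    obtain ⟨δ, hδ, hδ'⟩ := h.exists_margin (isCompact_closedAnnulus (q + ε) (1 - ε))
      fun ζ hζ => ⟨by linarith [hζ.1], by linarith [hζ.2]⟩
    refine ⟨δ, hδ, fun z hz hzδ => ?_⟩
    by_contra! hcon
    linarith [(hδ' z hz hcon).2]
  obtain ⟨δ₀, hδ₀, hsep⟩ := hmargin ((1 - q) / 4) (by linarith)
  set T : Set ℂ := strip m ∩ {z | -δ₀ < z.im} with hT
  have hTpre : IsPreconnected ((fun z => ‖φ z‖) '' T) := by
    have h1 : Convex ℝ T := (convex_strip m).inter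
      ((convex_Ioi (-δ₀)).linear_preimage Complex.imLm)
    exact h1.isPreconnected.image _ (h.differentiableOn.continuousOn.mono inter_subset_left).norm
  have hord := hTpre.ordConnected
  -- Near the upper side the modulus avoids the middle radius; the substrip being connected, it must
  -- stay on one side of it.
  have hmid : (q + 1) / 2 ∉ (fun z => ‖φ z‖) '' T := by
    rintro ⟨z, hz, hz'⟩
    simp only at hz'
    rcases hsep z hz.1 hz.2 with h1 | h1 <;> linarith
  have hdich : (∀ z ∈ T, (q + 1) / 2 < ‖φ z‖) ∨ ∀ z ∈ T, ‖φ z‖ < (q + 1) / 2 := by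
    by_contra! hcon
    obtain ⟨⟨u, hu, hu'⟩, v, hv, hv'⟩ := hcon
    exact hmid (hord.out (mem_image_of_mem _ hu) (mem_image_of_mem _ hv) ⟨hu', hv'⟩)
  rcases hdich with hd | hd
  · left
    intro ε hε
    obtain ⟨δ, hδ, hδ'⟩ := hmargin (min ε ((1 - q) / 4)) (lt_min hε (by linarith))
    refine ⟨min δ δ₀, lt_min hδ hδ₀, fun z hz hzδ => ?_⟩
    have e1 := min_le_left δ δ₀
    have e2 := min_le_right δ δ₀
    have e3 := min_le_left ε ((1 - q) / 4)
    have e4 := min_le_right ε ((1 - q) / 4)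
    have e5 := hd z ⟨hz, show -δ₀ < z.im by linarith⟩
    rcases hδ' z hz (by linarith) with h1 | h1 <;> linarith
  · right
    intro ε hε
    obtain ⟨δ, hδ, hδ'⟩ := hmargin (min ε ((1 - q) / 4)) (lt_min hε (by linarith))
    refine ⟨min δ δ₀, lt_min hδ hδ₀, fun z hz hzδ => ?_⟩
    have e1 := min_le_left δ δ₀
    have e2 := min_le_right δ δ₀
    have e3 := min_le_left ε ((1 - q) / 4)
    have e4 := min_le_right ε ((1 - q) / 4)
    have e5 := hd z ⟨hz, show -δ₀ < z.im by linarith⟩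
    rcases hδ' z hz (by linarith) with h1 | h1 <;> linarith

/-- For β = log(1/q)/m the modulus of φ(z)·exp(iβz) tends to 1 at both sides. The maximum principle
for this function and its reciprocal makes it constant. So φ is an exponential, and its period 1 and
injectivity modulo 1 force β = 2π. -/
theorem width_eq_of_sides (h : IsAnnulusParam m q φ)
    (htop : ∀ ε > 0, ∃ δ > 0, ∀ z ∈ strip m, -δ < z.im → 1 - ε < ‖φ z‖)
    (hbot : ∀ ε > 0, ∃ δ > 0, ∀ z ∈ strip m, z.im < -m + δ → ‖φ z‖ < q + ε) :
    m = Real.log q⁻¹ / (2 * Real.pi) := by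
  have hm := h.width_pos
  have hq0 := h.pos
  have hq1 := h.lt_one
  set β : ℝ := Real.log q⁻¹ / m with hβ
  have hlog : 0 < Real.log q⁻¹ := Real.log_pos (one_lt_inv_iff₀.2 ⟨hq0, hq1⟩)
  have hβ0 : 0 < β := div_pos hlog hm
  have hβm : Real.exp (β * m) = q⁻¹ := by
    rw [hβ, div_mul_cancel₀ _ hm.ne', Real.exp_log (inv_pos.2 hq0)]
  set ψ : ℂ → ℂ := fun z => φ z * Complex.exp (β * z * Complex.I) with hψ
  have hexp : ∀ z : ℂ, ‖Complex.exp (β * z * Complex.I)‖ = Real.exp (-(β * z.im)) := fun z => by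
    rw [Complex.norm_exp]; simp
  have hnorm : ∀ z, ‖ψ z‖ = ‖φ z‖ * Real.exp (-(β * z.im)) := fun z => by
    rw [hψ, norm_mul, hexp]
  have hφ0 : ∀ z ∈ strip m, φ z ≠ 0 := fun z hz h0 => by
    have := (h.mapsTo hz).1
    rw [h0, norm_zero] at this
    linarith
  have hψ0 : ∀ z ∈ strip m, ψ z ≠ 0 := fun z hz => mul_ne_zero (hφ0 z hz) (Complex.exp_ne_zero _)
  have hψd : DifferentiableOn ℂ ψ (strip m) := h.differentiableOn.fun_mul (by fun_prop)
  have hψper : ∀ z, ‖ψ (z + 1)‖ = ‖ψ z‖ := fun z => by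
    rw [hnorm, hnorm, h.periodic z]; simp
  have hsmall : ∀ η > 0, ∃ δ > 0, Real.exp (β * δ) ≤ 1 + η := by
    intro η hη
    refine ⟨Real.log (1 + η) / β, div_pos (Real.log_pos (by linarith)) hβ0, ?_⟩
    rw [mul_div_cancel₀ _ hβ0.ne', Real.exp_log (by linarith)]
  have hle : ∀ z ∈ strip m, ‖ψ z‖ ≤ 1 := by
    refine norm_le_one_of_boundary hψd hψper fun η hη => ?_
    obtain ⟨δ₁, hδ₁, h1⟩ := hsmall η hη
    obtain ⟨δ₂, hδ₂, h2⟩ := hbot (q * η) (by positivity)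
    refine ⟨min δ₁ δ₂, lt_min hδ₁ hδ₂, fun z hz hzb => ?_⟩
    have e1 := min_le_left δ₁ δ₂
    have e2 := min_le_right δ₁ δ₂
    rw [hnorm]
    rcases hzb with hzb | hzb
    · have e3 : Real.exp (-(β * z.im)) ≤ 1 + η :=
        (Real.exp_le_exp.2 (by nlinarith)).trans h1
      calc ‖φ z‖ * Real.exp (-(β * z.im)) ≤ 1 * (1 + η) :=
            mul_le_mul (h.mapsTo hz).2.le e3 (Real.exp_pos _).le zero_le_one
        _ = 1 + η := one_mul _
    · have e3 : Real.exp (-(β * z.im)) ≤ q⁻¹ := by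
        rw [← hβm]
        exact Real.exp_le_exp.2 (by nlinarith [hz.1])
      calc ‖φ z‖ * Real.exp (-(β * z.im)) ≤ (q + q * η) * q⁻¹ :=
            mul_le_mul (h2 z hz (by linarith)).le e3 (Real.exp_pos _).le (by positivity)
        _ = 1 + η := by field_simp
  have hge : ∀ z ∈ strip m, ‖(ψ z)⁻¹‖ ≤ 1 := by
    refine norm_le_one_of_boundary (χ := fun z => (ψ z)⁻¹) (hψd.fun_inv hψ0)
      (fun z => by simp only [norm_inv, hψper z]) fun η hη => ?_
    obtain ⟨δ₁, hδ₁, h1⟩ := htop (1 - (1 + η)⁻¹)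
      (sub_pos.2 (inv_lt_one_iff₀.2 (Or.inr (by linarith))))
    obtain ⟨δ₂, hδ₂, h2⟩ := hsmall η hη
    refine ⟨min δ₁ δ₂, lt_min hδ₁ hδ₂, fun z hz hzb => ?_⟩
    have e1 := min_le_left δ₁ δ₂
    have e2 := min_le_right δ₁ δ₂
    have hηpos : 0 < 1 + η := by linarith
    rw [norm_inv, hnorm]
    refine inv_le_of_inv_le₀ hηpos ?_
    rcases hzb with hzb | hzb
    · have e3 : 1 ≤ Real.exp (-(β * z.im)) := Real.one_le_exp (by nlinarith [hz.2])
      have e4 := h1 z hz (by linarith)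
      rw [sub_sub_cancel] at e4
      calc (1 + η)⁻¹ = (1 + η)⁻¹ * 1 := (mul_one _).symm
        _ ≤ ‖φ z‖ * Real.exp (-(β * z.im)) :=
          mul_le_mul e4.le e3 zero_le_one (norm_nonneg _)
    · have e3 : q⁻¹ * (1 + η)⁻¹ ≤ Real.exp (-(β * z.im)) := by
        have : Real.exp (β * m) * (Real.exp (β * δ₂))⁻¹ ≤ Real.exp (-(β * z.im)) := by
          rw [← Real.exp_neg, ← Real.exp_add]
          exact Real.exp_le_exp.2 (by nlinarith)
        refine le_trans ?_ this
        rw [hβm]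
        gcongr
      calc (1 + η)⁻¹ = q * (q⁻¹ * (1 + η)⁻¹) := by field_simp
        _ ≤ ‖φ z‖ * Real.exp (-(β * z.im)) :=
          mul_le_mul (h.mapsTo hz).1.le e3 (by positivity) (norm_nonneg _)
  have hone : ∀ z ∈ strip m, ‖ψ z‖ = 1 := fun z hz => by
    refine le_antisymm (hle z hz) ?_
    have h1 := hge z hz
    rw [norm_inv] at h1
    exact (inv_le_one₀ (norm_pos_iff.2 (hψ0 z hz))).1 h1
  -- A point of the midline; comparing values at its real translates suffices.
  set z₀ : ℂ := -(m / 2 : ℝ) * Complex.I with hz₀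
  have hshift : ∀ x : ℝ, z₀ + x ∈ strip m := fun x => by
    constructor <;> simp [hz₀] <;> linarith
  have hz₀s : z₀ ∈ strip m := by simpa using hshift 0
  have hconst : ∀ x : ℝ, ψ (z₀ + x) = ψ z₀ := fun x =>
    Complex.eqOn_of_isPreconnected_of_isMaxOn_norm (convex_strip m).isPreconnected (isOpen_strip m)
      hψd hz₀s (fun z hz => by simp [hone z hz, hone z₀ hz₀s]) (hshift x)
  have hφx : ∀ x : ℝ, φ (z₀ + x) * Complex.exp (β * x * Complex.I) = φ z₀ := by
    intro x
    have h1 := hconst x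
    simp only [hψ] at h1
    rw [mul_add, add_mul, Complex.exp_add, mul_left_comm, mul_comm (φ z₀)] at h1
    exact mul_left_cancel₀ (Complex.exp_ne_zero _) h1
  have h1 := hφx 1
  rw [Complex.ofReal_one, h.periodic z₀, mul_one] at h1
  have h2 : Complex.exp (β * Complex.I) = 1 :=
    mul_left_cancel₀ (hφ0 z₀ hz₀s) (h1.trans (mul_one _).symm)
  obtain ⟨k, hk⟩ := Complex.exp_eq_one_iff.1 h2
  have hk' : β = k * (2 * Real.pi) := by
    have h3 : (β : ℂ) * Complex.I = (k * (2 * Real.pi) : ℂ) * Complex.I := by rw [hk]; ring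
    exact_mod_cast mul_right_cancel₀ Complex.I_ne_zero h3
  have hkpos : (0 : ℝ) < k := by
    by_contra! hcon
    have := Real.pi_pos
    nlinarith
  -- With β = 2πk, the points z₀ and z₀ + 1/k have the same image, so 1/k is an integer.
  have h4 := hφx (k : ℝ)⁻¹
  have h5 : (β : ℂ) * ((k : ℝ)⁻¹ : ℝ) * Complex.I = 2 * Real.pi * Complex.I := by
    rw [← Complex.ofReal_mul, hk']
    have : (k : ℝ) * (2 * Real.pi) * (k : ℝ)⁻¹ = 2 * Real.pi := by field_simp
    rw [this]; push_cast; ring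
  rw [h5, Complex.exp_two_pi_mul_I, mul_one] at h4
  obtain ⟨n, hn⟩ := h.injective z₀ hz₀s _ (hshift (k : ℝ)⁻¹) h4.symm
  have h6 : ((k : ℝ)⁻¹ : ℝ) = n := by exact_mod_cast add_left_cancel hn
  have h7 : (n * k : ℤ) = 1 := by
    have : (n : ℝ) * k = 1 := by rw [← h6, inv_mul_cancel₀ hkpos.ne']
    exact_mod_cast this
  have h8 : k = 1 := by
    have hk0 : 0 < k := by exact_mod_cast hkpos
    exact Int.eq_one_of_dvd_one hk0.le ⟨n, by linarith⟩
  rw [h8, Int.cast_one, one_mul] at hk'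
  rw [← hk', hβ, div_div_cancel₀ hlog.ne']

/-- The conformal module is a conformal invariant. -/
theorem width_eq (h : IsAnnulusParam m q φ) : m = Real.log q⁻¹ / (2 * Real.pi) := by
  have hq := h.lt_one
  have hflip : ∀ (P : ℝ → ℝ → Prop), (∀ ε > 0, ∃ δ > 0, ∀ z ∈ strip m, -δ < z.im →
      P ε ‖φ (-z - m * Complex.I)‖) → ∀ ε > 0, ∃ δ > 0, ∀ z ∈ strip m, z.im < -m + δ → P ε ‖φ z‖ := by
    intro P hP ε hε
    obtain ⟨δ, hδ, hδ'⟩ := hP ε hε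
    refine ⟨δ, hδ, fun z hz hzδ => ?_⟩
    have h1 := hδ' (-z - m * Complex.I) ⟨by simp; linarith [hz.2], by simp; linarith [hz.1]⟩
      (by simp; linarith)
    have h2 : -(-z - m * Complex.I) - m * Complex.I = z := by ring
    rwa [h2] at h1
  have hflip' : ∀ (P : ℝ → ℝ → Prop), (∀ ε > 0, ∃ δ > 0, ∀ z ∈ strip m, -δ < z.im → P ε ‖φ z‖) →
      ∀ ε > 0, ∃ δ > 0, ∀ z ∈ strip m, z.im < -m + δ → P ε ‖φ (-z - m * Complex.I)‖ := by
    intro P hP ε hε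
    obtain ⟨δ, hδ, hδ'⟩ := hP ε hε
    exact ⟨δ, hδ, fun z hz hzδ => hδ' (-z - m * Complex.I)
      ⟨by simp; linarith [hz.2], by simp; linarith [hz.1]⟩ (by simp; linarith)⟩
  rcases h.upper_side_alternative with ht | ht <;> rcases h.flip.upper_side_alternative with hb | hb
  -- Were both sides sent to the outer circle, |φ| would be at least κ > q on the whole strip, and
  -- the circle of radius (q + κ)/2 would be missed.
  · exfalso
    obtain ⟨δ₁, hδ₁, h1⟩ := ht ((1 - q) / 2) (by linarith)
    obtain ⟨δ₂, hδ₂, h2⟩ := hflip (fun ε x => 1 - ε < x) hb ((1 - q) / 2) (by linarith)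
    obtain ⟨κ₁, κ₂, hκ₁, -, h3⟩ := h.exists_norm_bounds (a := -m + δ₂) (b := -δ₁) (by linarith)
      (by linarith)
    have hall : ∀ z ∈ strip m, min κ₁ ((1 + q) / 2) ≤ ‖φ z‖ := by
      intro z hz
      by_cases c1 : -δ₁ < z.im
      · exact (min_le_right _ _).trans (by linarith [h1 z hz c1])
      · by_cases c2 : z.im < -m + δ₂
        · exact (min_le_right _ _).trans (by linarith [h2 z hz c2])
        · exact (min_le_left _ _).trans (h3 z (not_lt.1 c2) (not_lt.1 c1)).1
    set κ := min κ₁ ((1 + q) / 2) with hκ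
    have hκq : q < κ := lt_min hκ₁ (by linarith)
    have hκ1 : κ < 1 := (min_le_right _ _).trans_lt (by linarith)
    have hn : ‖(((q + κ) / 2 : ℝ) : ℂ)‖ = (q + κ) / 2 := by
      rw [Complex.norm_real, Real.norm_of_nonneg (by linarith [h.pos])]
    obtain ⟨z, hz, hz'⟩ := h.surjOn (a := (((q + κ) / 2 : ℝ) : ℂ))
      ⟨by rw [hn]; linarith, by rw [hn]; linarith⟩
    have := hall z hz
    rw [hz', hn] at this
    linarith
  · exact h.width_eq_of_sides ht (hflip (fun ε x => x < q + ε) hb)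
  · exact h.flip.width_eq_of_sides hb (hflip' (fun ε x => x < q + ε) ht)
  -- Symmetrically, if both sides go to the inner circle, the radius (1 + κ)/2 is missed.
  · exfalso
    obtain ⟨δ₁, hδ₁, h1⟩ := ht ((1 - q) / 2) (by linarith)
    obtain ⟨δ₂, hδ₂, h2⟩ := hflip (fun ε x => x < q + ε) hb ((1 - q) / 2) (by linarith)
    obtain ⟨κ₁, κ₂, -, hκ₂, h3⟩ := h.exists_norm_bounds (a := -m + δ₂) (b := -δ₁) (by linarith)
      (by linarith)
    have hall : ∀ z ∈ strip m, ‖φ z‖ ≤ max κ₂ ((1 + q) / 2) := by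
      intro z hz
      by_cases c1 : -δ₁ < z.im
      · exact le_trans (by linarith [h1 z hz c1]) (le_max_right _ _)
      · by_cases c2 : z.im < -m + δ₂
        · exact le_trans (by linarith [h2 z hz c2]) (le_max_right _ _)
        · exact (h3 z (not_lt.1 c2) (not_lt.1 c1)).2.trans (le_max_left _ _)
    set κ := max κ₂ ((1 + q) / 2) with hκ
    have hκ1 : κ < 1 := max_lt hκ₂ (by linarith)
    have hκq : q < κ := lt_of_lt_of_le (by linarith) (le_max_right _ _)
    have hn : ‖(((1 + κ) / 2 : ℝ) : ℂ)‖ = (1 + κ) / 2 := by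
      rw [Complex.norm_real, Real.norm_of_nonneg (by linarith [h.pos])]
    obtain ⟨z, hz, hz'⟩ := h.surjOn (a := (((1 + κ) / 2 : ℝ) : ℂ))
      ⟨by rw [hn]; linarith, by rw [hn]; linarith⟩
    have := hall z hz
    rw [hz', hn] at this
    linarith

end IsAnnulusParam

/-! ### The strip width is the conformal module -/

theorem isOpen_annulus (q : ℝ) : IsOpen (annulus q) :=
  (isOpen_lt continuous_const continuous_norm).inter (isOpen_lt continuous_norm continuous_const)

namespace IsSlitMap

variable {m : ℝ} {A : Fin 4 → ℂ} {p : ℂ} {z : Fin 4 → ℂ} {f : ℂ → ℂ}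

/-- Composition with an inversion centred at a point of a slit makes the map finite. -/
theorem exists_finite_param (h : IsSlitMap m A p z f) {w₀ : ℂ} (hw₀ : w₀ ∈ slits A) :
    ∃ F : ℂ → ℂ, DifferentiableOn ℂ F (strip m) ∧ Function.Periodic F 1 ∧
      (∀ u ∈ strip m, ∀ v ∈ strip m, F u = F v → ∃ n : ℤ, v = u + n) ∧
      F '' strip m = insert 0 ((fun w => (w - w₀)⁻¹) '' (slits A)ᶜ) := by
  classical
  set F : ℂ → ℂ := fun w => if w ∈ intTranslates p then 0 else (f w - w₀)⁻¹ with hF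
  have hF0 : ∀ w ∈ intTranslates p, F w = 0 := fun w hw => if_pos hw
  have hF1 : ∀ w, w ∉ intTranslates p → F w = (f w - w₀)⁻¹ := fun w hw => if_neg hw
  have hmap : ∀ w ∈ strip m \ intTranslates p, f w ∈ (slits A)ᶜ := fun w hw => by
    rw [← h.image]; exact mem_image_of_mem f hw
  have hne : ∀ w ∈ strip m \ intTranslates p, f w - w₀ ≠ 0 := fun w hw h0 =>
    hmap w hw (by rw [sub_eq_zero.1 h0]; exact hw₀)
  have hper : Function.Periodic F 1 := by
    intro w
    have h1 : w + 1 ∈ intTranslates p ↔ w ∈ intTranslates p := by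
      simpa using add_int_mem_intTranslates_iff (p := p) (z := w) 1
    simp only [hF, h1, h.periodic w]
  have hpole : AnalyticAt ℂ F p := by
    refine analyticAt_of_eventuallyEq_inv_sub (w₀ := w₀) (hF0 p (mem_intTranslates_self p)) ?_ ?_ h.pole
    · filter_upwards [h.eventually_mem_strip_diff] with w hw
      exact hF1 w hw.2
    · filter_upwards [h.eventually_mem_strip_diff] with w hw
      exact (h.analyticAt hw).differentiableAt
  refine ⟨F, ?_, hper, ?_, ?_⟩
  · intro w hw
    refine DifferentiableAt.differentiableWithinAt ?_
    by_cases hwp : w ∈ intTranslates p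
    · obtain ⟨n, rfl⟩ := hwp
      have h1 : F = fun w => F (w - n) := by
        funext v
        simpa using (hper.sub_int_mul_eq n (x := v)).symm
      rw [h1]
      have h2 : DifferentiableAt ℂ F (p + n - n) := by
        rw [add_sub_cancel_right]; exact hpole.differentiableAt
      exact DifferentiableAt.fun_comp' (f := fun w => w - (n : ℂ)) (p + n) h2 (by fun_prop)
    · have h1 : DifferentiableAt ℂ (fun w => (f w - w₀)⁻¹) w :=
        (((h.analyticAt ⟨hw, hwp⟩).differentiableAt).sub_const w₀).fun_inv (hne w ⟨hw, hwp⟩)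
      refine h1.congr_of_eventuallyEq ?_
      filter_upwards [(isClosed_intTranslates p).isOpen_compl.mem_nhds hwp] with v hv
      exact hF1 v hv
  · intro u hu v hv huv
    by_cases hup : u ∈ intTranslates p <;> by_cases hvp : v ∈ intTranslates p
    · obtain ⟨k, rfl⟩ := hup
      obtain ⟨l, rfl⟩ := hvp
      exact ⟨l - k, by push_cast; ring⟩
    · rw [hF0 u hup, hF1 v hvp] at huv
      exact absurd huv.symm (inv_ne_zero (hne v ⟨hv, hvp⟩))
    · rw [hF1 u hup, hF0 v hvp] at huv
      exact absurd huv (inv_ne_zero (hne u ⟨hu, hup⟩))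
    · rw [hF1 u hup, hF1 v hvp] at huv
      exact h.injective u ⟨hu, hup⟩ v ⟨hv, hvp⟩ (sub_left_injective (inv_injective huv))
  · rw [← h.image]
    ext y
    constructor
    · rintro ⟨w, hw, rfl⟩
      by_cases hwp : w ∈ intTranslates p
      · exact Or.inl (hF0 w hwp)
      · exact Or.inr ⟨f w, mem_image_of_mem f ⟨hw, hwp⟩, (hF1 w hwp).symm⟩
    · rintro (rfl | ⟨_, ⟨w, hw, rfl⟩, rfl⟩)
      · exact ⟨p, h.pole_mem, hF0 p (mem_intTranslates_self p)⟩
      · exact ⟨w, hw.1, hF1 w hw.2⟩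

/-- The change of variable ζ = exp(-2πiw) has modulus exp(2π Im w), so it identifies the strip
modulo 1 with the annulus of inner radius exp(-2πm), and f descends to it. -/
theorem hasConformalModule (h : IsSlitMap m A p z f) : HasConformalModule (slits A) m := by
  have hm := h.width_pos
  have hpi := Real.pi_pos
  have h10 : ((-1 : ℝ)) ≠ 0 := by norm_num
  have hper : Function.Periodic f ((-1 : ℝ) : ℂ) := by
    have := h.periodic.neg
    simpa using this
  -- The period is taken to be -1 so that the lower half plane, not the upper, goes into the unit
  -- disc.
  set Q : ℂ → ℂ := Function.Periodic.qParam (-1) with hQ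
  set g : ℂ → ℂ := Function.Periodic.cuspFunction (-1) f with hg
  have hgQ : ∀ w, g (Q w) = f w := Function.Periodic.eq_cuspFunction h10 hper
  have hnorm : ∀ w, ‖Q w‖ = Real.exp (2 * Real.pi * w.im) := fun w => by
    rw [hQ, Function.Periodic.norm_qParam]
    congr 1
    ring
  have hQmem : ∀ w, Q w ∈ annulus (Real.exp (-(2 * Real.pi * m))) ↔ w ∈ strip m := by
    intro w
    simp only [annulus, strip, mem_ofPred_eq, hnorm, Real.exp_lt_exp, Real.exp_lt_one_iff]
    constructor
    · rintro ⟨h1, h2⟩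
      exact ⟨by nlinarith, by nlinarith⟩
    · rintro ⟨h1, h2⟩
      exact ⟨by nlinarith, by nlinarith⟩
  have hQeq : ∀ u v, Q u = Q v → ∃ n : ℤ, v = u + n := by
    intro u v huv
    obtain ⟨k, hk⟩ := Function.Periodic.qParam_left_inv_mod_period h10 u
    obtain ⟨l, hl⟩ := Function.Periodic.qParam_left_inv_mod_period h10 v
    have h1 : Function.Periodic.invQParam (-1) (Q u) = Function.Periodic.invQParam (-1) (Q v) := by
      rw [huv]
    rw [hQ, hk, hl] at h1
    exact ⟨l - k, by push_cast at h1 ⊢; linear_combination -h1⟩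
  have hQper : ∀ w (n : ℤ), Q (w + n) = Q w := by
    intro w n
    rw [hQ, Function.Periodic.qParam, Function.Periodic.qParam, Complex.exp_eq_exp_iff_exists_int]
    exact ⟨-n, by push_cast; ring⟩
  have hQsurj : ∀ ζ ∈ annulus (Real.exp (-(2 * Real.pi * m))), ∃ w ∈ strip m, Q w = ζ := by
    intro ζ hζ
    have hζ0 : ζ ≠ 0 := norm_pos_iff.1 ((Real.exp_pos _).trans hζ.1)
    have h1 := Function.Periodic.qParam_right_inv h10 hζ0
    exact ⟨_, (hQmem _).1 (by rw [hQ, h1]; exact hζ), h1⟩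
  have hpoles : ∀ w, Q w = Q p ↔ w ∈ intTranslates p := by
    intro w
    constructor
    · intro hw
      obtain ⟨n, hn⟩ := hQeq p w hw.symm
      exact ⟨n, hn⟩
    · rintro ⟨n, rfl⟩
      exact hQper p n
  refine ⟨Real.exp (-(2 * Real.pi * m)), Real.exp_pos _, ?_, ?_, g, Q p, (hQmem p).2 h.pole_mem,
    ?_, ?_, ?_, ?_, ?_⟩
  · rw [Real.exp_lt_one_iff]
    have : 0 < 2 * Real.pi * m := by positivity
    linarith
  · rw [← Real.exp_neg, Real.log_exp]
    field_simp
  · rintro ζ ⟨hζ, hζp⟩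
    obtain ⟨w, hw, rfl⟩ := hQsurj ζ hζ
    have hwp : w ∉ intTranslates p := fun hc => hζp ((hpoles w).2 hc)
    exact (Function.Periodic.differentiableAt_cuspFunction h10 hper
      (h.analyticAt ⟨hw, hwp⟩).differentiableAt).differentiableWithinAt
  -- Q is a local homeomorphism at p, so the limit of f at p becomes the limit of g at Q p.
  · have hstrict : HasStrictDerivAt Q (deriv Q p) p :=
      ((Function.Periodic.differentiable_qParam (h := -1)).analyticAt p).hasStrictDerivAt
    have hd : deriv Q p ≠ 0 := by
      have : HasDerivAt Q (Q p * (2 * Real.pi * Complex.I / ((-1 : ℝ) : ℂ))) p := by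
        simpa only [id_eq, mul_one] using!
          (((hasDerivAt_id p).const_mul (2 * Real.pi * Complex.I)).div_const ((-1 : ℝ) : ℂ)).cexp
      rw [this.deriv]
      exact mul_ne_zero (Complex.exp_ne_zero _)
        (div_ne_zero Complex.two_pi_I_ne_zero (by exact_mod_cast h10))
    intro S hS
    have h1 := mem_nhdsWithin_iff_eventually.1 (h.pole hS)
    rw [mem_map, mem_nhdsWithin_iff_eventually, ← hstrict.map_nhds_eq hd, eventually_map]
    filter_upwards [h1] with w hw hwQ
    rw [mem_preimage, hgQ]
    refine hw fun hwp => hwQ ?_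
    rw [mem_singleton_iff] at hwp ⊢
    rw [hwp]
  · rintro ζ ⟨hζ, hζp⟩
    obtain ⟨w, hw, rfl⟩ := hQsurj ζ hζ
    rw [hgQ, ← h.image]
    exact mem_image_of_mem f ⟨hw, fun hc => hζp ((hpoles w).2 hc)⟩
  · rintro ζ ⟨hζ, hζp⟩ ξ ⟨hξ, hξp⟩ heq
    obtain ⟨u, hu, rfl⟩ := hQsurj ζ hζ
    obtain ⟨v, hv, rfl⟩ := hQsurj ξ hξ
    rw [hgQ, hgQ] at heq
    obtain ⟨n, rfl⟩ := h.injective u ⟨hu, fun hc => hζp ((hpoles u).2 hc)⟩ v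
      ⟨hv, fun hc => hξp ((hpoles v).2 hc)⟩ heq
    exact (hQper u n).symm
  · intro y hy
    rw [← h.image] at hy
    obtain ⟨w, ⟨hw, hwp⟩, rfl⟩ := hy
    exact ⟨Q w, ⟨(hQmem w).2 hw, fun hc => hwp ((hpoles w).1 hc)⟩, hgQ w⟩

end IsSlitMap

/-- The same inversion as for the strip parametrization, with the same centre w₀, so that the two
finite maps have equal images. -/
theorem exists_finite_annulus_param {K : Set ℂ} {q : ℝ} {g : ℂ → ℂ} {a : ℂ} (ha : a ∈ annulus q)
    (hd : DifferentiableOn ℂ g (annulus q \ {a}))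
    (hpole : Tendsto g (𝓝[≠] a) (Bornology.cobounded ℂ)) (hbij : BijOn g (annulus q \ {a}) Kᶜ)
    {w₀ : ℂ} (hw₀ : w₀ ∈ K) :
    ∃ G : ℂ → ℂ, DifferentiableOn ℂ G (annulus q) ∧ InjOn G (annulus q) ∧
      G '' annulus q = insert 0 ((fun w => (w - w₀)⁻¹) '' Kᶜ) := by
  classical
  set G : ℂ → ℂ := Function.update (fun ζ => (g ζ - w₀)⁻¹) a 0 with hG
  have hGa : G a = 0 := by simp [hG]
  have hGζ : ∀ ζ, ζ ≠ a → G ζ = (g ζ - w₀)⁻¹ := fun ζ hζ => by rw [hG, Function.update_of_ne hζ]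
  have hne : ∀ ζ ∈ annulus q, ζ ≠ a → g ζ - w₀ ≠ 0 := fun ζ hζ hζa h0 =>
    hbij.mapsTo ⟨hζ, hζa⟩ (by rw [sub_eq_zero.1 h0]; exact hw₀)
  have hopen : IsOpen (annulus q \ {a}) := (isOpen_annulus q).sdiff isClosed_singleton
  refine ⟨G, ?_, ?_, ?_⟩
  · intro ζ hζ
    refine DifferentiableAt.differentiableWithinAt ?_
    by_cases hζa : ζ = a
    · subst hζa
      refine (analyticAt_of_eventuallyEq_inv_sub (w₀ := w₀) hGa ?_ ?_ hpole).differentiableAt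
      · filter_upwards [self_mem_nhdsWithin] with ξ hξ
        exact hGζ ξ hξ
      · filter_upwards [self_mem_nhdsWithin, mem_nhdsWithin_of_mem_nhds
          ((isOpen_annulus q).mem_nhds hζ)] with ξ hξ hξq
        exact hd.differentiableAt (hopen.mem_nhds ⟨hξq, hξ⟩)
    · have h1 : DifferentiableAt ℂ (fun ζ => (g ζ - w₀)⁻¹) ζ :=
        ((hd.differentiableAt (hopen.mem_nhds ⟨hζ, hζa⟩)).sub_const w₀).fun_inv (hne ζ hζ hζa)
      refine h1.congr_of_eventuallyEq ?_
      filter_upwards [isOpen_compl_singleton.mem_nhds hζa] with ξ hξ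
      exact hGζ ξ hξ
  · intro ζ hζ ξ hξ heq
    by_cases hζa : ζ = a <;> by_cases hξa : ξ = a
    · rw [hζa, hξa]
    · rw [hζa, hGa, hGζ ξ hξa] at heq
      exact absurd heq.symm (inv_ne_zero (hne ξ hξ hξa))
    · rw [hξa, hGa, hGζ ζ hζa] at heq
      exact absurd heq (inv_ne_zero (hne ζ hζ hζa))
    · rw [hGζ ζ hζa, hGζ ξ hξa] at heq
      exact hbij.injOn ⟨hζ, hζa⟩ ⟨hξ, hξa⟩ (sub_left_injective (inv_injective heq))
  · rw [← hbij.image_eq]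
    ext y
    constructor
    · rintro ⟨ζ, hζ, rfl⟩
      by_cases hζa : ζ = a
      · exact Or.inl (by rw [hζa, hGa])
      · exact Or.inr ⟨g ζ, mem_image_of_mem g ⟨hζ, hζa⟩, (hGζ ζ hζa).symm⟩
    · rintro (rfl | ⟨_, ⟨ζ, hζ, rfl⟩, rfl⟩)
      · exact ⟨a, ha, hGa⟩
      · exact ⟨ζ, hζ.1, hGζ ζ hζ.2⟩

/-- Two conformal parametrizations of the same domain, by a strip modulo `1` and by an annulus, differ
by a conformal map of the strip modulo `1` onto the annulus. -/
theorem exists_isAnnulusParam {m q : ℝ} (hm : 0 < m) (hq0 : 0 < q) (hq1 : q < 1) {F G : ℂ → ℂ}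
    (hF : DifferentiableOn ℂ F (strip m)) (hper : Function.Periodic F 1)
    (hFinj : ∀ u ∈ strip m, ∀ v ∈ strip m, F u = F v → ∃ n : ℤ, v = u + n)
    (hG : DifferentiableOn ℂ G (annulus q)) (hGinj : InjOn G (annulus q))
    (himg : F '' strip m = G '' annulus q) : ∃ φ, IsAnnulusParam m q φ := by
  set φ : ℂ → ℂ := fun w => Function.invFunOn G (annulus q) (F w) with hφ
  have hmem : ∀ w ∈ strip m, F w ∈ G '' annulus q := fun w hw => by
    rw [← himg]; exact mem_image_of_mem F hw
  have hφmem : ∀ w ∈ strip m, φ w ∈ annulus q := fun w hw => Function.invFunOn_mem (hmem w hw)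
  have hGφ : ∀ w ∈ strip m, G (φ w) = F w := fun w hw => Function.invFunOn_eq (hmem w hw)
  refine ⟨φ, hm, hq0, hq1, ?_, hφmem, fun w => by simp only [hφ, hper w], ?_, ?_⟩
  · intro w hw
    have han : AnalyticAt ℂ G (φ w) :=
      hG.analyticAt ((isOpen_annulus q).mem_nhds (hφmem w hw))
    have hd := han.deriv_ne_zero_of_injOn ((isOpen_annulus q).mem_nhds (hφmem w hw)) hGinj
    have hs := han.hasStrictDerivAt
    -- `Function.invFunOn` carries no regularity. By injectivity of G it agrees near F w with the
    -- local inverse, and this makes φ holomorphic.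
    set L := hs.localInverse _ _ _ hd with hL
    have hL' : HasStrictDerivAt L (deriv G (φ w))⁻¹ (G (φ w)) := hs.to_localInverse hd
    have hLφ : L (G (φ w)) = φ w := (HasStrictDerivAt.eventually_left_inverse hs hd).self_of_nhds
    have hGL : ∀ᶠ y in 𝓝 (G (φ w)), G (L y) = y := HasStrictDerivAt.eventually_right_inverse hs hd
    have hLm : ∀ᶠ y in 𝓝 (G (φ w)), L y ∈ annulus q := by
      refine hL'.hasDerivAt.continuousAt.eventually_mem ?_
      rw [hLφ]
      exact (isOpen_annulus q).mem_nhds (hφmem w hw)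
    rw [hGφ w hw] at hL' hGL hLm
    have hFw := hF.differentiableAt ((isOpen_strip m).mem_nhds hw)
    have h1 : DifferentiableAt ℂ (fun v => L (F v)) w :=
      DifferentiableAt.fun_comp' w hL'.hasDerivAt.differentiableAt hFw
    refine (h1.congr_of_eventuallyEq ?_).differentiableWithinAt
    filter_upwards [hFw.continuousAt.eventually hGL, hFw.continuousAt.eventually hLm,
      (isOpen_strip m).mem_nhds hw] with v h2 h3 h4
    exact hGinj (hφmem v h4) h3 ((hGφ v h4).trans h2.symm)
  · intro u hu v hv huv
    exact hFinj u hu v hv (by rw [← hGφ u hu, ← hGφ v hv, huv])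
  · intro ζ hζ
    have : G ζ ∈ F '' strip m := by rw [himg]; exact mem_image_of_mem G hζ
    obtain ⟨w, hw, hw'⟩ := this
    exact ⟨w, hw, hGinj (hφmem w hw) hζ ((hGφ w hw).trans hw')⟩

namespace IsSlitMap

variable {m : ℝ} {A : Fin 4 → ℂ} {p : ℂ} {z : Fin 4 → ℂ} {f : ℂ → ℂ}

/-- After inversion at a point of a slit both parametrizations are finite with the same image, and
`IsAnnulusParam.width_eq` applies to the transition map between them. -/
theorem eq_of_hasConformalModule (h : IsSlitMap m A p z f) {m' : ℝ}
    (h' : HasConformalModule (slits A) m') : m' = m := by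
  obtain ⟨q, hq0, hq1, hm', g, a, ha, hd, hpole, hbij⟩ := h'
  have hw₀ : A 0 ∈ slits A := Or.inl (left_mem_segment ℝ _ _)
  obtain ⟨F, hF, hper, hFinj, hFimg⟩ := h.exists_finite_param hw₀
  obtain ⟨G, hG, hGinj, hGimg⟩ := exists_finite_annulus_param ha hd hpole hbij hw₀
  obtain ⟨φ, hφ⟩ := exists_isAnnulusParam h.width_pos hq0 hq1 hF hper hFinj hG hGinj
    (hFimg.trans hGimg.symm)
  rw [hm', hφ.width_eq]

theorem conformalModule_eq (h : IsSlitMap m A p z f) : conformalModule (slits A) = m := by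
  have hex : ∃ m, HasConformalModule (slits A) m := ⟨m, h.hasConformalModule⟩
  rw [conformalModule, dif_pos hex]
  exact h.eq_of_hasConformalModule hex.choose_spec

end IsSlitMap

theorem corollary1 (I : Set ℝ) (m : ℝ → ℝ) (A : Fin 4 → ℝ → ℂ) (p : ℝ → ℂ)
    (z : Fin 4 → ℝ → ℂ) (f : ℝ → ℂ → ℂ) (hf : IsSmoothSlitFamily I m A p z f)
    (t : ℝ) (ht : t ∈ I) :
    conformalModule (slits fun k => A k t) = m t ∧
      (∀ k, iteratedDeriv 2 (f t) (z k t) ≠ 0) ∧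
      HasDerivAt (fun s => ((conformalModule (slits fun k => A k s) : ℝ) : ℂ))
        (Real.pi * ∑ k, slitGamma A z f k t) t := by
  have h := hf.isSlitMap t ht
  refine ⟨h.conformalModule_eq, h.iteratedDeriv_endpoint_ne_zero, ?_⟩
  have hd : HasDerivAt (fun s => ((m s : ℝ) : ℂ)) (Real.pi * ∑ k, slitGamma A z f k t) t := by
    rw [← hf.deriv_width ht]
    exact (hf.differentiableAt_width ht).hasDerivAt.ofReal_comp
  refine hd.congr_of_eventuallyEq ?_
  filter_upwards [hf.eventually_mem ht] with s hs
  rw [(hf.isSlitMap s hs).conformalModule_eq]
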